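/- Let the scalar field be $\mathbb R$ or $\mathbb C$, let $m$ be Lebesgue measure, and let $S(0,\infty)$ be the space of (classes of) measurable scalar functions $x$ on $(0,\infty)$ with $m(\{|x|>s\})<\infty$ for some $s>0$. For $x\in S(0,\infty)$ let $\mu(t;x)=\inf\{s\ge 0: m(\{|x|>s\})\le t\}$, $t>0$, be its decreasing rearrangement. A symmetric function space $E=E(0,\infty)$ is a linear subspace of $S(0,\infty)$ with a complete norm $\|\cdot\|_E$ such that $x\in S(0,\infty)$, $y\in E$ and $\mu(t;x)\le\mu(t;y)$ for all $t>0$ imply $x\in E$ and $\|x\|_E\le\|y\|_E$. It is a symmetric KB-function space if, in addition, its norm is order continuous ($\|x_\alpha\|_E\to0$ for every decreasing net $0\le x_\alpha\downarrow 0$ in $E$) and it has the Fatou property (every increasing net $0\le x_\beta$ in $E$ with $\sup_\beta\|x_\beta\|_E<\infty$ has a supremum $x\in E$, and $\|x\|_E=\sup_\beta\|x_\beta\|_E$). Let $C_0(0,\infty)=\{f\in L_\infty(0,\infty):\lim_{t\to\infty}\mu(t;f)=0\}$, and let $E(0,1)$ be the set of those $f\in L_1(0,1)$ whose extension by zero to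 $(0,\infty)$ belongs to $E(0,\infty)$. Let $E(0,\infty)$ be a symmetric function space such that $E(0,\infty)\cap L_\infty(0,\infty)\subsetneqq C_0(0,\infty)$. Then there exists a symmetric KB-function space $F(0,\infty)$ with $E(0,\infty)\subset F(0,\infty)$. If, in addition, $E(0,1)\ne L_1(0,1)$ as sets, then $F(0,\infty)$ can be chosen to be, moreover, a reflexive Banach space. -/

import Mathlib

open MeasureTheory Filter Topology Set
open scoped ENNReal ComplexOrder

noncomputable section

/-- Lebesgue measure on the half-line `(0, ∞)`. -/
abbrev halfLine : Measure ℝ := volume.restrict (Ioi (0 : ℝ))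

/-- Lebesgue measure on the interval `(0, 1)`. -/
abbrev unitInt : Measure ℝ := volume.restrict (Ioo (0 : ℝ) 1)

/-- The space `S(0, ∞)`: (classes of) measurable functions on `(0, ∞)` that are bounded outside a
set of finite measure. -/
def finiteDistribution (𝕜 : Type*) [RCLike 𝕜] : Set (ℝ →ₘ[halfLine] 𝕜) :=
  {x | ∃ s : ℝ, 0 < s ∧ halfLine {u | s < ‖x u‖} < ∞}

/-- The decreasing rearrangement `μ(t; x) = inf {s ≥ 0 : m {|x| > s} ≤ t}`, with values in
`[0, ∞]`; it is finite for `t > 0` and `x` in `S(0, ∞)`. -/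
def rearrangement {𝕜 : Type*} [RCLike 𝕜] (x : ℝ →ₘ[halfLine] 𝕜) (t : ℝ) : ℝ≥0∞ :=
  sInf {s : ℝ≥0∞ | halfLine {u | s < ‖x u‖ₑ} ≤ ENNReal.ofReal t}

/-- The space `C₀(0, ∞)` of essentially bounded functions `x` with `μ(t; x) → 0` as `t → ∞`. -/
def C0HalfLine (𝕜 : Type*) [RCLike 𝕜] : Set (ℝ →ₘ[halfLine] 𝕜) :=
  {x | x ∈ Lp 𝕜 ∞ halfLine ∧ Tendsto (rearrangement x) atTop (𝓝 0)}

/-- A linear space of (classes of) measurable functions on `(0, ∞)` with a norm. -/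
structure NormedFunctionSpace (𝕜 : Type*) [RCLike 𝕜] where
  carrier : Submodule 𝕜 (ℝ →ₘ[halfLine] 𝕜)
  nrm : Seminorm 𝕜 carrier
  eq_zero_of_nrm : ∀ x, nrm x = 0 → x = 0

namespace NormedFunctionSpace

instance {𝕜 : Type*} [RCLike 𝕜] (E : NormedFunctionSpace 𝕜) : NormedAddCommGroup E.carrier :=
  AddGroupNorm.toNormedAddCommGroup
    { E.nrm.toAddGroupSeminorm with
      eq_zero_of_map_eq_zero' := E.eq_zero_of_nrm }

instance {𝕜 : Type*} [RCLike 𝕜] (E : NormedFunctionSpace 𝕜) : NormedSpace 𝕜 E.carrier where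
  norm_smul_le a x := (map_smul_eq_mul E.nrm a x).le

/-- `E` is a symmetric function space on `(0, ∞)`: a subspace of `S(0, ∞)` with a complete norm
such that `x ∈ S(0, ∞)`, `y ∈ E` and `μ(x) ≤ μ(y)` imply `x ∈ E` and `‖x‖ ≤ ‖y‖`. -/
structure IsSymmetric {𝕜 : Type*} [RCLike 𝕜] (E : NormedFunctionSpace 𝕜) : Prop where
  subset_finiteDistribution : (E.carrier : Set (ℝ →ₘ[halfLine] 𝕜)) ⊆ finiteDistribution 𝕜
  complete : CompleteSpace E.carrier
  symmetric : ∀ x ∈ finiteDistribution 𝕜, ∀ y : E.carrier,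
    (∀ t : ℝ, 0 < t → rearrangement x t ≤ rearrangement (y : ℝ →ₘ[halfLine] 𝕜) t) →
      ∃ hx : x ∈ E.carrier, ‖(⟨x, hx⟩ : E.carrier)‖ ≤ ‖y‖

/-- Order continuity of the norm: `‖x_α‖ → 0` for every net `x_α ↓ 0` of positive elements.
A decreasing net is given here by its range, a downwards directed set `D`; the norms decrease
along the net, so they tend to `0` if and only if they become arbitrarily small. -/
def HasOrderContinuousNorm {𝕜 : Type*} [RCLike 𝕜] (E : NormedFunctionSpace 𝕜) : Prop :=
  ∀ D : Set E.carrier, D.Nonempty → DirectedOn (fun a b => b ≤ a) D → (∀ x ∈ D, 0 ≤ x) →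
    IsGLB D 0 → ∀ ε : ℝ, 0 < ε → ∃ x ∈ D, ‖x‖ < ε

/-- The Fatou property: every norm bounded increasing net of positive elements has a supremum in
`E`, whose norm is the supremum of the norms. An increasing net is given by its range, an upwards
directed set `D`. -/
def HasFatouProperty {𝕜 : Type*} [RCLike 𝕜] (E : NormedFunctionSpace 𝕜) : Prop :=
  ∀ D : Set E.carrier, D.Nonempty → DirectedOn (fun a b => a ≤ b) D → (∀ x ∈ D, 0 ≤ x) →
    BddAbove (norm '' D) → ∃ x : E.carrier, 0 ≤ x ∧ IsLUB D x ∧ IsLUB (norm '' D) ‖x‖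

/-- A symmetric `KB`-function space: a symmetric function space with the Fatou property and
order continuous norm. -/
structure IsSymmetricKB {𝕜 : Type*} [RCLike 𝕜] (E : NormedFunctionSpace 𝕜) : Prop where
  isSymmetric : E.IsSymmetric
  fatou : E.HasFatouProperty
  orderContinuous : E.HasOrderContinuousNorm

/-- Reflexivity: the canonical embedding into the second dual is onto. -/
def IsReflexive {𝕜 : Type*} [RCLike 𝕜] (E : NormedFunctionSpace 𝕜) : Prop :=
  Function.Surjective (NormedSpace.inclusionInDoubleDual 𝕜 E.carrier)

end NormedFunctionSpace

/-- Extension by zero of a function on `(0, 1)` to `(0, ∞)`. -/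
def zeroExtend {𝕜 : Type*} [RCLike 𝕜] (f : ℝ →ₘ[unitInt] 𝕜) : ℝ →ₘ[halfLine] 𝕜 :=
  AEEqFun.mk ((Ioo (0 : ℝ) 1).indicator f)
    (((aestronglyMeasurable_indicator_iff measurableSet_Ioo).2 f.aestronglyMeasurable).restrict)

/-- The space `E(0, 1)`, as a set of functions: those `f ∈ L₁(0, 1)` whose extension by zero
belongs to `E`. -/
def NormedFunctionSpace.onUnitInterval {𝕜 : Type*} [RCLike 𝕜] (E : NormedFunctionSpace 𝕜) :
    Set (ℝ →ₘ[unitInt] 𝕜) :=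
  {f | f ∈ Lp 𝕜 1 unitInt ∧ zeroExtend f ∈ E.carrier}

end

/-! The space `F` is built from `K(t, f) = ∫₀ᵗ μ(r; f) dr`: for weights `c` and arguments `t`,
`KWeights.space` consists of the `f` with `∑ (c k * K(t k, f))² < ∞`. Symmetry, completeness and the
Fatou property are inherited from `K`, whatever the weights. If moreover `∑ (c k * t k)² = ∞`, a
level set `{|f| > s}` of infinite measure would make the norm infinite; so all level sets have
finite measure, and dominated convergence gives order continuity (`isSymmetricKB_space`).

To fit a nonzero `E` inside, let `φ(t)` be the norm in `E` of the indicator of `(0, t]`. Averaging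
over cyclic rotations of step functions gives `φ(t) K(t, x) ≤ t ‖x‖` (`norm_box_mul_kFun_le`). If
`φ` were bounded near `∞`, summing dyadic layers would put all of `C₀` into `E`. Hence there are
`t_k ≥ 2^k` with `K(t_k, x) / t_k ≤ 2^(-k) ‖x‖` on `E` (`exists_large`), and the weights `1 / t_k`
give the first `F`. Similarly, if `E(0, 1) ≠ L₁(0, 1)`, then `φ(s) / s` is unbounded near `0`, and
there are `s_k ≤ 2^(-k)` with `K(s_k, x) ≤ 2^(-k) ‖x‖` (`exists_small`); the terms `K(s_k, ·)` are
added with weight `1`.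

Reflexivity (`isReflexive_space`) rests on three sums. From `∑ c² t < ∞` it follows that `L₂ ⊆ F`.
From `∑ c² = ∞` and `∑ (c t)² = ∞` it follows that `K(δ, ·)` and `K(T, ·) / T` are uniformly small
on the unit ball of `F` for suitable `δ` and `T`, so that truncation approximates the ball, in `L₁ +
L_∞`, by bounded subsets of `L₂`. Weak limits in `L₂` then yield a candidate in `F` for each element
of the bidual. Since the norm is an `ℓ₂`-sum, the functionals bounded for the `L₁ + L_∞` norm are
dense in the dual (`exists_dual_approx`), and they identify the candidate
(`surjective_inclusionInDoubleDual`). -/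

noncomputable section

/-! ### The K-functional of the couple (L₁, L_∞) -/

/-- The `K`-functional of the couple `(L₁, L_∞)`, in layer-cake form: the integral over `(0, t)` of
the decreasing rearrangement of `f`. -/
def kFun {α : Type*} [MeasurableSpace α] (ν : Measure α) (t : ℝ≥0∞) (f : α → ℝ≥0∞) : ℝ≥0∞ :=
  ∫⁻ s in Ioi (0 : ℝ), min t (ν {u | ENNReal.ofReal s < f u})

section KFunctional

variable {α : Type*} [MeasurableSpace α] {ν : Measure α}

lemma antitone_distribution (f : α → ℝ≥0∞) :
    Antitone fun s : ℝ => ν {u | ENNReal.ofReal s < f u} := fun _ _ h =>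
  measure_mono fun _ hu => (ENNReal.ofReal_le_ofReal h).trans_lt hu

lemma measurable_distribution (f : α → ℝ≥0∞) :
    Measurable fun s : ℝ => ν {u | ENNReal.ofReal s < f u} :=
  (antitone_distribution f).measurable

lemma kFun_mono_distribution {t : ℝ≥0∞} {f g : α → ℝ≥0∞}
    (h : ∀ s : ℝ, 0 < s → ν {u | ENNReal.ofReal s < f u} ≤ ν {u | ENNReal.ofReal s < g u}) :
    kFun ν t f ≤ kFun ν t g :=
  setLIntegral_mono' measurableSet_Ioi fun s hs => min_le_min le_rfl (h s hs)

lemma kFun_mono {t : ℝ≥0∞} {f g : α → ℝ≥0∞} (h : f ≤ᵐ[ν] g) : kFun ν t f ≤ kFun ν t g :=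
  kFun_mono_distribution fun s _ => measure_mono_ae <| by
    filter_upwards [h] with u hu
    exact fun (hs : _ < _) => hs.trans_le hu

lemma kFun_congr {t : ℝ≥0∞} {f g : α → ℝ≥0∞} (h : f =ᵐ[ν] g) : kFun ν t f = kFun ν t g :=
  le_antisymm (kFun_mono h.le) (kFun_mono h.symm.le)

lemma kFun_mono_left {t t' : ℝ≥0∞} (f : α → ℝ≥0∞) (h : t ≤ t') : kFun ν t f ≤ kFun ν t' f :=
  lintegral_mono fun _ => min_le_min h le_rfl

/-- The `K`-functional commutes with increasing suprema. -/
lemma kFun_iSup (t : ℝ≥0∞) {f : ℕ → α → ℝ≥0∞} (hf : Monotone f) :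
    kFun ν t (fun u => ⨆ n, f n u) = ⨆ n, kFun ν t (f n) := by
  unfold kFun
  rw [← lintegral_iSup]
  · refine lintegral_congr fun s => ?_
    have : {u | ENNReal.ofReal s < ⨆ n, f n u} = ⋃ n, {u | ENNReal.ofReal s < f n u} := by
      ext u; simp [lt_iSup_iff]
    rw [this, Monotone.measure_iUnion, inf_iSup_eq]
    exact fun m n h u (hu : _ < _) => hu.trans_le (hf h u)
  · exact fun n => measurable_const.min (measurable_distribution _)
  · exact fun m n h s => min_le_min le_rfl (measure_mono fun u (hu : _ < _) => hu.trans_le (hf h u))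

/-- Layer-cake formula for `(f - a)₊`. -/
lemma lintegral_tsub_const_eq [SFinite ν] {f : α → ℝ≥0∞} (hf : AEMeasurable f ν) {a : ℝ}
    (ha : 0 ≤ a) :
    ∫⁻ u, (f u - ENNReal.ofReal a) ∂ν = ∫⁻ s in Ioi a, ν {u | ENNReal.ofReal s < f u} := by
  wlog hm : Measurable f generalizing f
  · have h := this hf.measurable_mk.aemeasurable hf.measurable_mk
    have e := hf.ae_eq_mk
    rw [lintegral_congr_ae (e.mono fun u hu => by rw [hu]), h]
    refine lintegral_congr fun s => measure_congr ?_
    filter_upwards [e] with u hu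
    change (_ < _) = (_ < _)
    rw [hu]
  have key : ∀ u, f u - ENNReal.ofReal a
      = ∫⁻ s in Ioi a, ({s : ℝ | ENNReal.ofReal s < f u}.indicator 1 s : ℝ≥0∞) := by
    intro u
    rw [lintegral_indicator_one (measurableSet_lt (by fun_prop) (by fun_prop)),
      Measure.restrict_apply (measurableSet_lt (by fun_prop) (by fun_prop))]
    by_cases hu : f u = ∞
    · have : {s : ℝ | ENNReal.ofReal s < f u} ∩ Ioi a = Ioi a := by
        ext s; simp [hu]
      rw [this, hu]; simp
    · have : {s : ℝ | ENNReal.ofReal s < f u} ∩ Ioi a = Ioo a (f u).toReal := by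
        ext s
        simp only [mem_inter_iff, mem_ofPred_eq, mem_Ioi, mem_Ioo]
        constructor
        · rintro ⟨h1, h2⟩
          exact ⟨h2, (ENNReal.ofReal_lt_iff_lt_toReal (ha.trans h2.le) hu).1 h1⟩
        · rintro ⟨h1, h2⟩
          exact ⟨(ENNReal.ofReal_lt_iff_lt_toReal (ha.trans h1.le) hu).2 h2, h1⟩
      rw [this, Real.volume_Ioo, ENNReal.ofReal_sub _ ha, ENNReal.ofReal_toReal hu]
  rw [lintegral_congr key, lintegral_lintegral_swap]
  · refine lintegral_congr fun s => ?_
    have : ∀ u, ({s : ℝ | ENNReal.ofReal s < f u}.indicator 1 s : ℝ≥0∞)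
        = {u | ENNReal.ofReal s < f u}.indicator 1 u := by
      intro u; simp [indicator]
    rw [lintegral_congr this, lintegral_indicator_one (measurableSet_lt measurable_const hm)]
  · have : (Function.uncurry fun (u : α) (s : ℝ) =>
        ({s : ℝ | ENNReal.ofReal s < f u}.indicator 1 s : ℝ≥0∞))
        = {p : α × ℝ | ENNReal.ofReal p.2 < f p.1}.indicator 1 := by
      ext p; simp [indicator, Function.uncurry]
    rw [this]
    exact (measurable_one.indicator (measurableSet_lt (by fun_prop) (by fun_prop))).aemeasurable

lemma lintegral_eq_lintegral_distribution [SFinite ν] {f : α → ℝ≥0∞} (hf : AEMeasurable f ν) :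
    ∫⁻ u, f u ∂ν = ∫⁻ s in Ioi (0 : ℝ), ν {u | ENNReal.ofReal s < f u} := by
  simpa using lintegral_tsub_const_eq hf le_rfl

lemma lintegral_Ioi_eq_add {g : ℝ → ℝ≥0∞} {a : ℝ} (ha : 0 ≤ a) :
    ∫⁻ s in Ioi (0 : ℝ), g s = (∫⁻ s in Ioc 0 a, g s) + ∫⁻ s in Ioi a, g s := by
  rw [← Ioc_union_Ioi_eq_Ioi ha, lintegral_union measurableSet_Ioi]
  exact Set.disjoint_left.2 fun x hx hx' => (not_lt.2 hx.2) hx'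

/-- Splitting the layer-cake integral at `a`, the minimum is bounded by `t` below `a` and by the
distribution function above it. This is the easy half of the infimum formula for `K`. -/
lemma kFun_le_add [SFinite ν] {t : ℝ≥0∞} {f : α → ℝ≥0∞} (hf : AEMeasurable f ν) {a : ℝ}
    (ha : 0 ≤ a) :
    kFun ν t f ≤ t * ENNReal.ofReal a + ∫⁻ u, (f u - ENNReal.ofReal a) ∂ν := by
  rw [kFun, lintegral_Ioi_eq_add ha, lintegral_tsub_const_eq hf ha]
  gcongr
  · calc _ ≤ ∫⁻ s in Ioc 0 a, t := lintegral_mono fun _ => min_le_left _ _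
      _ = _ := by simp
  · exact min_le_right _ _

/-- Right continuity of the distribution function: the level set at `a` is the increasing union of
the level sets at levels decreasing to `a`. -/
lemma distribution_tendsto (f : α → ℝ≥0∞) (a : ℝ) {t : ℝ≥0∞}
    (h : ∀ s > a, ν {u | ENNReal.ofReal s < f u} ≤ t) : ν {u | ENNReal.ofReal a < f u} ≤ t := by
  obtain ⟨v, hv, hv', hvt⟩ := exists_seq_strictAnti_tendsto a
  have : {u | ENNReal.ofReal a < f u} ⊆ ⋃ n, {u | ENNReal.ofReal (v n) < f u} := by
    intro u hu
    have := (ENNReal.continuous_ofReal.tendsto a).comp hvt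
    obtain ⟨n, hn⟩ := (this.eventually (gt_mem_nhds (show ENNReal.ofReal a < f u from hu))).exists
    exact mem_iUnion.2 ⟨n, hn⟩
  refine (measure_mono this).trans ?_
  rw [Monotone.measure_iUnion]
  · exact iSup_le fun n => h _ (hv' n)
  · exact fun m n hmn u (hu : _ < _) =>
      (ENNReal.ofReal_le_ofReal (hv.antitone hmn)).trans_lt hu

/-- The infimum over `a` of `t a + ∫ (f - a)₊` is attained, and is equal to the `K`-functional. -/
lemma exists_kFun_eq_add [SFinite ν] {t : ℝ≥0∞} (ht : t ≠ 0) {f : α → ℝ≥0∞}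
    (hf : AEMeasurable f ν) (hK : kFun ν t f ≠ ∞) :
    ∃ a : ℝ, 0 ≤ a ∧
      kFun ν t f = t * ENNReal.ofReal a + ∫⁻ u, (f u - ENNReal.ofReal a) ∂ν := by
  -- The optimal level is `sInf S`, the value at `t` of the decreasing rearrangement: below it the
  -- minimum in the integrand is `t`, above it the distribution function. If `S` were empty, the
  -- integrand would be `t` everywhere and `K` infinite.
  set S : Set ℝ := {s | 0 ≤ s ∧ ν {u | ENNReal.ofReal s < f u} ≤ t} with hS
  have hne : S.Nonempty := by
    by_contra hcon
    apply hK
    rw [kFun, setLIntegral_congr_fun (g := fun _ => t) measurableSet_Ioi]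
    · simp [ht]
    · intro s (hs : 0 < s)
      refine min_eq_left (not_lt.1 fun hlt => hcon ⟨s, hs.le, hlt.le⟩)
  have hbdd : BddBelow S := ⟨0, fun s hs => hs.1⟩
  have ha : 0 ≤ sInf S := le_csInf hne fun s hs => hs.1
  refine ⟨sInf S, ha, ?_⟩
  rw [kFun, lintegral_Ioi_eq_add ha, lintegral_tsub_const_eq hf ha]
  congr 1
  · rw [← setLIntegral_congr Ioo_ae_eq_Ioc, setLIntegral_congr_fun (g := fun _ => t)
      measurableSet_Ioo]
    · simp
    · intro s hs
      exact min_eq_left (not_lt.1 fun hlt => notMem_of_lt_csInf hs.2 hbdd ⟨hs.1.le, hlt.le⟩)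
  · refine setLIntegral_congr_fun measurableSet_Ioi fun s (hs : sInf S < s) => ?_
    obtain ⟨r, hr, hrs⟩ := exists_lt_of_csInf_lt hne hs
    exact min_eq_right ((antitone_distribution f hrs.le).trans hr.2)

/-- If `a` and `b` are optimal levels for `f` and `g`, then `a + b` is an admissible level for the
sum, and `(f + g - a - b)₊ ≤ (f - a)₊ + (g - b)₊`. -/
lemma kFun_add_le [SFinite ν] {t : ℝ≥0∞} (ht : t ≠ 0) {f g : α → ℝ≥0∞}
    (hf : AEMeasurable f ν) (hg : AEMeasurable g ν) :
    kFun ν t (fun u => f u + g u) ≤ kFun ν t f + kFun ν t g := by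
  by_cases h1 : kFun ν t f = ∞
  · simp [h1]
  by_cases h2 : kFun ν t g = ∞
  · simp [h2]
  obtain ⟨a, ha, hfa⟩ := exists_kFun_eq_add ht hf h1
  obtain ⟨b, hb, hgb⟩ := exists_kFun_eq_add ht hg h2
  refine (kFun_le_add (hf.add hg) (add_nonneg ha hb)).trans ?_
  rw [hfa, hgb, ENNReal.ofReal_add ha hb, mul_add, add_add_add_comm,
    ← lintegral_add_left' (f := fun u => f u - ENNReal.ofReal a) (hf.sub aemeasurable_const)]
  gcongr with u
  exact add_tsub_add_le_tsub_add_tsub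

lemma kFun_const_mul_le [SFinite ν] {t : ℝ≥0∞} (ht : t ≠ 0) {f : α → ℝ≥0∞}
    (hf : AEMeasurable f ν) {r : ℝ} (hr : 0 < r) :
    kFun ν t (fun u => ENNReal.ofReal r * f u) ≤ ENNReal.ofReal r * kFun ν t f := by
  have hr0 : ENNReal.ofReal r ≠ 0 := by simpa using hr
  by_cases h1 : kFun ν t f = ∞
  · simp [h1, ENNReal.mul_top hr0]
  obtain ⟨a, ha, hfa⟩ := exists_kFun_eq_add ht hf h1
  refine (kFun_le_add (hf.const_mul _) (mul_nonneg hr.le ha)).trans ?_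
  rw [hfa, ENNReal.ofReal_mul hr.le, mul_add,
    ← lintegral_const_mul'' (f := fun u => f u - ENNReal.ofReal a) _ (hf.sub aemeasurable_const)]
  refine add_le_add (mul_left_comm _ _ _).le (lintegral_mono fun u => ?_)
  dsimp only
  rw [ENNReal.mul_sub fun _ _ => ENNReal.ofReal_ne_top]

lemma kFun_zero (t : ℝ≥0∞) : kFun ν t (fun _ => 0) = 0 := by
  simp [kFun]

lemma kFun_const_mul [SFinite ν] {t : ℝ≥0∞} (ht : t ≠ 0) {f : α → ℝ≥0∞}
    (hf : AEMeasurable f ν) {r : ℝ} (hr : 0 ≤ r) :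
    kFun ν t (fun u => ENNReal.ofReal r * f u) = ENNReal.ofReal r * kFun ν t f := by
  rcases hr.eq_or_lt with rfl | hr
  · simp [kFun_zero]
  refine le_antisymm (kFun_const_mul_le ht hf hr) ?_
  have h := kFun_const_mul_le (f := fun u => ENNReal.ofReal r * f u) ht (hf.const_mul _)
    (inv_pos.2 hr)
  have hr0 : ENNReal.ofReal r ≠ 0 := by simpa using hr
  have e : ∀ x : ℝ≥0∞, ENNReal.ofReal r⁻¹ * (ENNReal.ofReal r * x) = x := fun x => by
    rw [← mul_assoc, ← ENNReal.ofReal_mul (inv_pos.2 hr).le, inv_mul_cancel₀ hr.ne']; simp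
  simp only [e] at h
  calc _ ≤ ENNReal.ofReal r * (ENNReal.ofReal r⁻¹ * kFun ν t fun u => ENNReal.ofReal r * f u) := by
        gcongr
    _ = _ := by rw [mul_left_comm, e]

lemma kFun_le_lintegral [SFinite ν] (t : ℝ≥0∞) {f : α → ℝ≥0∞} (hf : AEMeasurable f ν) :
    kFun ν t f ≤ ∫⁻ u, f u ∂ν := by
  simpa using kFun_le_add (t := t) hf le_rfl

lemma kFun_le_mul_of_le [SFinite ν] (t : ℝ≥0∞) {f : α → ℝ≥0∞} (hf : AEMeasurable f ν) {a : ℝ}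
    (ha : 0 ≤ a) (h : ∀ u, f u ≤ ENNReal.ofReal a) : kFun ν t f ≤ t * ENNReal.ofReal a := by
  refine (kFun_le_add hf ha).trans ?_
  simp [tsub_eq_zero_of_le (h _)]

/-- `K(t)/t` is decreasing. -/
lemma kFun_mul_le {t t' : ℝ≥0∞} (h : t ≤ t') (ht' : t' ≠ ∞) (f : α → ℝ≥0∞) :
    t * kFun ν t' f ≤ t' * kFun ν t f := by
  have htt : t ≠ ∞ := ne_top_of_le_ne_top ht' h
  unfold kFun
  rw [← lintegral_const_mul' _ _ htt, ← lintegral_const_mul' _ _ ht']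
  refine lintegral_mono fun s => ?_
  dsimp only
  rcases le_total t (ν {u | ENNReal.ofReal s < f u}) with h1 | h1
  · rw [min_eq_left h1, mul_comm]
    gcongr
    exact min_le_left _ _
  · rw [min_eq_right h1, min_eq_right (h1.trans h)]
    gcongr

/-- A Chebyshev inequality: the integrand of `K` is decreasing in the level, so its integral over
`(0, b]` is at least `b` times its value at `b`. -/
lemma mul_min_le_kFun (t : ℝ≥0∞) (f : α → ℝ≥0∞) (b : ℝ) :
    ENNReal.ofReal b * min t (ν {u | ENNReal.ofReal b < f u}) ≤ kFun ν t f := by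
  calc _ = ∫⁻ s in Ioc 0 b, min t (ν {u | ENNReal.ofReal b < f u}) := by
        simp [mul_comm]
    _ ≤ ∫⁻ s in Ioc 0 b, min t (ν {u | ENNReal.ofReal s < f u}) :=
        setLIntegral_mono' measurableSet_Ioc fun s hs =>
          min_le_min le_rfl (antitone_distribution f hs.2)
    _ ≤ _ := lintegral_mono_set Ioc_subset_Ioi_self

lemma ae_eq_zero_of_kFun_eq_zero {t : ℝ≥0∞} (ht : t ≠ 0) {f : α → ℝ≥0∞}
    (h : kFun ν t f = 0) : f =ᵐ[ν] 0 := by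
  have : ν {u | ENNReal.ofReal 0 < f u} ≤ 0 := by
    refine distribution_tendsto f 0 fun s hs => ?_
    have := mul_min_le_kFun (ν := ν) t f s
    rw [h, nonpos_iff_eq_zero, mul_eq_zero] at this
    rcases this with h | h
    · simp [not_le.2 hs] at h
    · rcases min_eq_iff.1 h with h | h
      · exact absurd h.1 ht
      · exact h.1.le
  rw [nonpos_iff_eq_zero] at this
  filter_upwards [measure_eq_zero_iff_ae_notMem.1 this] with u hu
  simpa using hu

lemma ae_lt_top_of_kFun_ne_top {t : ℝ≥0∞} (ht : t ≠ 0) {f : α → ℝ≥0∞}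
    (h : kFun ν t f ≠ ∞) : ∀ᵐ u ∂ν, f u < ∞ := by
  have key : ∀ b : ℝ, ENNReal.ofReal b * min t (ν {u | f u = ∞}) ≤ kFun ν t f := fun b =>
    le_trans (by gcongr with u; intro hu; simp [hu]) (mul_min_le_kFun t f b)
  have h0 : min t (ν {u | f u = ∞}) = 0 := by
    by_contra hne
    have h2 : Tendsto (fun b : ℝ => ENNReal.ofReal b * min t (ν {u | f u = ∞})) atTop (𝓝 ∞) := by
      nth_rw 2 [← ENNReal.top_mul hne]
      exact ENNReal.Tendsto.mul_const ENNReal.tendsto_ofReal_atTop (Or.inl ENNReal.top_ne_zero)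
    exact h (top_le_iff.1 (le_of_tendsto' h2 key))
  have h1 : ν {u | f u = ∞} = 0 := by
    rcases min_eq_iff.1 h0 with h | h
    · exact absurd h.1 ht
    · exact h.1
  filter_upwards [measure_eq_zero_iff_ae_notMem.1 h1] with u hu
  exact lt_top_iff_ne_top.2 hu

/-- The bound `(f - a)₊ ≤ f² / a` at the level `a = D / √t`, which balances the two terms of the
infimum formula. This is what places `L₂` inside the spaces constructed below. -/
lemma kFun_le_sqrt_mul [SFinite ν] {t : ℝ} (ht : 0 < t) {f : α → ℝ≥0∞} (hf : AEMeasurable f ν)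
    {C : ℝ} (hC : 0 ≤ C) (h : ∫⁻ u, f u ^ 2 ∂ν ≤ ENNReal.ofReal (C ^ 2)) :
    kFun ν (ENNReal.ofReal t) f ≤ ENNReal.ofReal (2 * √t * C) := by
  have hst : 0 < √t := Real.sqrt_pos.2 ht
  -- Working with `D > C` and letting `D` decrease to `C` avoids a division by zero when `C = 0`.
  have main : ∀ D > C, kFun ν (ENNReal.ofReal t) f ≤ ENNReal.ofReal (2 * √t * D) := by
    intro D hD
    have hD0 : 0 < D := hC.trans_lt hD
    have ha : 0 < D / √t := by positivity
    refine (kFun_le_add hf ha.le).trans ?_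
    have h1 : ∀ u, f u - ENNReal.ofReal (D / √t) ≤ ENNReal.ofReal (√t / D) * f u ^ 2 := by
      intro u
      rcases le_total (f u) (ENNReal.ofReal (D / √t)) with h | h
      · simp [tsub_eq_zero_of_le h]
      · calc f u - ENNReal.ofReal (D / √t) ≤ 1 * f u := by simp
          _ = ENNReal.ofReal (√t / D) * ENNReal.ofReal (D / √t) * f u := by
            rw [← ENNReal.ofReal_mul (by positivity)]
            congr
            field_simp
            simp
          _ ≤ ENNReal.ofReal (√t / D) * f u * f u := by gcongr
          _ = _ := by ring
    calc _ ≤ ENNReal.ofReal t * ENNReal.ofReal (D / √t) +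
          ∫⁻ u, ENNReal.ofReal (√t / D) * f u ^ 2 ∂ν := by gcongr with u; exact h1 u
      _ ≤ ENNReal.ofReal t * ENNReal.ofReal (D / √t) +
          ENNReal.ofReal (√t / D) * ENNReal.ofReal (D ^ 2) := by
        rw [lintegral_const_mul' _ _ ENNReal.ofReal_ne_top]
        gcongr
        exact h.trans (ENNReal.ofReal_le_ofReal (by gcongr))
      _ = ENNReal.ofReal (2 * √t * D) := by
        rw [← ENNReal.ofReal_mul ht.le, ← ENNReal.ofReal_mul (by positivity),
          ← ENNReal.ofReal_add (by positivity) (by positivity)]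
        congr 1
        have : t = √t * √t := (Real.mul_self_sqrt ht.le).symm
        rw [div_eq_mul_inv]
        nth_rw 1 [this]
        field_simp
        ring
  have hl : Tendsto (fun D => ENNReal.ofReal (2 * √t * D)) (𝓝[>] C)
      (𝓝 (ENNReal.ofReal (2 * √t * C))) :=
    ((ENNReal.continuous_ofReal.comp (by fun_prop)).tendsto C).mono_left nhdsWithin_le_nhds
  exact ge_of_tendsto hl (eventually_nhdsWithin_of_forall main)

/-- If `f` exceeds `b` on a set of measure at most `t`, its integral over this set is at most
`K(t, f)`. -/
lemma lintegral_indicator_le_kFun [SFinite ν] {t : ℝ≥0∞} {f : α → ℝ≥0∞}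
    (hf : AEMeasurable f ν) {b : ℝ≥0∞} (h : ν {u | b < f u} ≤ t) :
    ∫⁻ u, {u | b < f u}.indicator f u ∂ν ≤ kFun ν t f := by
  rw [lintegral_eq_lintegral_distribution
    (hf.indicator₀ (nullMeasurableSet_lt aemeasurable_const hf))]
  refine lintegral_mono fun s => le_min ?_ ?_
  · refine (measure_mono ?_).trans h
    intro u hu
    exact mem_of_indicator_ne_zero (bot_lt_of_lt (mem_ofPred.1 hu)).ne'
  · refine measure_mono ?_
    intro u hu
    exact (mem_ofPred.1 hu).trans_le (indicator_le_self _ _ _)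

end KFunctional

/-! ### The ℓ₂-sum of weighted K-functionals -/

/-- The `ℓ₂`-sum of the weighted `K`-functionals `c k * K(t k, f)`. -/
def kNorm {α ι : Type*} [MeasurableSpace α] (ν : Measure α) (c t : ι → ℝ≥0∞) (f : α → ℝ≥0∞) :
    ℝ≥0∞ :=
  (∑' k, (c k * kFun ν (t k) f) ^ 2) ^ (1 / 2 : ℝ)

section KNorm

variable {α ι : Type*} [MeasurableSpace α] {ν : Measure α} {c t : ι → ℝ≥0∞}

lemma kNorm_sq (c t : ι → ℝ≥0∞) (f : α → ℝ≥0∞) :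
    kNorm ν c t f ^ 2 = ∑' k, (c k * kFun ν (t k) f) ^ 2 := by
  rw [kNorm, ← ENNReal.rpow_two, ← ENNReal.rpow_mul]
  norm_num

lemma kNorm_mono_of_kFun {f g : α → ℝ≥0∞} (h : ∀ k, kFun ν (t k) f ≤ kFun ν (t k) g) :
    kNorm ν c t f ≤ kNorm ν c t g := by
  unfold kNorm
  gcongr with k
  exact h k

lemma kNorm_mono {f g : α → ℝ≥0∞} (h : f ≤ᵐ[ν] g) : kNorm ν c t f ≤ kNorm ν c t g :=
  kNorm_mono_of_kFun fun _ => kFun_mono h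

lemma kNorm_congr {f g : α → ℝ≥0∞} (h : f =ᵐ[ν] g) : kNorm ν c t f = kNorm ν c t g :=
  le_antisymm (kNorm_mono h.le) (kNorm_mono h.symm.le)

lemma mul_kFun_le_kNorm (k : ι) (f : α → ℝ≥0∞) : c k * kFun ν (t k) f ≤ kNorm ν c t f := by
  rw [← ENNReal.pow_le_pow_left_iff two_ne_zero, kNorm_sq]
  exact ENNReal.le_tsum k

lemma ENNReal.rpow_half_tsum_le_iff {a : ι → ℝ≥0∞} {M : ℝ≥0∞} :
    (∑' k, a k ^ 2) ^ (1 / 2 : ℝ) ≤ M ↔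
      ∀ s : Finset ι, (∑ k ∈ s, a k ^ (2 : ℝ)) ^ (1 / 2 : ℝ) ≤ M := by
  have h : ∀ x : ℝ≥0∞, x ^ (1 / 2 : ℝ) ≤ M ↔ x ≤ M ^ (2 : ℝ) := fun x => by
    rw [one_div, ENNReal.rpow_inv_le_iff two_pos]
  simp only [h, ENNReal.rpow_two, ENNReal.tsum_eq_iSup_sum, iSup_le_iff]

/-- Subadditivity of each `K(t k, ·)` combined with Minkowski's inequality in `ℓ₂`, applied to
finite partial sums. -/
lemma kNorm_add_le [SFinite ν] (ht : ∀ k, t k ≠ 0) {f g : α → ℝ≥0∞}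
    (hf : AEMeasurable f ν) (hg : AEMeasurable g ν) :
    kNorm ν c t (fun u => f u + g u) ≤ kNorm ν c t f + kNorm ν c t g := by
  unfold kNorm
  rw [ENNReal.rpow_half_tsum_le_iff]
  intro s
  calc _ ≤ (∑ k ∈ s, (c k * kFun ν (t k) f + c k * kFun ν (t k) g) ^ (2 : ℝ)) ^ (1 / 2 : ℝ) := by
        gcongr with k
        rw [← mul_add]
        gcongr
        exact kFun_add_le (ht k) hf hg
    _ ≤ _ := ENNReal.Lp_add_le s _ _ (by norm_num)
    _ ≤ _ := add_le_add (ENNReal.rpow_half_tsum_le_iff.1 le_rfl s)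
        (ENNReal.rpow_half_tsum_le_iff.1 le_rfl s)

lemma kNorm_const_mul [SFinite ν] (ht : ∀ k, t k ≠ 0) {f : α → ℝ≥0∞}
    (hf : AEMeasurable f ν) {r : ℝ} (hr : 0 ≤ r) :
    kNorm ν c t (fun u => ENNReal.ofReal r * f u) = ENNReal.ofReal r * kNorm ν c t f := by
  rw [← (ENNReal.pow_right_strictMono two_ne_zero).injective.eq_iff, mul_pow, kNorm_sq, kNorm_sq, ← ENNReal.tsum_mul_left]
  refine tsum_congr fun k => ?_
  rw [kFun_const_mul (ht k) hf hr]
  ring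

lemma kNorm_zero : kNorm ν c t (fun _ => 0) = 0 := by
  simp [kNorm, kFun_zero]

lemma kNorm_iSup {f : ℕ → α → ℝ≥0∞} (hf : Monotone f) :
    kNorm ν c t (fun u => ⨆ n, f n u) = ⨆ n, kNorm ν c t (f n) := by
  refine le_antisymm ?_ (iSup_le fun n => kNorm_mono (Eventually.of_forall fun u => le_iSup
    (fun n => f n u) n))
  unfold kNorm
  rw [ENNReal.rpow_half_tsum_le_iff]
  intro s
  have hl : ∀ k, Tendsto (fun n => c k * kFun ν (t k) (f n)) atTop
      (𝓝 (c k * kFun ν (t k) fun u => ⨆ n, f n u)) := by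
    intro k
    rw [kFun_iSup _ hf, ENNReal.mul_iSup]
    exact tendsto_atTop_iSup fun m n h => by
      gcongr
      exact kFun_mono (Eventually.of_forall (hf h))
  have : Tendsto (fun n => (∑ k ∈ s, (c k * kFun ν (t k) (f n)) ^ (2 : ℝ)) ^ (1 / 2 : ℝ)) atTop
      (𝓝 ((∑ k ∈ s, (c k * kFun ν (t k) fun u => ⨆ n, f n u) ^ (2 : ℝ)) ^ (1 / 2 : ℝ))) :=
    (ENNReal.continuous_rpow_const.tendsto _).comp <| tendsto_finsetSum _ fun k _ =>
      (ENNReal.continuous_rpow_const.tendsto _).comp (hl k)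
  exact le_of_tendsto' this fun n => (ENNReal.rpow_half_tsum_le_iff.1 le_rfl s).trans
    (le_iSup (fun n => (∑' k, (c k * kFun ν (t k) (f n)) ^ 2) ^ (1 / 2 : ℝ)) n)

lemma kNorm_sum_le [SFinite ν] (ht : ∀ k, t k ≠ 0) {f : ℕ → α → ℝ≥0∞}
    (hf : ∀ n, AEMeasurable (f n) ν) (n : ℕ) :
    kNorm ν c t (fun u => ∑ i ∈ Finset.range n, f i u) ≤
      ∑ i ∈ Finset.range n, kNorm ν c t (f i) := by
  induction n with
  | zero => simp [kNorm_zero]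
  | succ n ih =>
    simp only [Finset.sum_range_succ]
    refine (kNorm_add_le ht (Finset.aemeasurable_fun_sum _ fun i _ => hf i) (hf n)).trans ?_
    gcongr

lemma kNorm_tsum_le [SFinite ν] (ht : ∀ k, t k ≠ 0) {f : ℕ → α → ℝ≥0∞}
    (hf : ∀ n, AEMeasurable (f n) ν) :
    kNorm ν c t (fun u => ∑' i, f i u) ≤ ∑' i, kNorm ν c t (f i) := by
  simp only [ENNReal.tsum_eq_iSup_nat]
  rw [kNorm_iSup (f := fun n u => ∑ i ∈ Finset.range n, f i u)]
  · exact iSup_mono fun n => kNorm_sum_le ht hf n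
  · exact fun m n h u => Finset.sum_le_sum_of_subset (Finset.range_mono h)

end KNorm

/-! ### The normed function space given by a system of weights -/

/-- Weights `c` and arguments `t` for an `ℓ₂`-sum of `K`-functionals. -/
structure KWeights (ι : Type*) where
  c : ι → ℝ≥0∞
  t : ι → ℝ≥0∞
  c_ne_top : ∀ k, c k ≠ ∞
  t_ne_zero : ∀ k, t k ≠ 0
  t_ne_top : ∀ k, t k ≠ ∞
  exists_c_ne_zero : ∃ k, c k ≠ 0

namespace KWeights

variable {ι : Type*} (w : KWeights ι) {𝕜 : Type*} [RCLike 𝕜]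

/-- The extended norm of a class of functions on the half-line. -/
def eNrm (x : ℝ →ₘ[halfLine] 𝕜) : ℝ≥0∞ := kNorm halfLine w.c w.t fun u => ‖x u‖ₑ

lemma aemeasurable_enorm (x : ℝ →ₘ[halfLine] 𝕜) : AEMeasurable (fun u => ‖x u‖ₑ) halfLine :=
  x.aestronglyMeasurable.enorm

lemma kNorm_enorm_add_le {c t : ι → ℝ≥0∞} (ht : ∀ k, t k ≠ 0) (x y : ℝ →ₘ[halfLine] 𝕜) :
    kNorm halfLine c t (fun u => ‖(x + y) u‖ₑ) ≤
      kNorm halfLine c t (fun u => ‖x u‖ₑ) + kNorm halfLine c t (fun u => ‖y u‖ₑ) := by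
  refine le_trans (kNorm_mono ?_) (kNorm_add_le ht (aemeasurable_enorm x) (aemeasurable_enorm y))
  filter_upwards [AEEqFun.coeFn_add x y] with u hu
  rw [hu]
  exact enorm_add_le _ _

lemma kNorm_enorm_smul {c t : ι → ℝ≥0∞} (ht : ∀ k, t k ≠ 0) (a : 𝕜) (x : ℝ →ₘ[halfLine] 𝕜) :
    kNorm halfLine c t (fun u => ‖(a • x) u‖ₑ) =
      ENNReal.ofReal ‖a‖ * kNorm halfLine c t (fun u => ‖x u‖ₑ) := by
  rw [← kNorm_const_mul ht (aemeasurable_enorm x) (norm_nonneg a)]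
  refine kNorm_congr ?_
  filter_upwards [AEEqFun.coeFn_smul a x] with u hu
  rw [hu, Pi.smul_apply, smul_eq_mul, enorm_mul, ofReal_norm]

lemma eNrm_add_le (x y : ℝ →ₘ[halfLine] 𝕜) : w.eNrm (x + y) ≤ w.eNrm x + w.eNrm y :=
  kNorm_enorm_add_le w.t_ne_zero x y

lemma eNrm_smul (a : 𝕜) (x : ℝ →ₘ[halfLine] 𝕜) :
    w.eNrm (a • x) = ENNReal.ofReal ‖a‖ * w.eNrm x :=
  kNorm_enorm_smul w.t_ne_zero a x

lemma eNrm_zero : w.eNrm (0 : ℝ →ₘ[halfLine] 𝕜) = 0 := by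
  rw [← kNorm_zero (ν := halfLine) (c := w.c) (t := w.t)]
  refine kNorm_congr ?_
  filter_upwards [AEEqFun.coeFn_zero (β := 𝕜) (μ := halfLine)] with u hu
  simp [hu]

lemma eNrm_mono {x y : ℝ →ₘ[halfLine] 𝕜} (h : ∀ᵐ u ∂halfLine, ‖x u‖ₑ ≤ ‖y u‖ₑ) :
    w.eNrm x ≤ w.eNrm y := kNorm_mono h

lemma kFun_ne_top {f : ℝ → ℝ≥0∞} (h : kNorm halfLine w.c w.t f ≠ ∞) {k : ι} (hk : w.c k ≠ 0) :
    kFun halfLine (w.t k) f ≠ ∞ := fun h' => h <| top_le_iff.1 <| by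
  have := mul_kFun_le_kNorm (ν := halfLine) (c := w.c) (t := w.t) k f
  rwa [h', ENNReal.mul_top hk] at this

lemma eq_zero_of_eNrm {x : ℝ →ₘ[halfLine] 𝕜} (h : w.eNrm x = 0) : x = 0 := by
  obtain ⟨k, hk⟩ := w.exists_c_ne_zero
  have h1 := mul_kFun_le_kNorm (ν := halfLine) (c := w.c) (t := w.t) k fun u => ‖x u‖ₑ
  rw [show kNorm halfLine w.c w.t _ = 0 from h, nonpos_iff_eq_zero, mul_eq_zero,
    or_iff_right hk] at h1
  refine AEEqFun.ext ?_
  filter_upwards [ae_eq_zero_of_kFun_eq_zero (w.t_ne_zero k) h1,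
    AEEqFun.coeFn_zero (β := 𝕜) (μ := halfLine)] with u hu h0
  rw [h0]
  simpa using hu

/-- The space of functions for which the `ℓ₂`-sum of weighted `K`-functionals is finite. -/
def space (𝕜 : Type*) [RCLike 𝕜] : NormedFunctionSpace 𝕜 where
  carrier :=
    { carrier := {x | w.eNrm x ≠ ∞}
      add_mem' := fun {x y} hx hy =>
        ne_top_of_le_ne_top (ENNReal.add_ne_top.2 ⟨hx, hy⟩) (w.eNrm_add_le x y)
      zero_mem' := by simp [eNrm_zero]
      smul_mem' := fun a x hx => by
        rw [mem_ofPred_eq, eNrm_smul]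
        exact ENNReal.mul_ne_top ENNReal.ofReal_ne_top hx }
  nrm := Seminorm.of (fun x => (w.eNrm (x : ℝ →ₘ[halfLine] 𝕜)).toReal)
    (fun x y => by
      rw [← ENNReal.toReal_add x.2 y.2]
      exact ENNReal.toReal_mono (ENNReal.add_ne_top.2 ⟨x.2, y.2⟩) (w.eNrm_add_le _ _))
    (fun a x => by simp [eNrm_smul])
  eq_zero_of_nrm := fun x hx => Subtype.ext <| w.eq_zero_of_eNrm <| by
    rcases (ENNReal.toReal_eq_zero_iff _).1 hx with h | h
    · exact h
    · exact absurd h x.2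

lemma mem_space {x : ℝ →ₘ[halfLine] 𝕜} : x ∈ (w.space 𝕜).carrier ↔ w.eNrm x ≠ ∞ := Iff.rfl

lemma norm_def (x : (w.space 𝕜).carrier) : ‖x‖ = (w.eNrm (x : ℝ →ₘ[halfLine] 𝕜)).toReal := rfl

lemma ofReal_norm (x : (w.space 𝕜).carrier) :
    ENNReal.ofReal ‖x‖ = w.eNrm (x : ℝ →ₘ[halfLine] 𝕜) := ENNReal.ofReal_toReal x.2

lemma norm_le_iff (x : (w.space 𝕜).carrier) {C : ℝ} (hC : 0 ≤ C) :
    ‖x‖ ≤ C ↔ w.eNrm (x : ℝ →ₘ[halfLine] 𝕜) ≤ ENNReal.ofReal C := by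
  rw [norm_def, ENNReal.le_ofReal_iff_toReal_le x.2 hC]

/-- The Riesz–Fischer argument. By countable subadditivity `∑ |x n|` has finite norm, hence is
finite almost everywhere; the series therefore converges pointwise, and the same subadditivity
bounds its remainders by the tails of the series of norms. -/
instance completeSpace_space : CompleteSpace (w.space 𝕜).carrier := by
  refine NormedAddCommGroup.completeSpace_of_summable_imp_tendsto fun x hx => ?_
  set f : ℕ → ℝ → ℝ≥0∞ := fun n u => ‖(x n : ℝ →ₘ[halfLine] 𝕜) u‖ₑ with hf
  have hfm : ∀ n, AEMeasurable (f n) halfLine := fun n => aemeasurable_enorm _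
  have hsum : ∑' n, kNorm halfLine w.c w.t (f n) ≠ ∞ := by
    have : ∀ n, kNorm halfLine w.c w.t (f n) = ENNReal.ofReal ‖x n‖ := fun n =>
      (w.ofReal_norm (x n)).symm
    simp only [this]
    exact hx.tsum_ofReal_ne_top
  have hfin : ∀ᵐ u ∂halfLine, ∑' n, f n u < ∞ := by
    obtain ⟨k, hk⟩ := w.exists_c_ne_zero
    exact ae_lt_top_of_kFun_ne_top (w.t_ne_zero k)
      (w.kFun_ne_top (ne_top_of_le_ne_top hsum (kNorm_tsum_le w.t_ne_zero hfm)) hk)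
  have hsumm : ∀ᵐ u ∂halfLine, Summable fun n => (x n : ℝ →ₘ[halfLine] 𝕜) u := by
    filter_upwards [hfin] with u hu
    refine Summable.of_norm ?_
    have := ENNReal.summable_toReal hu.ne
    simpa [hf] using this
  have hcoe : ∀ n, ⇑((∑ i ∈ Finset.range n, x i : (w.space 𝕜).carrier) : ℝ →ₘ[halfLine] 𝕜)
      =ᵐ[halfLine] fun u => ∑ i ∈ Finset.range n, (x i : ℝ →ₘ[halfLine] 𝕜) u := fun n => by
    rw [AddSubmonoidClass.coe_finsetSum]
    exact AEEqFun.coeFn_fun_finsetSum _ _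
  have hmeas : AEStronglyMeasurable (fun u => ∑' n, (x n : ℝ →ₘ[halfLine] 𝕜) u) halfLine := by
    refine aestronglyMeasurable_of_tendsto_ae atTop
      (f := fun n u => ∑ i ∈ Finset.range n, (x i : ℝ →ₘ[halfLine] 𝕜) u)
      (fun n => Finset.aestronglyMeasurable_fun_sum _ fun i _ => AEEqFun.aestronglyMeasurable _) ?_
    filter_upwards [hsumm] with u hu
    exact hu.hasSum.tendsto_sum_nat
  set y : ℝ →ₘ[halfLine] 𝕜 := AEEqFun.mk _ hmeas with hy
  have hdiff : ∀ n, w.eNrm (y - ((∑ i ∈ Finset.range n, x i : (w.space 𝕜).carrier) :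
      ℝ →ₘ[halfLine] 𝕜)) ≤ ∑' i, kNorm halfLine w.c w.t (f (i + n)) := by
    intro n
    refine le_trans (kNorm_mono ?_) (kNorm_tsum_le w.t_ne_zero fun i => hfm (i + n))
    filter_upwards [hsumm, hcoe n, AEEqFun.coeFn_mk _ hmeas, AEEqFun.coeFn_sub y
      ((∑ i ∈ Finset.range n, x i : (w.space 𝕜).carrier) : ℝ →ₘ[halfLine] 𝕜)] with u h1 h2 h3 h4
    rw [h4, Pi.sub_apply, h2, hy, h3, ← h1.sum_add_tsum_nat_add n, add_sub_cancel_left]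
    exact enorm_tsum_le_tsum_enorm
  have hymem : y ∈ (w.space 𝕜).carrier := by
    have := hdiff 0
    simp only [Finset.range_zero, Finset.sum_empty, ZeroMemClass.coe_zero, sub_zero,
      add_zero] at this
    exact ne_top_of_le_ne_top hsum this
  refine ⟨⟨y, hymem⟩, ?_⟩
  rw [tendsto_iff_norm_sub_tendsto_zero]
  have h0 : Tendsto (fun n => (∑' i, kNorm halfLine w.c w.t (f (i + n))).toReal) atTop (𝓝 0) := by
    rw [← ENNReal.toReal_zero]
    exact (ENNReal.tendsto_toReal ENNReal.zero_ne_top).comp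
      (ENNReal.tendsto_sum_nat_add _ hsum)
  refine squeeze_zero (fun _ => norm_nonneg _) (fun n => ?_) h0
  rw [norm_sub_rev]
  refine ENNReal.toReal_mono ?_ (hdiff n)
  refine ne_top_of_le_ne_top hsum ?_
  exact ENNReal.tsum_comp_le_tsum_of_injective (add_left_injective n) _

end KWeights

/-! ### Comparison of rearrangements and distribution functions -/

section Rearrangement

variable {𝕜 : Type*} [RCLike 𝕜]

lemma rearrangement_le_iff (x : ℝ →ₘ[halfLine] 𝕜) (t : ℝ) {s : ℝ} (hs : 0 ≤ s) :
    rearrangement x t ≤ ENNReal.ofReal s ↔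
      halfLine {u | ENNReal.ofReal s < ‖x u‖ₑ} ≤ ENNReal.ofReal t := by
  refine ⟨fun h => ?_, fun h => sInf_le h⟩
  refine distribution_tendsto (fun u => ‖x u‖ₑ) s fun r hr => ?_
  obtain ⟨q, hq, hqr⟩ := sInf_lt_iff.1
    (h.trans_lt ((ENNReal.ofReal_lt_ofReal_iff (hs.trans_lt hr)).2 hr))
  exact (measure_mono fun u (hu : _ < _) => hqr.trans hu).trans hq

/-- Any finite `b` above the distribution function of `y` is positive, so it can serve as the
argument at which the rearrangements are compared; then `b` decreases to its bound. -/
lemma distribution_le_of_rearrangement_le {x y : ℝ →ₘ[halfLine] 𝕜}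
    (h : ∀ t : ℝ, 0 < t → rearrangement x t ≤ rearrangement y t) {s : ℝ} (hs : 0 ≤ s) :
    halfLine {u | ENNReal.ofReal s < ‖x u‖ₑ} ≤ halfLine {u | ENNReal.ofReal s < ‖y u‖ₑ} := by
  refine le_of_forall_gt_imp_ge_of_dense fun b hb => ?_
  by_cases hbt : b = ∞
  · simp [hbt]
  have hb0 : 0 < b.toReal := ENNReal.toReal_pos (bot_lt_of_lt hb).ne' hbt
  rw [← ENNReal.ofReal_toReal hbt] at hb ⊢
  rw [← rearrangement_le_iff _ _ hs]
  exact (h _ hb0).trans ((rearrangement_le_iff y _ hs).2 hb.le)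

lemma rearrangement_le_of_distribution_le {x y : ℝ →ₘ[halfLine] 𝕜}
    (h : ∀ s : ℝ, 0 < s → halfLine {u | ENNReal.ofReal s < ‖x u‖ₑ} ≤
      halfLine {u | ENNReal.ofReal s < ‖y u‖ₑ}) (t : ℝ) :
    rearrangement x t ≤ rearrangement y t := by
  refine ENNReal.le_of_forall_pos_le_add fun ε hε hy => ?_
  have h0 : (0 : ℝ) < (rearrangement y t).toReal + ε :=
    add_pos_of_nonneg_of_pos ENNReal.toReal_nonneg hε
  have hs : rearrangement y t + ε = ENNReal.ofReal ((rearrangement y t).toReal + ε) := by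
    rw [ENNReal.ofReal_add ENNReal.toReal_nonneg ε.coe_nonneg, ENNReal.ofReal_toReal hy.ne,
      ENNReal.ofReal_coe_nnreal]
  rw [hs, rearrangement_le_iff _ _ h0.le]
  refine (h _ h0).trans ((rearrangement_le_iff y _ h0.le).1 ?_)
  rw [← hs]
  exact le_self_add

lemma mem_finiteDistribution_iff {x : ℝ →ₘ[halfLine] 𝕜} :
    x ∈ finiteDistribution 𝕜 ↔
      ∃ s : ℝ, 0 < s ∧ halfLine {u | ENNReal.ofReal s < ‖x u‖ₑ} < ∞ := by
  refine exists_congr fun s => and_congr_right fun hs => ?_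
  have : {u | s < ‖x u‖} = {u | ENNReal.ofReal s < ‖x u‖ₑ} := by
    ext u
    rw [mem_ofPred, mem_ofPred, ← ofReal_norm, ENNReal.ofReal_lt_ofReal_iff_of_nonneg hs.le]
  rw [this]

end Rearrangement

/-! ### Dominated convergence and suprema of directed families -/

section Convergence

variable {α ι : Type*} [MeasurableSpace α] {ν : Measure α}

/-- Dominated convergence is used twice: at a fixed level it sends the distribution functions to
`0`, the level set of `g` being of finite measure, and then it applies to the integral over the
levels. -/
lemma tendsto_kFun_zero {t : ℝ≥0∞} {f : ℕ → α → ℝ≥0∞} {g : α → ℝ≥0∞}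
    (hf : ∀ n, AEMeasurable (f n) ν) (hg : AEMeasurable g ν) (hfg : ∀ n, f n ≤ᵐ[ν] g)
    (hlim : ∀ᵐ u ∂ν, Tendsto (fun n => f n u) atTop (𝓝 0))
    (hfin : ∀ s : ℝ, 0 < s → ν {u | ENNReal.ofReal s < g u} ≠ ∞) (hK : kFun ν t g ≠ ∞) :
    Tendsto (fun n => kFun ν t (f n)) atTop (𝓝 0) := by
  have hd : ∀ s : ℝ, 0 < s →
      Tendsto (fun n => ν {u | ENNReal.ofReal s < f n u}) atTop (𝓝 0) := by
    intro s hs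
    have hs0 : 0 < ENNReal.ofReal s := by simpa using hs
    have hm : ∀ n, NullMeasurableSet {u | ENNReal.ofReal s < f n u} ν := fun n =>
      nullMeasurableSet_lt aemeasurable_const (hf n)
    have hmg : NullMeasurableSet {u | ENNReal.ofReal s < g u} ν :=
      nullMeasurableSet_lt aemeasurable_const hg
    have := tendsto_lintegral_of_dominated_convergence' (μ := ν)
      (F := fun n => {u | ENNReal.ofReal s < f n u}.indicator 1) (f := fun _ => 0)
      ({u | ENNReal.ofReal s < g u}.indicator 1)
      (fun n => aemeasurable_one.indicator₀ (hm n)) ?_ ?_ ?_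
    · simpa [lintegral_indicator_one₀ (hm _)] using this
    · intro n
      filter_upwards [hfg n] with u hu
      by_cases h : ENNReal.ofReal s < f n u
      · simp [indicator, h, h.trans_le hu]
      · simp [indicator, h]
    · rw [lintegral_indicator_one₀ hmg]
      exact hfin s hs
    · filter_upwards [hlim] with u hu
      refine tendsto_const_nhds.congr' ?_
      filter_upwards [hu.eventually (gt_mem_nhds hs0)] with n hn
      rw [indicator_of_notMem]
      exact not_lt.2 (le_of_lt hn)
  have := tendsto_lintegral_of_dominated_convergence (μ := volume.restrict (Ioi (0 : ℝ)))
    (F := fun n s => min t (ν {u | ENNReal.ofReal s < f n u})) (f := fun _ => 0)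
    (fun s => min t (ν {u | ENNReal.ofReal s < g u}))
    (fun n => measurable_const.min (measurable_distribution _)) ?_ hK ?_
  · simpa [kFun] using this
  · intro n
    refine Eventually.of_forall fun s => min_le_min le_rfl (measure_mono_ae ?_)
    filter_upwards [hfg n] with u hu
    exact fun (h : _ < _) => h.trans_le hu
  · filter_upwards [ae_restrict_mem measurableSet_Ioi] with s hs
    simpa using (tendsto_const_nhds (x := t)).min (hd s hs)

/-- Dominated convergence for the counting measure on the indices, with the terms of `g` as
majorant. -/
lemma tendsto_kNorm_zero {c t : ι → ℝ≥0∞} (hc : ∀ k, c k ≠ ∞) {f : ℕ → α → ℝ≥0∞} {g : α → ℝ≥0∞}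
    (hf : ∀ n, AEMeasurable (f n) ν) (hg : AEMeasurable g ν) (hfg : ∀ n, f n ≤ᵐ[ν] g)
    (hlim : ∀ᵐ u ∂ν, Tendsto (fun n => f n u) atTop (𝓝 0))
    (hfin : ∀ s : ℝ, 0 < s → ν {u | ENNReal.ofReal s < g u} ≠ ∞)
    (hK : kNorm ν c t g ≠ ∞) :
    Tendsto (fun n => kNorm ν c t (f n)) atTop (𝓝 0) := by
  have hsq : Tendsto (fun n => ∑' k, (c k * kFun ν (t k) (f n)) ^ 2) atTop (𝓝 0) := by
    let _ : MeasurableSpace ι := ⊤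
    have := tendsto_lintegral_of_dominated_convergence (μ := (Measure.count : Measure ι))
      (F := fun n k => (c k * kFun ν (t k) (f n)) ^ 2) (f := fun _ => 0)
      (fun k => (c k * kFun ν (t k) g) ^ 2)
      (fun n => measurable_from_top) ?_ ?_ ?_
    · simpa [lintegral_count] using this
    · intro n
      refine Eventually.of_forall fun k => ?_
      dsimp only
      gcongr
      exact kFun_mono (hfg n)
    · rw [lintegral_count, ← kNorm_sq]
      exact ENNReal.pow_ne_top hK
    · refine Eventually.of_forall fun k => ?_
      by_cases hk : c k = 0
      · simp [hk]
      have hk' : kFun ν (t k) g ≠ ∞ := fun h' => hK <| top_le_iff.1 <| by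
        have := mul_kFun_le_kNorm (ν := ν) (c := c) (t := t) k g
        rwa [h', ENNReal.mul_top hk] at this
      have h1 := ENNReal.Tendsto.const_mul (tendsto_kFun_zero hf hg hfg hlim hfin hk')
        (Or.inr (hc k))
      have h2 := ((ENNReal.continuous_pow 2).tendsto _).comp h1
      simpa [Function.comp_def] using h2
  have := (ENNReal.continuous_rpow_const (y := (1 / 2 : ℝ))).tendsto _ |>.comp hsq
  simpa [Function.comp_def, kNorm] using this

/-- A directed family of uniformly bounded functions has, up to null sets, the same supremum as
some monotone sequence of its members. -/
lemma exists_seq_ae_le_iSup [SigmaFinite ν] {P : Type*} {r : P → P → Prop} {D : Set P}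
    (hne : D.Nonempty) (hdir : DirectedOn r D) {G : P → α → ℝ≥0∞}
    (hG : ∀ d, AEMeasurable (G d) ν) (hG1 : ∀ d u, G d u ≤ 1)
    (hr : ∀ a b, r a b → G a ≤ᵐ[ν] G b) :
    ∃ x : ℕ → P, (∀ n, x n ∈ D) ∧ (∀ n, r (x n) (x (n + 1))) ∧
      ∀ d ∈ D, ∀ᵐ u ∂ν, G d u ≤ ⨆ n, G (x n) u := by
  -- An exhaustion argument: `γ` is a finite measure with the same null sets as `ν`, and a sequence
  -- is sought along which the `γ`-integrals tend to their supremum `A` over the family.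
  set γ := ν.toFinite
  have hγ : ae γ = ae ν := ae_toFinite
  have hac : γ ≪ ν := toFinite_absolutelyContinuous ν
  set A : ℝ≥0∞ := ⨆ d ∈ D, ∫⁻ u, G d u ∂γ with hA
  have hbd : ∀ g : α → ℝ≥0∞, (∀ᵐ u ∂γ, g u ≤ 1) → ∫⁻ u, g u ∂γ ≠ ∞ := fun g hg =>
    ne_top_of_le_ne_top (by simp : ∫⁻ _, 1 ∂γ ≠ ∞) (lintegral_mono_ae hg)
  have hAle : A ≤ ∫⁻ _, 1 ∂γ := iSup₂_le fun d _ => lintegral_mono (hG1 d)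
  have hAtop : A ≠ ∞ := ne_top_of_le_ne_top (by simp) hAle
  have hex : ∀ n : ℕ, ∃ d ∈ D, A ≤ ∫⁻ u, G d u ∂γ + (n + 1 : ℝ≥0∞)⁻¹ := by
    intro n
    have hpos : ((n : ℝ≥0∞) + 1)⁻¹ ≠ 0 := by simp
    by_cases hA0 : A = 0
    · obtain ⟨d, hd⟩ := hne
      exact ⟨d, hd, by simp [hA0]⟩
    · have hlt : A - (n + 1 : ℝ≥0∞)⁻¹ < A := ENNReal.sub_lt_self hAtop hA0 hpos
      obtain ⟨d, hd⟩ := lt_iSup_iff.1 hlt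
      obtain ⟨hdD, hd⟩ := lt_iSup_iff.1 hd
      exact ⟨d, hdD, tsub_le_iff_right.1 hd.le⟩
  choose e heD he using hex
  choose! j hjD hj1 hj2 using hdir
  -- Each term lies above the preceding one and above the near maximiser `e (n + 1)`.
  let x : ℕ → P := fun n => Nat.rec (e 0) (fun n y => j y (e (n + 1))) n
  have hxs : ∀ n, x (n + 1) = j (x n) (e (n + 1)) := fun n => rfl
  have hxD : ∀ n, x n ∈ D := fun n => by
    induction n with
    | zero => exact heD 0
    | succ n ih => rw [hxs]; exact hjD _ ih _ (heD _)
  have hx1 : ∀ n, r (x n) (x (n + 1)) := fun n => by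
    rw [hxs]; exact hj1 _ (hxD n) _ (heD _)
  have hxA : ∀ n : ℕ, A ≤ ∫⁻ u, G (x n) u ∂γ + (n + 1 : ℝ≥0∞)⁻¹ := by
    intro n
    refine (he n).trans ?_
    gcongr 1
    cases n with
    | zero => exact le_rfl
    | succ n =>
      refine lintegral_mono_ae (hac.ae_le (hr _ _ ?_))
      rw [hxs]; exact hj2 _ (hxD n) _ (heD _)
  refine ⟨x, hxD, hx1, fun d hd => ?_⟩
  have hmono : ∀ᵐ u ∂ν, Monotone fun n => G (x n) u := by
    filter_upwards [ae_all_iff.2 fun n => hr _ _ (hx1 n)] with u hu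
    exact monotone_nat_of_le_succ hu
  have hGγ : ∀ d, AEMeasurable (G d) γ := fun d => (hG d).mono_ac hac
  set S : α → ℝ≥0∞ := fun u => ⨆ n, G (x n) u
  have hS : AEMeasurable S γ := .iSup fun n => hGγ _
  have hS1 : ∀ u, S u ≤ 1 := fun u => iSup_le fun n => hG1 _ u
  have hSA : A ≤ ∫⁻ u, S u ∂γ := by
    have hl : Tendsto (fun n : ℕ => ∫⁻ u, S u ∂γ + (n + 1 : ℝ≥0∞)⁻¹) atTop
        (𝓝 (∫⁻ u, S u ∂γ + 0)) := by
      refine tendsto_const_nhds.add ?_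
      have := (tendsto_add_atTop_iff_nat 1).2 ENNReal.tendsto_inv_nat_nhds_zero
      simpa using this
    rw [add_zero] at hl
    refine ge_of_tendsto' hl fun n => (hxA n).trans ?_
    gcongr with u
    exact le_iSup (fun n => G (x n) u) n
  -- By directedness some member of the family dominates both `G (x n)` and `G d`, so adjoining `G
  -- d` cannot raise the integral above `A`; since `S` already reaches `A`, the maximum equals `S`
  -- almost everywhere.
  have hmax : ∫⁻ u, max (S u) (G d u) ∂γ ≤ A := by
    have e1 : ∀ u, max (S u) (G d u) = ⨆ n, max (G (x n) u) (G d u) := fun u => by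
      rw [iSup_sup_eq, ciSup_const]
    rw [lintegral_congr e1, lintegral_iSup' (fun n => (hGγ _).max (hGγ _))]
    · refine iSup_le fun n => ?_
      refine le_trans (lintegral_mono_ae ?_)
        (le_iSup₂ (f := fun d _ => ∫⁻ u, G d u ∂γ) (j (x n) d) (hjD _ (hxD n) _ hd))
      filter_upwards [hac.ae_le (hr _ _ (hj1 _ (hxD n) _ hd)),
        hac.ae_le (hr _ _ (hj2 _ (hxD n) _ hd))] with u h1 h2
      exact max_le h1 h2
    · filter_upwards [hac.ae_le hmono] with u hu
      exact fun m n h => max_le_max (hu h) le_rfl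
  have heq : S =ᵐ[γ] fun u => max (S u) (G d u) :=
    ae_eq_of_ae_le_of_lintegral_le (Eventually.of_forall fun u => le_max_left _ _)
      (hbd _ (Eventually.of_forall hS1)) (hS.max (hGγ d)) (hmax.trans hSA)
  rw [← hγ]
  filter_upwards [heq] with u hu
  change _ ≤ S u
  rw [hu]
  exact le_max_right _ _

end Convergence

/-! ### Order and absolute value for nonnegative classes -/

section Nonneg

variable {𝕜 : Type*} [RCLike 𝕜]

lemma RCLike.enorm_le_enorm_of_le {a b : 𝕜} (ha : 0 ≤ a) (hab : a ≤ b) : ‖a‖ₑ ≤ ‖b‖ₑ := by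
  refine enorm_le_iff_norm_le.2 (RCLike.ofReal_le_ofReal (K := 𝕜).1 ?_)
  rwa [RCLike.norm_of_nonneg' ha, RCLike.norm_of_nonneg' (ha.trans hab)]

lemma RCLike.le_of_enorm_le {a b : 𝕜} (ha : 0 ≤ a) (hb : 0 ≤ b) (h : ‖a‖ₑ ≤ ‖b‖ₑ) : a ≤ b := by
  rw [← RCLike.norm_of_nonneg' ha, ← RCLike.norm_of_nonneg' hb]
  exact RCLike.ofReal_le_ofReal.2 (enorm_le_iff_norm_le.1 h)

lemma AEEqFun.ae_nonneg {x : ℝ →ₘ[halfLine] 𝕜} (hx : 0 ≤ x) : ∀ᵐ u ∂halfLine, 0 ≤ x u := by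
  filter_upwards [AEEqFun.coeFn_le.2 hx, AEEqFun.coeFn_zero (β := 𝕜) (μ := halfLine)] with u h h0
  rwa [h0] at h

lemma AEEqFun.nonneg_of_ae {x : ℝ →ₘ[halfLine] 𝕜} (hx : ∀ᵐ u ∂halfLine, 0 ≤ x u) : 0 ≤ x := by
  rw [← AEEqFun.coeFn_le]
  filter_upwards [hx, AEEqFun.coeFn_zero (β := 𝕜) (μ := halfLine)] with u h h0
  rwa [h0]

lemma AEEqFun.enorm_le_of_le {x y : ℝ →ₘ[halfLine] 𝕜} (hx : 0 ≤ x) (h : x ≤ y) :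
    ∀ᵐ u ∂halfLine, ‖x u‖ₑ ≤ ‖y u‖ₑ := by
  filter_upwards [AEEqFun.ae_nonneg hx, AEEqFun.coeFn_le.2 h] with u h1 h2
  exact RCLike.enorm_le_enorm_of_le h1 h2

lemma AEEqFun.le_of_enorm_le {x y : ℝ →ₘ[halfLine] 𝕜} (hx : 0 ≤ x) (hy : 0 ≤ y)
    (h : ∀ᵐ u ∂halfLine, ‖x u‖ₑ ≤ ‖y u‖ₑ) : x ≤ y := by
  rw [← AEEqFun.coeFn_le]
  filter_upwards [AEEqFun.ae_nonneg hx, AEEqFun.ae_nonneg hy, h] with u h1 h2 h3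
  exact RCLike.le_of_enorm_le h1 h2 h3

/-- The class of a nonnegative function that is almost everywhere finite. -/
lemma AEEqFun.exists_nonneg_enorm_eq (𝕜 : Type*) [RCLike 𝕜] {f : ℝ → ℝ≥0∞}
    (hf : AEMeasurable f halfLine) (hfin : ∀ᵐ u ∂halfLine, f u < ∞) :
    ∃ x : ℝ →ₘ[halfLine] 𝕜, 0 ≤ x ∧ ∀ᵐ u ∂halfLine, ‖x u‖ₑ = f u := by
  have hm : AEStronglyMeasurable (fun u => ((f u).toReal : 𝕜)) halfLine :=
    (RCLike.continuous_ofReal.measurable.comp_aemeasurable hf.ennreal_toReal).aestronglyMeasurable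
  refine ⟨AEEqFun.mk _ hm, AEEqFun.nonneg_of_ae ?_, ?_⟩
  · filter_upwards [AEEqFun.coeFn_mk _ hm] with u hu
    rw [hu]
    exact RCLike.ofReal_nonneg.2 ENNReal.toReal_nonneg
  · filter_upwards [AEEqFun.coeFn_mk _ hm, hfin] with u hu hfu
    rw [hu, ← ofReal_norm, RCLike.norm_ofReal, abs_of_nonneg ENNReal.toReal_nonneg,
      ENNReal.ofReal_toReal hfu.ne]

end Nonneg

/-! ### Symmetry, Fatou property and order continuity of the constructed space -/

namespace KWeights

variable {ι : Type*} (w : KWeights ι) {𝕜 : Type*} [RCLike 𝕜]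

lemma isSymmetric_space : (w.space 𝕜).IsSymmetric where
  subset_finiteDistribution := by
    intro x hx
    obtain ⟨k, hk⟩ := w.exists_c_ne_zero
    have hK : kFun halfLine (w.t k) (fun u => ‖x u‖ₑ) ≠ ∞ := w.kFun_ne_top hx hk
    have ht : 0 < (w.t k).toReal := ENNReal.toReal_pos (w.t_ne_zero k) (w.t_ne_top k)
    set K := kFun halfLine (w.t k) (fun u => ‖x u‖ₑ)
    -- At this level `b` one has `b * t k = K + 1`, so an infinite level set would contradict
    -- `mul_min_le_kFun`.
    have hb : 0 < (K.toReal + 1) / (w.t k).toReal := by positivity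
    refine mem_finiteDistribution_iff.2 ⟨_, hb, ?_⟩
    by_contra hcon
    have h1 := mul_min_le_kFun (ν := halfLine) (w.t k) (fun u => ‖x u‖ₑ)
      ((K.toReal + 1) / (w.t k).toReal)
    rw [top_le_iff.1 (not_lt.1 hcon), min_eq_left le_top] at h1
    nth_rw 2 [← ENNReal.ofReal_toReal (w.t_ne_top k)] at h1
    rw [← ENNReal.ofReal_mul hb.le, div_mul_cancel₀ _ ht.ne'] at h1
    have h2 := ENNReal.toReal_mono hK h1
    rw [ENNReal.toReal_ofReal (by positivity)] at h2
    linarith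
  complete := w.completeSpace_space
  symmetric := by
    intro x _ y h
    have hle : w.eNrm x ≤ w.eNrm (y : ℝ →ₘ[halfLine] 𝕜) :=
      kNorm_mono_of_kFun fun k => kFun_mono_distribution fun s hs =>
        distribution_le_of_rearrangement_le h hs.le
    exact ⟨ne_top_of_le_ne_top y.2 hle, ENNReal.toReal_mono y.2 hle⟩

/-- If `{f > s}` had infinite measure, then `K(t k, f) ≥ s * t k` for every `k`, and the norm would
be infinite. -/
lemma distribution_ne_top (hw : ∑' k, (w.c k * w.t k) ^ 2 = ∞) {f : ℝ → ℝ≥0∞}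
    (hf : kNorm halfLine w.c w.t f ≠ ∞) {s : ℝ} (hs : 0 < s) :
    halfLine {u | ENNReal.ofReal s < f u} ≠ ∞ := by
  intro htop
  apply ENNReal.pow_ne_top (n := 2) hf
  rw [kNorm_sq, ← top_le_iff]
  have hs0 : ENNReal.ofReal s ^ 2 ≠ 0 := pow_ne_zero _ (by simpa using hs)
  calc ∞ = ENNReal.ofReal s ^ 2 * ∑' k, (w.c k * w.t k) ^ 2 := by rw [hw, ENNReal.mul_top hs0]
    _ = ∑' k, (w.c k * (ENNReal.ofReal s * w.t k)) ^ 2 := by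
      rw [← ENNReal.tsum_mul_left]
      exact tsum_congr fun k => by ring
    _ ≤ _ := by
      gcongr with k
      refine le_trans ?_ (mul_min_le_kFun (w.t k) f s)
      rw [htop, min_eq_left le_top]

lemma hasFatouProperty_space : (w.space 𝕜).HasFatouProperty := by
  intro D hne hdir hpos ⟨M, hM⟩
  let f : (w.space 𝕜).carrier → ℝ → ℝ≥0∞ := fun d u => ‖(d : ℝ →ₘ[halfLine] 𝕜) u‖ₑ
  have hfm : ∀ d, AEMeasurable (f d) halfLine := fun d => aemeasurable_enorm _
  have hfmono : ∀ a b : (w.space 𝕜).carrier, 0 ≤ a ∧ a ≤ b → f a ≤ᵐ[halfLine] f b :=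
    fun a b h => AEEqFun.enorm_le_of_le h.1 h.2
  have hdir' : DirectedOn (fun a b : (w.space 𝕜).carrier => 0 ≤ a ∧ a ≤ b) D := by
    intro a ha b hb
    obtain ⟨d, hd, h1, h2⟩ := hdir a ha b hb
    exact ⟨d, hd, ⟨hpos a ha, h1⟩, ⟨hpos b hb, h2⟩⟩
  -- The map `r ↦ 1 - (1 + r)⁻¹` is strictly increasing with values in `[0, 1]`; it makes the family
  -- uniformly bounded without losing the order.
  obtain ⟨x, hxD, hxr, hx⟩ := exists_seq_ae_le_iSup (ν := halfLine) hne hdir'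
    (G := fun d u => 1 - (1 + f d u)⁻¹)
    (fun d => aemeasurable_const.sub (aemeasurable_const.add (hfm d)).inv)
    (fun d u => tsub_le_self) (fun a b h => by
      filter_upwards [hfmono a b h] with u hu
      gcongr)
  have hmono : ∀ᵐ u ∂halfLine, Monotone fun n => f (x n) u := by
    filter_upwards [ae_all_iff.2 fun n => hfmono _ _ (hxr n)] with u hu
    exact monotone_nat_of_le_succ hu
  have hsup : ∀ d ∈ D, ∀ᵐ u ∂halfLine, f d u ≤ ⨆ n, f (x n) u := by
    intro d hd
    filter_upwards [hx d hd] with u hu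
    by_contra! hlt
    have hfd : f d u ≠ ∞ := enorm_ne_top
    have h1 : (1 + f d u)⁻¹ < (1 + ⨆ n, f (x n) u)⁻¹ := by
      rw [ENNReal.inv_lt_inv]
      exact ENNReal.add_lt_add_left ENNReal.one_ne_top hlt
    have h3 : (1 + ⨆ n, f (x n) u)⁻¹ ≤ 1 := by simp
    have h2 : 1 - (1 + ⨆ n, f (x n) u)⁻¹ < 1 - (1 + f d u)⁻¹ :=
      AddLECancellable.tsub_lt_tsub_left_of_le (ENNReal.cancel_of_ne (by simp)) h3 h1
    refine absurd (hu.trans (iSup_le fun n => ?_)) (not_le.2 h2)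
    gcongr
    exact le_iSup (fun n => f (x n) u) n
  -- a genuinely monotone version of the sequence
  let g : ℕ → ℝ → ℝ≥0∞ := fun n u => ⨆ i ≤ n, f (x i) u
  have hg : Monotone g := fun m n h u => biSup_mono fun i hi => le_trans hi h
  have hgf : ∀ n, g n =ᵐ[halfLine] f (x n) := by
    intro n
    filter_upwards [hmono] with u hu
    exact le_antisymm (iSup₂_le fun i hi => hu hi) (le_iSup₂ (f := fun i _ => f (x i) u) n le_rfl)
  have hsg : (fun u => ⨆ n, f (x n) u) =ᵐ[halfLine] fun u => ⨆ n, g n u := by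
    filter_upwards [ae_all_iff.2 hgf] with u hu
    exact iSup_congr fun n => (hu n).symm
  have hknorm : kNorm halfLine w.c w.t (fun u => ⨆ n, f (x n) u) =
      ⨆ n, kNorm halfLine w.c w.t (f (x n)) := by
    rw [kNorm_congr hsg, kNorm_iSup hg]
    exact iSup_congr fun n => kNorm_congr (hgf n)
  have hle : ∀ n, kNorm halfLine w.c w.t (f (x n)) ≤ ENNReal.ofReal M := fun n => by
    change w.eNrm (x n : ℝ →ₘ[halfLine] 𝕜) ≤ _
    rw [← w.ofReal_norm]
    exact ENNReal.ofReal_le_ofReal (hM ⟨_, hxD n, rfl⟩)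
  have hkfin : kNorm halfLine w.c w.t (fun u => ⨆ n, f (x n) u) ≠ ∞ := by
    rw [hknorm]
    exact ne_top_of_le_ne_top ENNReal.ofReal_ne_top (iSup_le hle)
  obtain ⟨k, hk⟩ := w.exists_c_ne_zero
  obtain ⟨y, hy0, hy⟩ := AEEqFun.exists_nonneg_enorm_eq 𝕜 (AEMeasurable.iSup fun n => hfm (x n))
    (ae_lt_top_of_kFun_ne_top (w.t_ne_zero k) (w.kFun_ne_top hkfin hk))
  have hyn : w.eNrm y = kNorm halfLine w.c w.t (fun u => ⨆ n, f (x n) u) := kNorm_congr hy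
  have hymem : y ∈ (w.space 𝕜).carrier := by rwa [mem_space, hyn]
  have hub : ∀ d ∈ D, (d : ℝ →ₘ[halfLine] 𝕜) ≤ y := by
    intro d hd
    refine AEEqFun.le_of_enorm_le (hpos d hd) hy0 ?_
    filter_upwards [hsup d hd, hy] with u h1 h2
    rw [h2]; exact h1
  refine ⟨⟨y, hymem⟩, hy0, ⟨hub, ?_⟩, ⟨?_, ?_⟩⟩
  · intro b hb
    have hb0 : (0 : ℝ →ₘ[halfLine] 𝕜) ≤ b := (hpos _ (hxD 0)).trans (hb (hxD 0))
    refine AEEqFun.le_of_enorm_le hy0 hb0 ?_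
    filter_upwards [hy, ae_all_iff.2 fun n => AEEqFun.enorm_le_of_le (hpos _ (hxD n))
      (hb (hxD n))] with u h1 h2
    rw [h1]
    exact iSup_le h2
  · rintro _ ⟨d, hd, rfl⟩
    refine ENNReal.toReal_mono hymem (w.eNrm_mono ?_)
    exact AEEqFun.enorm_le_of_le (hpos d hd) (hub d hd)
  · intro B hB
    have hB0 : 0 ≤ B := (norm_nonneg _).trans (hB ⟨_, hxD 0, rfl⟩)
    rw [w.norm_le_iff _ hB0]
    change w.eNrm y ≤ _
    rw [hyn, hknorm]
    refine iSup_le fun n => ?_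
    change w.eNrm (x n : ℝ →ₘ[halfLine] 𝕜) ≤ _
    rw [← w.ofReal_norm]
    exact ENNReal.ofReal_le_ofReal (hB ⟨_, hxD n, rfl⟩)

lemma hasOrderContinuousNorm_space (hw : ∑' k, (w.c k * w.t k) ^ 2 = ∞) :
    (w.space 𝕜).HasOrderContinuousNorm := by
  intro D hne hdir hpos hglb ε hε
  let f : (w.space 𝕜).carrier → ℝ → ℝ≥0∞ := fun d u => ‖(d : ℝ →ₘ[halfLine] 𝕜) u‖ₑ
  have hfm : ∀ d, AEMeasurable (f d) halfLine := fun d => aemeasurable_enorm _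
  have hfmono : ∀ a b : (w.space 𝕜).carrier, 0 ≤ b ∧ b ≤ a → f b ≤ᵐ[halfLine] f a :=
    fun a b h => AEEqFun.enorm_le_of_le h.1 h.2
  have hdir' : DirectedOn (fun a b : (w.space 𝕜).carrier => 0 ≤ b ∧ b ≤ a) D := by
    intro a ha b hb
    obtain ⟨d, hd, h1, h2⟩ := hdir a ha b hb
    exact ⟨d, hd, ⟨hpos d hd, h1⟩, ⟨hpos d hd, h2⟩⟩
  -- The order-reversing map `r ↦ (1 + r)⁻¹` turns the downwards directed family into an upwards
  -- directed, uniformly bounded one.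
  obtain ⟨x, hxD, hxr, hx⟩ := exists_seq_ae_le_iSup (ν := halfLine) hne hdir'
    (G := fun d u => (1 + f d u)⁻¹)
    (fun d => (aemeasurable_const.add (hfm d)).inv)
    (fun d u => by simp) (fun a b h => by
      filter_upwards [hfmono a b h] with u hu
      gcongr)
  have hmono : ∀ᵐ u ∂halfLine, Antitone fun n => f (x n) u := by
    filter_upwards [ae_all_iff.2 fun n => hfmono _ _ (hxr n)] with u hu
    exact antitone_nat_of_succ_le hu
  have hinf : ∀ d ∈ D, ∀ᵐ u ∂halfLine, ⨅ n, f (x n) u ≤ f d u := by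
    intro d hd
    filter_upwards [hx d hd] with u hu
    by_contra! hlt
    have hfd : f d u ≠ ∞ := enorm_ne_top
    have h1 : (1 + ⨅ n, f (x n) u)⁻¹ < (1 + f d u)⁻¹ := by
      rw [ENNReal.inv_lt_inv]
      exact ENNReal.add_lt_add_left ENNReal.one_ne_top hlt
    refine absurd (hu.trans (iSup_le fun n => ?_)) (not_le.2 h1)
    gcongr
    exact iInf_le (fun n => f (x n) u) n
  obtain ⟨y, hy0, hy⟩ := AEEqFun.exists_nonneg_enorm_eq 𝕜 (AEMeasurable.iInf fun n => hfm (x n))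
    (Eventually.of_forall fun u => (iInf_le (fun n => f (x n) u) 0).trans_lt enorm_lt_top)
  have hymem : y ∈ (w.space 𝕜).carrier := by
    refine ne_top_of_le_ne_top (x 0).2 (w.eNrm_mono ?_)
    filter_upwards [hy] with u hu
    rw [hu]
    exact iInf_le (fun n => f (x n) u) 0
  -- The pointwise infimum of the sequence is already a lower bound of the whole of `D`, so it
  -- vanishes because the infimum of `D` is `0`.
  have hylb : (⟨y, hymem⟩ : (w.space 𝕜).carrier) ≤ 0 := by
    refine hglb.2 fun d hd => ?_
    refine AEEqFun.le_of_enorm_le hy0 (hpos d hd) ?_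
    filter_upwards [hinf d hd, hy] with u h1 h2
    rw [h2]; exact h1
  have hyzero : ∀ᵐ u ∂halfLine, ⨅ n, f (x n) u = 0 := by
    filter_upwards [hy, AEEqFun.enorm_le_of_le hy0 hylb,
      AEEqFun.coeFn_zero (β := 𝕜) (μ := halfLine)] with u h1 h2 h3
    rw [← h1]
    rw [ZeroMemClass.coe_zero, h3] at h2
    simpa using h2
  have hlim : ∀ᵐ u ∂halfLine, Tendsto (fun n => f (x n) u) atTop (𝓝 0) := by
    filter_upwards [hmono, hyzero] with u h1 h2
    rw [← h2]
    exact tendsto_atTop_iInf h1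
  have hdom : ∀ n, f (x n) ≤ᵐ[halfLine] f (x 0) := fun n => by
    filter_upwards [hmono] with u hu
    exact hu (Nat.zero_le n)
  have := tendsto_kNorm_zero (c := w.c) (t := w.t) w.c_ne_top (fun n => hfm (x n)) (hfm (x 0)) hdom
    hlim (fun s hs => w.distribution_ne_top hw (x 0).2 hs) (x 0).2
  obtain ⟨n, hn⟩ := (this.eventually (gt_mem_nhds (ENNReal.ofReal_pos.2 hε))).exists
  refine ⟨x n, hxD n, ?_⟩
  have h2 : ENNReal.ofReal ‖x n‖ < ENNReal.ofReal ε := by rw [w.ofReal_norm]; exact hn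
  exact (ENNReal.ofReal_lt_ofReal_iff hε).1 h2

lemma isSymmetricKB_space (hw : ∑' k, (w.c k * w.t k) ^ 2 = ∞) : (w.space 𝕜).IsSymmetricKB :=
  ⟨w.isSymmetric_space, w.hasFatouProperty_space, w.hasOrderContinuousNorm_space hw⟩

end KWeights

/-! ### An abstract criterion for reflexivity -/

section Reflexivity

variable {𝕜 : Type*} [RCLike 𝕜] {W : Type*} [NormedAddCommGroup W] [NormedSpace 𝕜 W]

lemma norm_le_of_forall_re_le {ψ : StrongDual 𝕜 W} {u : ℝ}
    (h : ∀ x : W, ‖x‖ ≤ 1 → RCLike.re (ψ x) ≤ u) : ‖ψ‖ ≤ u := by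
  have h1 : ∀ z ∈ Metric.closedBall (0 : W) 1, ‖ψ z‖ ≤ u := by
    intro z hz
    obtain ⟨ζ, hζ, hz'⟩ := RCLike.exists_norm_eq_mul_self (ψ z)
    have := h (ζ • z) (by rw [norm_smul, hζ, one_mul]; simpa using hz)
    rwa [map_smul, smul_eq_mul, ← hz', RCLike.ofReal_re] at this
  simpa using ContinuousLinearMap.opNorm_bound_of_ball_bound one_pos u ψ h1

/-- Helly's theorem: a functional on the dual is approximated, on finitely many functionals, by
points of the unit ball. -/
lemma mem_closure_image_closedBall {I : Type*} [Finite I]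
    {Φ : StrongDual 𝕜 (StrongDual 𝕜 W)} (hΦ : ‖Φ‖ ≤ 1) (φ : I → StrongDual 𝕜 W) :
    (fun i => Φ (φ i)) ∈ closure ((fun (x : W) i => φ i x) '' Metric.closedBall 0 1) := by
  classical
  cases nonempty_fintype I
  let _ : NormedSpace ℝ W := NormedSpace.restrictScalars ℝ 𝕜 W
  by_contra hcon
  let T : W →ₗ[ℝ] (I → 𝕜) :=
    (LinearMap.pi fun i => (φ i : W →ₗ[𝕜] 𝕜)).restrictScalars ℝ
  have hconv : Convex ℝ (closure ((fun (x : W) i => φ i x) '' Metric.closedBall 0 1)) :=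
    ((convex_closedBall (0 : W) 1).linear_image T).closure
  -- A functional on the finite-dimensional space separating the point from the closed convex set is
  -- a linear combination of coordinates, so it pulls back to some `ψ` in the span of the `φ i`,
  -- with `‖ψ‖ ≤ u < re (Φ ψ)`.
  obtain ⟨f, u, h1, h2⟩ := RCLike.geometric_hahn_banach_closed_point (𝕜 := 𝕜) hconv
    isClosed_closure hcon
  let ψ : StrongDual 𝕜 W := ∑ i, f (Pi.single i 1) • φ i
  have hf : ∀ v : I → 𝕜, f v = ∑ i, f (Pi.single i 1) * v i := by
    intro v
    conv_lhs => rw [← Finset.univ_sum_single v, map_sum]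
    refine Finset.sum_congr rfl fun i _ => ?_
    have : (Pi.single i (v i) : I → 𝕜) = v i • Pi.single i 1 := by
      rw [← Pi.single_smul, smul_eq_mul, mul_one]
    rw [this, map_smul, smul_eq_mul, mul_comm]
  have hψ : ∀ x, ψ x = f fun i => φ i x := fun x => by
    rw [hf]; simp [ψ]
  have hΦψ : Φ ψ = f fun i => Φ (φ i) := by
    rw [hf]; simp [ψ]
  have hle : ‖ψ‖ ≤ u := norm_le_of_forall_re_le fun x hx => by
    rw [hψ]
    exact (h1 _ (subset_closure ⟨x, by simpa using hx, rfl⟩)).le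
  rw [← hΦψ] at h2
  have h3 : ‖Φ ψ‖ ≤ ‖ψ‖ := (Φ.le_opNorm ψ).trans (mul_le_of_le_one_left (norm_nonneg _) hΦ)
  exact absurd ((RCLike.re_le_norm _).trans (h3.trans hle)) (not_le.2 h2)

/-- Goldstine's theorem, in terms of ultrafilters. -/
lemma exists_ultrafilter_tendsto {Φ : StrongDual 𝕜 (StrongDual 𝕜 W)} (hΦ : ‖Φ‖ ≤ 1) :
    ∃ U : Ultrafilter W, (∀ᶠ x in (U : Filter W), ‖x‖ ≤ 1) ∧
      ∀ φ : StrongDual 𝕜 W, Tendsto (fun x => φ x) U (𝓝 (Φ φ)) := by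
  have hmem : (fun φ => Φ φ) ∈
      closure ((fun (x : W) (φ : StrongDual 𝕜 W) => φ x) '' Metric.closedBall 0 1) := by
    rw [mem_closure_iff_nhds]
    intro s hs
    rw [nhds_pi, Filter.mem_pi] at hs
    obtain ⟨I, hI, t, ht, hts⟩ := hs
    have := hI.to_subtype
    have h := mem_closure_image_closedBall hΦ (fun i : I => (i : StrongDual 𝕜 W))
    rw [mem_closure_iff_nhds] at h
    obtain ⟨_, h1, x, hx, rfl⟩ := h (univ.pi fun i : I => t i)
      (set_pi_mem_nhds finite_univ fun i _ => ht i)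
    exact ⟨_, hts fun i hi => h1 ⟨i, hi⟩ trivial, x, hx, rfl⟩
  obtain ⟨V, hV, hV'⟩ := mem_closure_iff_ultrafilter.1 hmem
  refine ⟨Ultrafilter.ofComapInfPrincipal hV, ?_, fun φ => ?_⟩
  · filter_upwards [Ultrafilter.ofComapInfPrincipal_mem hV] with x hx
    simpa using hx
  · have hmap := Ultrafilter.ofComapInfPrincipal_eq_of_map hV
    have h : Tendsto (fun (x : W) (φ : StrongDual 𝕜 W) => φ x)
        (Ultrafilter.ofComapInfPrincipal hV) (𝓝 fun φ => Φ φ) := by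
      rw [Tendsto, ← Ultrafilter.coe_map, hmap]
      exact hV'
    exact (tendsto_pi_nhds.1 h) φ

/-- Bounded families in a Hilbert space converge weakly along ultrafilters. -/
lemma exists_weak_limit {H X : Type*} [NormedAddCommGroup H] [InnerProductSpace 𝕜 H]
    [CompleteSpace H] (U : Ultrafilter X) {y : X → H} {C : ℝ} (hy : ∀ᶠ x in U, ‖y x‖ ≤ C) :
    ∃ Y : H, ∀ ψ : StrongDual 𝕜 H, Tendsto (fun x => ψ (y x)) U (𝓝 (ψ Y)) := by
  -- The Riesz representation moves the family into the dual of `H`, where closed balls are weak-*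
  -- compact.
  let z : X → WeakDual 𝕜 H := fun x => StrongDual.toWeakDual (InnerProductSpace.toDual 𝕜 H (y x))
  have hc := WeakDual.isCompact_closedBall (𝕜 := 𝕜) (0 : StrongDual 𝕜 H) C
  obtain ⟨L, -, hL⟩ := hc.ultrafilter_le_nhds (U.map z) (by
    rw [le_principal_iff, Ultrafilter.coe_map, Filter.mem_map]
    filter_upwards [hy] with x hx
    simpa [z] using hx)
  refine ⟨(InnerProductSpace.toDual 𝕜 H).symm (WeakDual.toStrongDual L), fun ψ => ?_⟩
  set h := (InnerProductSpace.toDual 𝕜 H).symm ψ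
  have hψ : ∀ v, ψ v = starRingEnd 𝕜 (inner 𝕜 v h) := fun v => by
    rw [inner_conj_symm]
    exact (InnerProductSpace.toDual_symm_apply (𝕜 := 𝕜)).symm
  simp only [hψ]
  refine (RCLike.continuous_conj.tendsto _).comp ?_
  have h1 : Tendsto (fun x => z x h) U (𝓝 (L h)) :=
    ((WeakDual.eval_continuous h).tendsto L).comp hL
  rw [InnerProductSpace.toDual_symm_apply]
  exact h1

/-- Weak lower semicontinuity of the norm, tested on a functional of norm at most one that attains
`‖T Y‖`. -/
lemma norm_le_of_weak_limit {H X G : Type*} [NormedAddCommGroup H] [NormedSpace 𝕜 H]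
    [NormedAddCommGroup G] [NormedSpace 𝕜 G] {U : Ultrafilter X} {y : X → H} {Y : H}
    (hY : ∀ ψ : StrongDual 𝕜 H, Tendsto (fun x => ψ (y x)) U (𝓝 (ψ Y))) (T : H →L[𝕜] G) {C : ℝ}
    (hT : ∀ᶠ x in U, ‖T (y x)‖ ≤ C) : ‖T Y‖ ≤ C := by
  obtain ⟨g, hg1, hg⟩ := exists_dual_vector'' 𝕜 (T Y)
  have h1 := (hY (g.comp T)).norm
  have h2 : ‖g.comp T Y‖ = ‖T Y‖ := by
    rw [ContinuousLinearMap.comp_apply, hg]; simp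
  rw [← h2]
  refine le_of_tendsto h1 ?_
  filter_upwards [hT] with x hx
  exact (g.le_opNorm _).trans ((mul_le_of_le_one_left (norm_nonneg _) hg1).trans hx)

/-- A functional on a space normed by the `ℓ₂`-sum of two seminorms splits accordingly. -/
lemma exists_dual_split (p q : Seminorm 𝕜 W) (hpq : ∀ x, ‖x‖ ^ 2 = p x ^ 2 + q x ^ 2)
    (φ : StrongDual 𝕜 W) :
    ∃ φ₁ φ₂ : StrongDual 𝕜 W, φ = φ₁ + φ₂ ∧
      ∀ u v, ‖φ₁ u‖ + ‖φ₂ v‖ ≤ ‖φ‖ * √(p u ^ 2 + q v ^ 2) := by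
  let _ : NormedSpace ℝ W := NormedSpace.restrictScalars ℝ 𝕜 W
  have hsmul : ∀ (r : ℝ) (x : W), r • x = (r : 𝕜) • x := fun r x => by
    rw [RCLike.real_smul_eq_coe_smul (K := 𝕜)]
  -- By `hpq`, the real part of `φ`, placed on the diagonal of `W × W`, is dominated by this
  -- sublinear functional. A Hahn–Banach extension restricted to the two axes gives the two
  -- summands.
  let N : W × W → ℝ := fun z => ‖φ‖ * √(p z.1 ^ 2 + q z.2 ^ 2)
  let D : Submodule ℝ (W × W) := LinearMap.eqLocus (LinearMap.fst ℝ W W) (LinearMap.snd ℝ W W)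
  let φr : W →ₗ[ℝ] ℝ := RCLike.reLm.comp ((φ : W →ₗ[𝕜] 𝕜).restrictScalars ℝ)
  let f : W × W →ₗ.[ℝ] ℝ := ⟨D, (φr.comp (LinearMap.fst ℝ W W)).domRestrict D⟩
  have hN1 : ∀ r : ℝ, 0 < r → ∀ z, N (r • z) = r * N z := by
    intro r hr z
    change ‖φ‖ * √(p (r • z.1) ^ 2 + q (r • z.2) ^ 2) = r * (‖φ‖ * √(p z.1 ^ 2 + q z.2 ^ 2))
    rw [hsmul, hsmul, map_smul_eq_mul, map_smul_eq_mul, RCLike.norm_ofReal, abs_of_pos hr, mul_pow,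
      mul_pow, ← mul_add, Real.sqrt_mul (sq_nonneg r), Real.sqrt_sq hr.le]
    ring
  have hN2 : ∀ z z', N (z + z') ≤ N z + N z' := by
    intro z z'
    change ‖φ‖ * √(p (z.1 + z'.1) ^ 2 + q (z.2 + z'.2) ^ 2) ≤
      ‖φ‖ * √(p z.1 ^ 2 + q z.2 ^ 2) + ‖φ‖ * √(p z'.1 ^ 2 + q z'.2 ^ 2)
    rw [← mul_add]
    refine mul_le_mul_of_nonneg_left ?_ (norm_nonneg φ)
    have hE : ∀ a b : ℝ, √(a ^ 2 + b ^ 2) = ‖(!₂[a, b] : EuclideanSpace ℝ (Fin 2))‖ := fun a b => by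
      simp [EuclideanSpace.norm_eq]
    calc √(p (z.1 + z'.1) ^ 2 + q (z.2 + z'.2) ^ 2)
        ≤ √((p z.1 + p z'.1) ^ 2 + (q z.2 + q z'.2) ^ 2) := by
          gcongr
          · exact map_add_le_add p _ _
          · exact map_add_le_add q _ _
      _ ≤ _ := by
        rw [hE, hE, hE]
        refine le_trans (le_of_eq ?_) (norm_add_le _ _)
        congr 1
        ext i
        fin_cases i <;> simp
  have hN3 : ∀ x : f.domain, f x ≤ N x := by
    rintro ⟨⟨x, y⟩, hxy⟩
    have hxy : x = y := hxy
    subst hxy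
    change RCLike.re (φ x) ≤ ‖φ‖ * √(p x ^ 2 + q x ^ 2)
    rw [← hpq, Real.sqrt_sq (norm_nonneg x)]
    exact (RCLike.re_le_norm _).trans (φ.le_opNorm x)
  obtain ⟨g, hg1, hg2⟩ := exists_extension_of_le_sublinear f N hN1 hN2 hN3
  let g₁ : Module.Dual ℝ W := g.comp (LinearMap.inl ℝ W W)
  let g₂ : Module.Dual ℝ W := g.comp (LinearMap.inr ℝ W W)
  let l₁ : W →ₗ[𝕜] 𝕜 := Module.Dual.extendRCLike g₁
  let l₂ : W →ₗ[𝕜] 𝕜 := Module.Dual.extendRCLike g₂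
  have hl : ∀ u v, ‖l₁ u‖ + ‖l₂ v‖ ≤ ‖φ‖ * √(p u ^ 2 + q v ^ 2) := by
    intro u v
    -- Unimodular scalars make both values real and nonnegative, so their sum is one value of `g`,
    -- at `(a • u, b • v)`; `N` does not see these scalars.
    obtain ⟨a, ha, hau⟩ := RCLike.exists_norm_eq_mul_self (l₁ u)
    obtain ⟨b, hb, hbv⟩ := RCLike.exists_norm_eq_mul_self (l₂ v)
    have e1 : ‖l₁ u‖ = g (a • u, 0) := by
      have : RCLike.re (l₁ (a • u)) = g₁ (a • u) := Module.Dual.re_extendRCLike_apply g₁ _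
      rw [map_smul, smul_eq_mul, ← hau, RCLike.ofReal_re] at this
      exact this
    have e2 : ‖l₂ v‖ = g (0, b • v) := by
      have : RCLike.re (l₂ (b • v)) = g₂ (b • v) := Module.Dual.re_extendRCLike_apply g₂ _
      rw [map_smul, smul_eq_mul, ← hbv, RCLike.ofReal_re] at this
      exact this
    rw [e1, e2, ← map_add]
    refine (hg2 _).trans ?_
    simp [N, map_smul_eq_mul, ha, hb]
  have hp : ∀ x, p x ≤ ‖x‖ := fun x =>
    abs_le_of_sq_le_sq' (by nlinarith [hpq x, sq_nonneg (q x)]) (norm_nonneg x) |>.2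
  have hq : ∀ x, q x ≤ ‖x‖ := fun x =>
    abs_le_of_sq_le_sq' (by nlinarith [hpq x, sq_nonneg (p x)]) (norm_nonneg x) |>.2
  refine ⟨l₁.mkContinuous ‖φ‖ fun u => ?_, l₂.mkContinuous ‖φ‖ fun v => ?_, ?_, hl⟩
  · have := hl u 0
    simp only [map_zero, norm_zero, add_zero, ne_eq, OfNat.ofNat_ne_zero, not_false_eq_true,
      zero_pow, Real.sqrt_sq (apply_nonneg p u)] at this
    exact this.trans (by gcongr; exact hp u)
  · have := hl 0 v
    simp only [map_zero, norm_zero, zero_add, ne_eq, OfNat.ofNat_ne_zero, not_false_eq_true,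
      zero_pow, Real.sqrt_sq (apply_nonneg q v)] at this
    exact this.trans (by gcongr; exact hq v)
  · have hre : ∀ x, RCLike.re (φ x) = RCLike.re (l₁ x + l₂ x) := by
      intro x
      rw [map_add, show RCLike.re (l₁ x) = g₁ x from Module.Dual.re_extendRCLike_apply g₁ x,
        show RCLike.re (l₂ x) = g₂ x from Module.Dual.re_extendRCLike_apply g₂ x]
      have h1 := hg1 ⟨(x, x), rfl⟩
      have h2 : (x, x) = (x, 0) + (0, x) := by simp
      change g (x, x) = RCLike.re (φ x) at h1
      rw [← h1, h2, map_add]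
      rfl
    ext x
    refine RCLike.ext (hre x) ?_
    have h := hre ((RCLike.I : 𝕜) • x)
    rw [φ.map_smul, l₁.map_smul, l₂.map_smul, ← smul_add, smul_eq_mul, smul_eq_mul,
      RCLike.I_mul_re, RCLike.I_mul_re] at h
    exact neg_inj.1 h

/-- If the norm is, for every `S`, the `ℓ₂`-sum of `p S` and of `q S`, and `q S x` can be made
arbitrarily small for each `x`, then the functionals dominated by some `p S` are dense. -/
lemma exists_dual_approx {σ : Type*} (p q : σ → Seminorm 𝕜 W)
    (hpq : ∀ S x, ‖x‖ ^ 2 = p S x ^ 2 + q S x ^ 2) (hq : ∀ x, ∀ η > 0, ∃ S, q S x ≤ η)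
    (φ : StrongDual 𝕜 W) {ε : ℝ} (hε : 0 < ε) :
    ∃ (S : σ) (φ₁ φ₂ : StrongDual 𝕜 W), φ = φ₁ + φ₂ ∧ (∀ u, ‖φ₁ u‖ ≤ ‖φ‖ * p S u) ∧ ‖φ₂‖ ≤ ε := by
  set M := ‖φ‖ with hM
  have hM0 : 0 ≤ M := norm_nonneg φ
  set r := ε / (2 * (M + 1)) with hr
  have hr0 : 0 < r := by positivity
  -- Here `x` norms `φ` up to `r²`, and `S` is chosen with `q S x ≤ r²`. Then `φ₁` nearly takes its
  -- largest possible value at `x`, which leaves little room for `φ₂`.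
  obtain ⟨x, hx1, hx⟩ : ∃ x : W, ‖x‖ ≤ 1 ∧ M - r ^ 2 ≤ ‖φ x‖ := by
    by_contra! hcon
    have h1 : M ≤ M - r ^ 2 := norm_le_of_forall_re_le fun x hx =>
      (RCLike.re_le_norm _).trans (hcon x hx).le
    nlinarith
  obtain ⟨S, hS⟩ := hq x (r ^ 2) (by positivity)
  obtain ⟨φ₁, φ₂, hφ, h⟩ := exists_dual_split (p S) (q S) (hpq S) φ
  refine ⟨S, φ₁, φ₂, hφ, fun u => ?_, ?_⟩
  · have := h u 0
    simpa [Real.sqrt_sq (apply_nonneg (p S) u)] using this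
  have hp1 : p S x ^ 2 ≤ 1 := by
    have h1 : ‖x‖ ^ 2 ≤ 1 := by nlinarith [norm_nonneg x]
    nlinarith [hpq S x, sq_nonneg (q S x)]
  have h2x : ‖φ₂ x‖ ≤ M * r ^ 2 := by
    have := h 0 x
    simp only [map_zero, norm_zero, zero_add, ne_eq, OfNat.ofNat_ne_zero, not_false_eq_true,
        zero_pow, Real.sqrt_sq (apply_nonneg (q S) x)] at this
    exact this.trans (by gcongr)
  have h1x : M - r ^ 2 - M * r ^ 2 ≤ ‖φ₁ x‖ := by
    have : ‖φ x‖ ≤ ‖φ₁ x‖ + ‖φ₂ x‖ := by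
      rw [hφ]; exact norm_add_le _ _
    linarith
  refine norm_le_of_forall_re_le fun v hv => (RCLike.re_le_norm _).trans ?_
  have hqv : q S v ^ 2 ≤ 1 := by
    have h1 : ‖v‖ ^ 2 ≤ 1 := by nlinarith [norm_nonneg v]
    nlinarith [hpq S v, sq_nonneg (p S v)]
  -- The perturbation `r • v` costs only second order, since `√(1 + r²) ≤ 1 + r² / 2`, while its
  -- contribution `r * ‖φ₂ v‖` is of first order. Dividing by `r` bounds `‖φ₂ v‖` by `2 * r * (M +
  -- 1) = ε`.
  have hv2 := h x ((r : 𝕜) • v)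
  rw [map_smul, norm_smul, map_smul_eq_mul, RCLike.norm_ofReal, abs_of_pos hr0] at hv2
  have hsq : √(p S x ^ 2 + (r * q S v) ^ 2) ≤ 1 + r ^ 2 / 2 := by
    rw [Real.sqrt_le_left (by positivity)]
    nlinarith [mul_le_mul_of_nonneg_left hqv (sq_nonneg r), sq_nonneg (r ^ 2)]
  have hfin : r * ‖φ₂ v‖ ≤ r * (r * (2 * (M + 1))) := by
    have := mul_le_mul_of_nonneg_left hsq hM0
    nlinarith
  have := le_of_mul_le_mul_left hfin hr0
  rwa [hr, div_mul_cancel₀ _ (by positivity)] at this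

/-- A criterion for reflexivity: `W` contains a continuous image of a Hilbert space `H`, embeds
into a Banach space `X`, and its unit ball is, up to small errors in `X`, contained in bounded parts
of `H`. -/
theorem surjective_inclusionInDoubleDual {H X : Type*} [NormedAddCommGroup H]
    [InnerProductSpace 𝕜 H] [CompleteSpace H] [NormedAddCommGroup X] [NormedSpace 𝕜 X]
    [CompleteSpace X] (j : H →L[𝕜] W) (i : W →L[𝕜] X)
    (htrunc : ∀ ε > 0, ∃ C : ℝ, ∀ x : W, ‖x‖ ≤ 1 →
      ∃ y : H, ‖y‖ ≤ C ∧ ‖j y‖ ≤ 1 ∧ ‖i x - i (j y)‖ ≤ ε)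
    (hclosed : ∀ (v : ℕ → W) (z : X), (∀ n, ‖v n‖ ≤ 1) → Tendsto (fun n => i (v n)) atTop (𝓝 z) →
      z ∈ range i)
    (hdense : ∀ (φ : StrongDual 𝕜 W), ∀ ε > 0, ∃ φ₁ φ₂ : StrongDual 𝕜 W, φ = φ₁ + φ₂ ∧
      (∃ C, ∀ u, ‖φ₁ u‖ ≤ C * ‖i u‖) ∧ ‖φ₂‖ ≤ ε) :
    Function.Surjective (NormedSpace.inclusionInDoubleDual 𝕜 W) := by
  have main : ∀ Φ : StrongDual 𝕜 (StrongDual 𝕜 W), ‖Φ‖ ≤ 1 →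
      ∃ Y, NormedSpace.inclusionInDoubleDual 𝕜 W Y = Φ := by
    intro Φ hΦ
    obtain ⟨U, hU, hUΦ⟩ := exists_ultrafilter_tendsto hΦ
    set ε : ℕ → ℝ := fun n => 1 / ((n : ℝ) + 1) with hε
    have hεpos : ∀ n, 0 < ε n := fun n => Nat.one_div_pos_of_nat
    have hεlim : Tendsto ε atTop (𝓝 0) := tendsto_one_div_add_atTop_nhds_zero_nat
    have hex : ∀ n, ∃ (C : ℝ) (y : W → H), ∀ x, ‖x‖ ≤ 1 →
        ‖y x‖ ≤ C ∧ ‖j (y x)‖ ≤ 1 ∧ ‖i x - i (j (y x))‖ ≤ ε n := by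
      intro n
      obtain ⟨C, hC⟩ := htrunc (ε n) (hεpos n)
      choose! y hy using hC
      exact ⟨C, y, hy⟩
    choose C y hy using hex
    -- At precision `ε n` the approximants form a bounded family in `H`, so they have a weak limit
    -- `Y n` along the Goldstine ultrafilter.
    have hw : ∀ n, ∃ Y : H, ∀ ψ : StrongDual 𝕜 H, Tendsto (fun x => ψ (y n x)) U (𝓝 (ψ Y)) :=
      fun n => exists_weak_limit U (hU.mono fun x hx => (hy n x hx).1)
    choose Y hY using hw
    have hYn : ∀ n, ‖j (Y n)‖ ≤ 1 := fun n =>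
      norm_le_of_weak_limit (hY n) j (hU.mono fun x hx => (hy n x hx).2.1)
    have hYd : ∀ m n, ‖i (j (Y m)) - i (j (Y n))‖ ≤ ε m + ε n := by
      intro m n
      have h1 : ∀ ψ : StrongDual 𝕜 H, Tendsto (fun x => ψ (y m x - y n x)) U
          (𝓝 (ψ (Y m - Y n))) := fun ψ => by
        simpa only [map_sub] using (hY m ψ).sub (hY n ψ)
      have h2 := norm_le_of_weak_limit h1 (i.comp j) (C := ε m + ε n) (hU.mono fun x hx => by
        rw [ContinuousLinearMap.comp_apply, map_sub, map_sub]
        have := norm_sub_le (i x - i (j (y n x))) (i x - i (j (y m x)))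
        rw [sub_sub_sub_cancel_left] at this
        linarith [(hy m x hx).2.2, (hy n x hx).2.2])
      simpa using h2
    have hcauchy : CauchySeq fun n => i (j (Y n)) := by
      refine cauchySeq_of_le_tendsto_0 (fun n => 2 * ε n) (fun n m N hn hm => ?_)
        (by simpa using hεlim.const_mul 2)
      have hanti : Antitone ε := fun a b h => Nat.one_div_le_one_div h
      rw [dist_eq_norm]
      linarith [hYd n m, hanti hn, hanti hm]
    obtain ⟨z, hz⟩ := cauchySeq_tendsto_of_complete hcauchy
    obtain ⟨Z, rfl⟩ := hclosed _ z hYn hz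
    refine ⟨Z, ?_⟩
    -- A functional controlled by the norm of `X` does not distinguish a point from its approximant
    -- by more than a multiple of `ε n`, so `Φ` acts on it as evaluation at `Z`.
    have hV : ∀ φ₁ : StrongDual 𝕜 W, (∃ C, ∀ u, ‖φ₁ u‖ ≤ C * ‖i u‖) → Φ φ₁ = φ₁ Z := by
      rintro φ₁ ⟨B, hB⟩
      wlog hB0 : 0 ≤ B generalizing B
      · exact this 0 (fun u => (hB u).trans (by nlinarith [norm_nonneg (i u)])) le_rfl
      have h1 : ∀ n, ‖Φ φ₁ - φ₁ (j (Y n))‖ ≤ B * ε n := by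
        intro n
        refine le_of_tendsto ((hUΦ φ₁).sub (hY n (φ₁.comp j))).norm (hU.mono fun x hx => ?_)
        rw [ContinuousLinearMap.comp_apply, ← map_sub]
        refine (hB _).trans ?_
        rw [map_sub]
        exact mul_le_mul_of_nonneg_left (hy n x hx).2.2 hB0
      have h2 : Tendsto (fun n => φ₁ (j (Y n))) atTop (𝓝 (Φ φ₁)) := by
        rw [tendsto_iff_norm_sub_tendsto_zero]
        refine squeeze_zero (fun _ => norm_nonneg _) (fun n => ?_)
          (by simpa using hεlim.const_mul B)
        rw [norm_sub_rev]
        exact h1 n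
      have h3 : Tendsto (fun n => φ₁ (j (Y n))) atTop (𝓝 (φ₁ Z)) := by
        rw [tendsto_iff_norm_sub_tendsto_zero] at hz ⊢
        refine squeeze_zero (fun _ => norm_nonneg _) (fun n => ?_)
          (by simpa using hz.const_mul B)
        rw [← map_sub, ← map_sub]
        exact hB _
      exact tendsto_nhds_unique h2 h3
    ext φ
    rw [NormedSpace.dual_def]
    have hsmall : ∀ δ > 0, ‖φ Z - Φ φ‖ ≤ δ * (‖Z‖ + 1) := by
      intro δ hδ
      obtain ⟨φ₁, φ₂, rfl, hφ₁, hφ₂⟩ := hdense φ δ hδ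
      rw [map_add, hV φ₁ hφ₁, add_apply, add_sub_add_left_eq_sub]
      refine (norm_sub_le _ _).trans ?_
      have h1 : ‖φ₂ Z‖ ≤ δ * ‖Z‖ := (φ₂.le_opNorm Z).trans (by gcongr)
      have h2 : ‖Φ φ₂‖ ≤ δ := (Φ.le_opNorm φ₂).trans
        ((mul_le_of_le_one_left (norm_nonneg _) hΦ).trans hφ₂)
      linarith
    refine sub_eq_zero.1 (norm_le_zero_iff.1 (le_of_forall_pos_le_add fun δ hδ => ?_))
    have h0 : 0 < ‖Z‖ + 1 := by positivity
    have := hsmall (δ / (‖Z‖ + 1)) (by positivity)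
    rwa [div_mul_cancel₀ _ h0.ne', ← zero_add δ] at this
  intro Φ
  have hpos : (0 : ℝ) < ‖Φ‖ + 1 := by positivity
  have hne : ((‖Φ‖ + 1 : ℝ) : 𝕜) ≠ 0 := by exact_mod_cast hpos.ne'
  obtain ⟨Y, hY⟩ := main (((‖Φ‖ + 1 : ℝ) : 𝕜)⁻¹ • Φ) (by
    refine (ContinuousLinearMap.opNorm_smul_le _ _).trans ?_
    rw [norm_inv, RCLike.norm_ofReal, abs_of_pos hpos, inv_mul_le_iff₀ hpos]
    linarith)
  refine ⟨((‖Φ‖ + 1 : ℝ) : 𝕜) • Y, ?_⟩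
  rw [map_smul, hY, smul_smul, mul_inv_cancel₀ hne, one_smul]

end Reflexivity

/-! ### Finite partial sums and uniform smallness on the unit ball -/

section Comparison

variable {α ι : Type*} [MeasurableSpace α] {ν : Measure α}

lemma kFun_le_const_mul (ν : Measure α) {t t' : ℝ≥0∞} (ht : t ≠ ∞) (ht'0 : t' ≠ 0) (ht' : t' ≠ ∞) :
    ∃ C ≠ ∞, ∀ f : α → ℝ≥0∞, kFun ν t f ≤ C * kFun ν t' f := by
  rcases le_total t t' with h | h
  · exact ⟨1, ENNReal.one_ne_top, fun f => by simpa using kFun_mono_left f h⟩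
  · refine ⟨t / t', ENNReal.div_ne_top ht ht'0, fun f => ?_⟩
    have := kFun_mul_le (ν := ν) h ht f
    rwa [← ENNReal.mul_le_mul_iff_right ht'0 ht', ← mul_assoc, ENNReal.mul_div_cancel ht'0 ht']

/-- Each `K(t k, ·)` is bounded by a multiple of `K(1, ·)`, the norm of `L₁ + L_∞`, so any finite
part of the sum is too. -/
lemma kNorm_finset_indicator_le {c t : ι → ℝ≥0∞} (hc : ∀ k, c k ≠ ∞) (ht : ∀ k, t k ≠ ∞)
    (S : Finset ι) :
    ∃ C ≠ ∞, ∀ f : α → ℝ≥0∞,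
      kNorm ν ((S : Set ι).indicator c) t f ≤ C * kFun ν 1 f := by
  choose B hB hBf using fun k => kFun_le_const_mul ν (ht k) one_ne_zero ENNReal.one_ne_top
  refine ⟨(∑ k ∈ S, (c k * B k) ^ 2) ^ (1 / 2 : ℝ), ?_, fun f => ?_⟩
  · refine ENNReal.rpow_ne_top_of_nonneg (by norm_num) (ENNReal.sum_ne_top.2 fun k _ => ?_)
    exact ENNReal.pow_ne_top (ENNReal.mul_ne_top (hc k) (hB k))
  · rw [← ENNReal.pow_le_pow_left_iff two_ne_zero, kNorm_sq, mul_pow, ← ENNReal.rpow_two (_ ^ _),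
      ← ENNReal.rpow_mul, tsum_eq_sum (s := S)]
    · norm_num
      rw [Finset.sum_mul]
      refine Finset.sum_le_sum fun k hk => ?_
      rw [indicator_of_mem (by simpa using hk), ← mul_pow, mul_assoc]
      gcongr
      exact hBf k f
    · intro k hk
      rw [indicator_of_notMem (by simpa using hk)]
      simp

lemma kNorm_indicator_le {c t : ι → ℝ≥0∞} (s : Set ι) (f : α → ℝ≥0∞) :
    kNorm ν (s.indicator c) t f ≤ kNorm ν c t f := by
  unfold kNorm
  gcongr with k
  exact indicator_le_self _ _ _

lemma kNorm_sq_add_compl (c t : ι → ℝ≥0∞) (s : Set ι) (f : α → ℝ≥0∞) :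
    kNorm ν c t f ^ 2 = kNorm ν (s.indicator c) t f ^ 2 + kNorm ν (sᶜ.indicator c) t f ^ 2 := by
  rw [kNorm_sq, kNorm_sq, kNorm_sq, ← ENNReal.tsum_add]
  refine tsum_congr fun k => ?_
  by_cases hk : k ∈ s <;> simp [hk]

lemma exists_finset_kNorm_compl_le {c t : ι → ℝ≥0∞} {f : α → ℝ≥0∞} (hf : kNorm ν c t f ≠ ∞)
    {η : ℝ≥0∞} (hη : η ≠ 0) :
    ∃ S : Finset ι, kNorm ν ((S : Set ι)ᶜ.indicator c) t f ≤ η := by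
  have h1 : ∑' k, (c k * kFun ν (t k) f) ^ 2 ≠ ∞ := by
    rw [← kNorm_sq]; exact ENNReal.pow_ne_top hf
  have h2 := ENNReal.tendsto_tsum_compl_atTop_zero h1
  have hη2 : 0 < η ^ 2 := pos_iff_ne_zero.2 (pow_ne_zero _ hη)
  obtain ⟨S, hS⟩ := (h2.eventually (gt_mem_nhds hη2)).exists
  refine ⟨S, ?_⟩
  rw [← ENNReal.pow_le_pow_left_iff two_ne_zero, kNorm_sq]
  refine le_trans (le_of_eq ?_) hS.le
  have := tsum_subtype (S : Set ι)ᶜ fun k => (c k * kFun ν (t k) f) ^ 2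
  refine Eq.trans (tsum_congr fun k => ?_) this.symm
  by_cases hk : k ∈ (S : Set ι)ᶜ
  · rw [indicator_of_mem hk, indicator_of_mem hk]
  · rw [indicator_of_notMem hk, indicator_of_notMem hk]; simp

lemma kNorm_le_of_finset {c t : ι → ℝ≥0∞} {f : α → ℝ≥0∞} {M : ℝ≥0∞}
    (h : ∀ S : Finset ι, kNorm ν ((S : Set ι).indicator c) t f ≤ M) : kNorm ν c t f ≤ M := by
  unfold kNorm at h ⊢
  rw [ENNReal.rpow_half_tsum_le_iff]
  intro S
  refine le_trans (le_of_eq ?_) (ENNReal.rpow_half_tsum_le_iff.1 (h S) S)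
  congr 1
  refine Finset.sum_congr rfl fun k hk => ?_
  rw [indicator_of_mem (by simpa using hk)]

/-- If `∑ c² = ∞`, then `K(δ, ·)` is small on the unit ball for some `δ > 0`. -/
lemma exists_kFun_le {c t : ι → ℝ≥0∞} (ht : ∀ k, t k ≠ 0) (hc : ∑' k, c k ^ 2 = ∞) {ε : ℝ≥0∞}
    (hε : ε ≠ 0) :
    ∃ δ, δ ≠ 0 ∧ δ ≠ ∞ ∧ ∀ f : α → ℝ≥0∞, kNorm ν c t f ≤ 1 → kFun ν δ f ≤ ε := by
  have hε2 : ε ^ 2 ≠ 0 := pow_ne_zero _ hε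
  have htop : ∑' k, ε ^ 2 * c k ^ 2 = ∞ := by rw [ENNReal.tsum_mul_left, hc, ENNReal.mul_top hε2]
  rw [ENNReal.tsum_eq_iSup_sum] at htop
  -- Finitely many weights already satisfy `∑ ε² c² > 1`. With `δ` below all the corresponding `t
  -- k`, an inequality `K(δ, f) > ε` would give `K(t k, f) > ε` on `S` and a norm above `1`.
  obtain ⟨S, hS⟩ := lt_iSup_iff.1 (htop ▸ ENNReal.one_lt_top :
    1 < ⨆ S : Finset ι, ∑ k ∈ S, ε ^ 2 * c k ^ 2)
  refine ⟨min 1 (S.inf t), ?_, ?_, fun f hf => ?_⟩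
  · rw [← pos_iff_ne_zero, lt_min_iff]
    refine ⟨one_pos, (Finset.lt_inf_iff ENNReal.zero_lt_top).2 fun k _ => pos_iff_ne_zero.2 (ht k)⟩
  · exact ne_top_of_le_ne_top ENNReal.one_ne_top (min_le_left _ _)
  by_contra! hlt
  have h1 : ∑' k, (c k * kFun ν (t k) f) ^ 2 ≤ 1 := by
    rw [← kNorm_sq]; exact pow_le_one₀ bot_le hf
  refine absurd ((ENNReal.sum_le_tsum S).trans h1) (not_le.2 (hS.trans_le ?_))
  refine Finset.sum_le_sum fun k hk => ?_
  rw [← mul_pow, mul_comm]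
  gcongr
  exact hlt.le.trans (kFun_mono_left f ((min_le_right _ _).trans (Finset.inf_le hk)))

/-- If `∑ (c t)² = ∞`, then `K(T, ·) / T` is small on the unit ball for some `T`. -/
lemma exists_kFun_le_mul {c t : ι → ℝ≥0∞} (ht : ∀ k, t k ≠ ∞)
    (hc : ∑' k, (c k * t k) ^ 2 = ∞) {ε : ℝ≥0∞} (hε : ε ≠ 0) :
    ∃ T, T ≠ 0 ∧ T ≠ ∞ ∧ ∀ f : α → ℝ≥0∞, kNorm ν c t f ≤ 1 → kFun ν T f ≤ ε * T := by
  have hε2 : ε ^ 2 ≠ 0 := pow_ne_zero _ hε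
  have htop : ∑' k, ε ^ 2 * (c k * t k) ^ 2 = ∞ := by
    rw [ENNReal.tsum_mul_left, hc, ENNReal.mul_top hε2]
  rw [ENNReal.tsum_eq_iSup_sum] at htop
  obtain ⟨S, hS⟩ := lt_iSup_iff.1 (htop ▸ ENNReal.one_lt_top :
    1 < ⨆ S : Finset ι, ∑ k ∈ S, ε ^ 2 * (c k * t k) ^ 2)
  have hT0 : max 1 (S.sup t) ≠ 0 := (lt_max_of_lt_left one_pos).ne'
  have hTt : max 1 (S.sup t) ≠ ∞ := by
    rw [← lt_top_iff_ne_top, max_lt_iff]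
    exact ⟨ENNReal.one_lt_top, (Finset.sup_lt_iff ENNReal.zero_lt_top).2
      fun k _ => lt_top_iff_ne_top.2 (ht k)⟩
  refine ⟨max 1 (S.sup t), hT0, hTt, fun f hf => ?_⟩
  by_contra! hlt
  have h1 : ∑' k, (c k * kFun ν (t k) f) ^ 2 ≤ 1 := by
    rw [← kNorm_sq]; exact pow_le_one₀ bot_le hf
  refine absurd ((ENNReal.sum_le_tsum S).trans h1) (not_le.2 (hS.trans_le ?_))
  refine Finset.sum_le_sum fun k hk => ?_
  rw [← mul_pow, mul_left_comm]
  gcongr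
  -- As `K(t) / t` decreases and `T` is at least every `t k` in `S`, a large value of `K(T, f) / T`
  -- forces equally large values of `K(t k, f) / t k`.
  have h2 := kFun_mul_le (ν := ν) (t := t k) ((Finset.le_sup hk).trans (le_max_right 1 _)) hTt f
  rw [← ENNReal.mul_le_mul_iff_right hT0 hTt]
  refine le_trans ?_ h2
  calc _ = t k * (ε * max 1 (S.sup t)) := by ring
    _ ≤ _ := by gcongr

end Comparison

/-! ### Truncation into L₂ -/

section Lp

variable {𝕜 : Type*} [RCLike 𝕜]

lemma lintegral_enorm_sq_eq (x : Lp 𝕜 2 halfLine) :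
    ∫⁻ u, ‖(x : ℝ →ₘ[halfLine] 𝕜) u‖ₑ ^ 2 ∂halfLine = ENNReal.ofReal (‖x‖ ^ 2) := by
  have h := eLpNorm_nnreal_pow_eq_lintegral (μ := halfLine) (p := 2) (f := x) (by norm_num)
  rw [Lp.norm_def, ← ENNReal.toReal_pow, ENNReal.ofReal_toReal
    (ENNReal.pow_ne_top (Lp.eLpNorm_ne_top x))]
  simpa using h.symm

lemma exists_Lp_of_lintegral_sq_le {y : ℝ →ₘ[halfLine] 𝕜} {C : ℝ} (hC : 0 ≤ C)
    (h : ∫⁻ u, ‖y u‖ₑ ^ 2 ∂halfLine ≤ ENNReal.ofReal (C ^ 2)) :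
    ∃ z : Lp 𝕜 2 halfLine, (z : ℝ →ₘ[halfLine] 𝕜) = y ∧ ‖z‖ ≤ C := by
  have h2 := eLpNorm_nnreal_pow_eq_lintegral (μ := halfLine) (p := 2) (f := y) (by norm_num)
  have h3 : eLpNorm y 2 halfLine ^ 2 ≤ ENNReal.ofReal (C ^ 2) := by
    refine le_trans (le_of_eq ?_) h
    simpa using h2
  have h4 : eLpNorm y 2 halfLine ≠ ∞ := fun htop => by simp [htop] at h3
  refine ⟨⟨y, Lp.mem_Lp_iff_eLpNorm_lt_top.2 (lt_top_iff_ne_top.2 h4)⟩, rfl, ?_⟩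
  rw [Lp.norm_def, ← ENNReal.le_ofReal_iff_toReal_le h4 hC,
    ← ENNReal.pow_le_pow_left_iff two_ne_zero, ← ENNReal.ofReal_pow hC]
  exact h3

/-- A function whose `K`-functional is small near `0` and, relative to its argument, near `∞` is
close in `L₁ + L_∞` to its truncation, whose `L₂`-norm is controlled. -/
lemma exists_truncation {δ T ε : ℝ} (hδ : 0 < δ) (hT : 0 < T) (hε : 0 < ε)
    (x : ℝ →ₘ[halfLine] 𝕜)
    (h1 : kFun halfLine (ENNReal.ofReal δ) (fun u => ‖x u‖ₑ) ≤ ENNReal.ofReal ε)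
    (h2 : kFun halfLine (ENNReal.ofReal T) (fun u => ‖x u‖ₑ) ≤
      ENNReal.ofReal ε * ENNReal.ofReal T) :
    ∃ y : Lp 𝕜 2 halfLine, ‖y‖ ≤ (2 * ε / δ) * √T ∧
      (∀ᵐ u ∂halfLine, ‖(y : ℝ →ₘ[halfLine] 𝕜) u‖ₑ ≤ ‖x u‖ₑ) ∧
      kFun halfLine 1 (fun u => ‖(x - y : ℝ →ₘ[halfLine] 𝕜) u‖ₑ) ≤ ENNReal.ofReal (3 * ε) := by
  set f : ℝ → ℝ≥0∞ := fun u => ‖x u‖ₑ with hf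
  have hfm : Measurable f := x.stronglyMeasurable.enorm
  -- The factors `2` make `b * δ` and `a * T` exceed the assumed bounds on `K`, so that `{f > b}`
  -- has measure at most `δ` and `{f > a}` measure at most `T`.
  set b := 2 * ε / δ with hb
  set a := 2 * ε with ha
  have hb0 : 0 < b := by positivity
  have ha0 : 0 < a := by positivity
  have hdb : halfLine {u | ENNReal.ofReal b < f u} ≤ ENNReal.ofReal δ := by
    by_contra! hlt
    have h := (mul_min_le_kFun (ν := halfLine) (ENNReal.ofReal δ) f b).trans h1
    rw [min_eq_left hlt.le, ← ENNReal.ofReal_mul hb0.le, hb, div_mul_cancel₀ _ hδ.ne',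
      ENNReal.ofReal_le_ofReal_iff hε.le] at h
    linarith
  have hda : halfLine {u | ENNReal.ofReal a < f u} ≤ ENNReal.ofReal T := by
    by_contra! hlt
    have h := (mul_min_le_kFun (ν := halfLine) (ENNReal.ofReal T) f a).trans h2
    rw [min_eq_left hlt.le, ← ENNReal.ofReal_mul ha0.le, ← ENNReal.ofReal_mul hε.le,
      ENNReal.ofReal_le_ofReal_iff (by positivity)] at h
    nlinarith
  -- Only the values between `a` and `b` are kept. The discarded small values cost at most `a = 2 *
  -- ε` in `L_∞`, the large ones at most `K(δ, f) ≤ ε` in `L₁`.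
  set A : Set ℝ := {u | ENNReal.ofReal a < f u ∧ f u ≤ ENNReal.ofReal b} with hA
  have hAm : MeasurableSet A :=
    (measurableSet_lt measurable_const hfm).inter (measurableSet_le hfm measurable_const)
  have hym : AEStronglyMeasurable (A.indicator x) halfLine :=
    x.aestronglyMeasurable.indicator hAm
  set y : ℝ →ₘ[halfLine] 𝕜 := AEEqFun.mk _ hym with hy
  have hyc : ∀ᵐ u ∂halfLine, y u = A.indicator x u := AEEqFun.coeFn_mk _ hym
  have hint : ∫⁻ u, ‖y u‖ₑ ^ 2 ∂halfLine ≤ ENNReal.ofReal ((b * √T) ^ 2) := by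
    calc ∫⁻ u, ‖y u‖ₑ ^ 2 ∂halfLine
        ≤ ∫⁻ u, {u | ENNReal.ofReal a < f u}.indicator (fun _ => ENNReal.ofReal (b ^ 2)) u
          ∂halfLine := by
          refine lintegral_mono_ae ?_
          filter_upwards [hyc] with u hu
          rw [hu]
          by_cases huA : u ∈ A
          · rw [indicator_of_mem huA, indicator_of_mem (show u ∈ {u | _ < f u} from huA.1),
              ENNReal.ofReal_pow hb0.le]
            exact pow_le_pow_left₀ bot_le huA.2 2
          · rw [indicator_of_notMem huA]
            simp
      _ = ENNReal.ofReal (b ^ 2) * halfLine {u | ENNReal.ofReal a < f u} :=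
          lintegral_indicator_const (measurableSet_lt measurable_const hfm) _
      _ ≤ ENNReal.ofReal (b ^ 2) * ENNReal.ofReal T := by gcongr
      _ = _ := by rw [← ENNReal.ofReal_mul (sq_nonneg b), mul_pow, Real.sq_sqrt hT.le]
  obtain ⟨z, hz, hzn⟩ := exists_Lp_of_lintegral_sq_le (by positivity) hint
  refine ⟨z, hzn, ?_, ?_⟩
  · rw [hz]
    filter_upwards [hyc] with u hu
    rw [hu]
    by_cases huA : u ∈ A
    · rw [indicator_of_mem huA]
    · rw [indicator_of_notMem huA]; simp
  · rw [hz]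
    have hm1 : Measurable ({u | f u ≤ ENNReal.ofReal a}.indicator f) :=
      hfm.indicator (measurableSet_le hfm measurable_const)
    have hm2 : Measurable ({u | ENNReal.ofReal b < f u}.indicator f) :=
      hfm.indicator (measurableSet_lt measurable_const hfm)
    have hle : (fun u => ‖(x - y) u‖ₑ) ≤ᵐ[halfLine] fun u =>
        {u | f u ≤ ENNReal.ofReal a}.indicator f u +
        {u | ENNReal.ofReal b < f u}.indicator f u := by
      filter_upwards [hyc, AEEqFun.coeFn_sub x y] with u h1 h2
      rw [h2, Pi.sub_apply, h1]
      by_cases huA : u ∈ A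
      · simp [huA]
      · rw [indicator_of_notMem huA, sub_zero]
        by_cases hua : f u ≤ ENNReal.ofReal a
        · rw [indicator_of_mem (show u ∈ {u | f u ≤ ENNReal.ofReal a} from hua)]
          exact le_self_add
        · have hub : ENNReal.ofReal b < f u :=
            not_le.1 fun h => huA ⟨not_le.1 hua, h⟩
          rw [indicator_of_mem (show u ∈ {u | ENNReal.ofReal b < f u} from hub)]
          exact le_add_self
    refine (kFun_mono hle).trans ((kFun_add_le one_ne_zero hm1.aemeasurable hm2.aemeasurable).trans
      ?_)
    have e1 := kFun_le_mul_of_le (ν := halfLine) 1 hm1.aemeasurable ha0.le (fun u => by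
      by_cases hu : f u ≤ ENNReal.ofReal a
      · rwa [indicator_of_mem (show u ∈ {u | f u ≤ ENNReal.ofReal a} from hu)]
      · rw [indicator_of_notMem (show u ∉ {u | f u ≤ ENNReal.ofReal a} from hu)]
        exact bot_le)
    have e2 := (kFun_le_lintegral (ν := halfLine) 1 hm2.aemeasurable).trans
      ((lintegral_indicator_le_kFun hfm.aemeasurable hdb).trans h1)
    refine (add_le_add e1 e2).trans (le_of_eq ?_)
    rw [one_mul, ← ENNReal.ofReal_add ha0.le hε.le]
    congr 1
    rw [ha]; ring

end Lp

/-! ### Reflexivity of the constructed space -/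

namespace KWeights

variable {ι : Type*} (w : KWeights ι) {𝕜 : Type*} [RCLike 𝕜]

/-- The weights defining the space `L₁ + L_∞`. -/
def one : KWeights Unit where
  c := 1
  t := 1
  c_ne_top := by simp
  t_ne_zero := by simp
  t_ne_top := by simp
  exists_c_ne_zero := by simp

lemma one_eNrm (x : ℝ →ₘ[halfLine] 𝕜) : one.eNrm x = kFun halfLine 1 fun u => ‖x u‖ₑ := by
  rw [eNrm, ← (ENNReal.pow_right_strictMono two_ne_zero).injective.eq_iff, kNorm_sq]
  simp [one]

lemma exists_one_eNrm_le : ∃ C : ℝ, 0 ≤ C ∧ ∀ x : ℝ →ₘ[halfLine] 𝕜,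
    one.eNrm x ≤ ENNReal.ofReal C * w.eNrm x := by
  obtain ⟨k, hk⟩ := w.exists_c_ne_zero
  obtain ⟨B, hB, hBf⟩ := kFun_le_const_mul halfLine ENNReal.one_ne_top (w.t_ne_zero k)
    (w.t_ne_top k)
  have hBc : B / w.c k ≠ ∞ := ENNReal.div_ne_top hB hk
  refine ⟨(B / w.c k).toReal, ENNReal.toReal_nonneg, fun x => ?_⟩
  rw [ENNReal.ofReal_toReal hBc, one_eNrm]
  calc _ ≤ B * kFun halfLine (w.t k) fun u => ‖x u‖ₑ := hBf _
    _ = B / w.c k * (w.c k * kFun halfLine (w.t k) fun u => ‖x u‖ₑ) := by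
      rw [← mul_assoc, ENNReal.div_mul_cancel hk (w.c_ne_top k)]
    _ ≤ _ := by
      gcongr
      exact mul_kFun_le_kNorm k _

/-- The inclusion into `L₁ + L_∞`. -/
lemma exists_inclusion_one : ∃ i : (w.space 𝕜).carrier →L[𝕜] (one.space 𝕜).carrier,
    ∀ x, (i x : ℝ →ₘ[halfLine] 𝕜) = x := by
  obtain ⟨C, hC0, hC⟩ := w.exists_one_eNrm_le (𝕜 := 𝕜)
  have hmem : ∀ x : (w.space 𝕜).carrier, (x : ℝ →ₘ[halfLine] 𝕜) ∈ (one.space 𝕜).carrier :=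
    fun x => ne_top_of_le_ne_top (ENNReal.mul_ne_top ENNReal.ofReal_ne_top x.2) (hC x)
  let l : (w.space 𝕜).carrier →ₗ[𝕜] (one.space 𝕜).carrier :=
    { toFun := fun x => ⟨x, hmem x⟩
      map_add' := fun _ _ => rfl
      map_smul' := fun _ _ => rfl }
  refine ⟨l.mkContinuous C fun x => ?_, fun x => rfl⟩
  rw [norm_le_iff _ _ (by positivity), ENNReal.ofReal_mul hC0, ofReal_norm]
  exact hC x

/-- The inclusion of `L₂`. -/
lemma exists_inclusion_Lp (hw : ∑' k, w.c k ^ 2 * w.t k ≠ ∞) :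
    ∃ j : Lp 𝕜 2 halfLine →L[𝕜] (w.space 𝕜).carrier,
      ∀ x, (j x : ℝ →ₘ[halfLine] 𝕜) = (x : ℝ →ₘ[halfLine] 𝕜) := by
  set B := (4 * ∑' k, w.c k ^ 2 * w.t k).toReal with hB
  have hB4 : 4 * ∑' k, w.c k ^ 2 * w.t k ≠ ∞ := ENNReal.mul_ne_top (by simp) hw
  have hB0 : 0 ≤ B := ENNReal.toReal_nonneg
  have hC : ∀ x : Lp 𝕜 2 halfLine, w.eNrm (x : ℝ →ₘ[halfLine] 𝕜) ≤ ENNReal.ofReal (√B * ‖x‖) := by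
    intro x
    rw [← ENNReal.pow_le_pow_left_iff two_ne_zero, eNrm, kNorm_sq,
      ← ENNReal.ofReal_pow (by positivity), mul_pow, Real.sq_sqrt hB0, ENNReal.ofReal_mul hB0, hB,
      ENNReal.ofReal_toReal hB4, ← ENNReal.tsum_mul_left, ← ENNReal.tsum_mul_right]
    refine ENNReal.tsum_le_tsum fun k => ?_
    have ht : 0 < (w.t k).toReal := ENNReal.toReal_pos (w.t_ne_zero k) (w.t_ne_top k)
    have h := kFun_le_sqrt_mul (ν := halfLine) ht
      (aemeasurable_enorm (x : ℝ →ₘ[halfLine] 𝕜)) (norm_nonneg x) (lintegral_enorm_sq_eq x).le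
    rw [ENNReal.ofReal_toReal (w.t_ne_top k)] at h
    calc _ ≤ (w.c k * ENNReal.ofReal (2 * √(w.t k).toReal * ‖x‖)) ^ 2 := by gcongr
      _ = w.c k ^ 2 * ENNReal.ofReal (4 * (w.t k).toReal * ‖x‖ ^ 2) := by
        rw [mul_pow, ← ENNReal.ofReal_pow (by positivity), mul_pow, mul_pow, Real.sq_sqrt ht.le]
        norm_num
      _ = _ := by
        rw [ENNReal.ofReal_mul (by positivity), ENNReal.ofReal_mul (by norm_num),
          ENNReal.ofReal_toReal (w.t_ne_top k)]
        norm_num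
        ring
  let l : Lp 𝕜 2 halfLine →ₗ[𝕜] (w.space 𝕜).carrier :=
    { toFun := fun x => ⟨x, ne_top_of_le_ne_top ENNReal.ofReal_ne_top (hC x)⟩
      map_add' := fun _ _ => rfl
      map_smul' := fun _ _ => rfl }
  refine ⟨l.mkContinuous √B fun x => ?_, fun x => rfl⟩
  rw [norm_le_iff _ _ (by positivity)]
  exact hC x

/-- The seminorm given by the part of the sum over `s`. -/
def partSeminorm (𝕜 : Type*) [RCLike 𝕜] (s : Set ι) : Seminorm 𝕜 (w.space 𝕜).carrier :=
  Seminorm.of (fun x => (kNorm halfLine (s.indicator w.c) w.t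
      fun u => ‖(x : ℝ →ₘ[halfLine] 𝕜) u‖ₑ).toReal)
    (fun x y => by
      have hx := ne_top_of_le_ne_top x.2 (kNorm_indicator_le (t := w.t) s _)
      have hy := ne_top_of_le_ne_top y.2 (kNorm_indicator_le (t := w.t) s _)
      rw [← ENNReal.toReal_add hx hy]
      exact ENNReal.toReal_mono (ENNReal.add_ne_top.2 ⟨hx, hy⟩)
        (kNorm_enorm_add_le w.t_ne_zero _ _))
    (fun a x => by
      rw [Submodule.coe_smul, kNorm_enorm_smul w.t_ne_zero]
      simp)

lemma ofReal_partSeminorm (s : Set ι) (x : (w.space 𝕜).carrier) :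
    ENNReal.ofReal (w.partSeminorm 𝕜 s x) = kNorm halfLine (s.indicator w.c) w.t
      fun u => ‖(x : ℝ →ₘ[halfLine] 𝕜) u‖ₑ :=
  ENNReal.ofReal_toReal (ne_top_of_le_ne_top x.2 (kNorm_indicator_le (t := w.t) s _))

lemma norm_sq_eq_partSeminorm (s : Set ι) (x : (w.space 𝕜).carrier) :
    ‖x‖ ^ 2 = w.partSeminorm 𝕜 s x ^ 2 + w.partSeminorm 𝕜 sᶜ x ^ 2 := by
  rw [← ENNReal.ofReal_eq_ofReal_iff (sq_nonneg _) (by positivity),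
    ENNReal.ofReal_add (sq_nonneg _) (sq_nonneg _), ENNReal.ofReal_pow (norm_nonneg _),
    ENNReal.ofReal_pow (apply_nonneg _ _), ENNReal.ofReal_pow (apply_nonneg _ _), ofReal_norm,
    ofReal_partSeminorm, ofReal_partSeminorm]
  exact kNorm_sq_add_compl _ _ _ _

/-- The abstract criterion for `L₂ → F → L₁ + L_∞`: the first two sums give the truncations, and the
third gives the inclusion of `L₂`. Closedness and density of functionals come from splitting the
index set into a finite part, which is continuous for `L₁ + L_∞`, and its complement. -/
theorem isReflexive_space (hc : ∑' k, w.c k ^ 2 = ∞) (hct : ∑' k, (w.c k * w.t k) ^ 2 = ∞)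
    (hw : ∑' k, w.c k ^ 2 * w.t k ≠ ∞) : (w.space 𝕜).IsReflexive := by
  obtain ⟨i, hi⟩ := w.exists_inclusion_one (𝕜 := 𝕜)
  obtain ⟨j, hj⟩ := w.exists_inclusion_Lp (𝕜 := 𝕜) hw
  have hione : ∀ y : (one.space 𝕜).carrier, ENNReal.ofReal ‖y‖ =
      kFun halfLine 1 fun u => ‖(y : ℝ →ₘ[halfLine] 𝕜) u‖ₑ := fun y => by
    rw [ofReal_norm, one_eNrm]
  have hw1 : ∀ {x : (w.space 𝕜).carrier}, ‖x‖ ≤ 1 → w.eNrm (x : ℝ →ₘ[halfLine] 𝕜) ≤ 1 :=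
    fun {x} hx => by simpa using (w.norm_le_iff x zero_le_one).1 hx
  refine surjective_inclusionInDoubleDual j i ?_ ?_ ?_
  · intro ε hε
    have hε3 : ENNReal.ofReal (ε / 3) ≠ 0 := by simpa using hε
    obtain ⟨δ, hδ0, hδt, hδ⟩ := exists_kFun_le (ν := halfLine) w.t_ne_zero hc hε3
    obtain ⟨T, hT0, hTt, hT⟩ := exists_kFun_le_mul (ν := halfLine) w.t_ne_top hct hε3
    refine ⟨(2 * (ε / 3) / δ.toReal) * √T.toReal, fun x hx => ?_⟩
    obtain ⟨y, hy1, hy2, hy3⟩ := exists_truncation (ENNReal.toReal_pos hδ0 hδt)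
      (ENNReal.toReal_pos hT0 hTt) (by positivity : 0 < ε / 3) (x : ℝ →ₘ[halfLine] 𝕜)
      (by rw [ENNReal.ofReal_toReal hδt]; exact hδ _ (hw1 hx))
      (by rw [ENNReal.ofReal_toReal hTt]; exact hT _ (hw1 hx))
    refine ⟨y, hy1, ?_, ?_⟩
    · rw [norm_le_iff _ _ zero_le_one, hj]
      refine (w.eNrm_mono hy2).trans ?_
      simpa using hw1 hx
    · rw [← ENNReal.ofReal_le_ofReal_iff hε.le, hione]
      rw [mul_div_cancel₀ _ (by norm_num : (3 : ℝ) ≠ 0)] at hy3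
      rw [Submodule.coe_sub, hi, hi, hj]
      exact hy3
  · intro v z hv hz
    have hmem : (z : ℝ →ₘ[halfLine] 𝕜) ∈ (w.space 𝕜).carrier := by
      -- It suffices to bound each finite part of the sum at `z`; such a part passes to the limit
      -- along `v n`, whose norms are at most `1`.
      refine ne_top_of_le_ne_top ENNReal.one_ne_top (kNorm_le_of_finset fun S => ?_)
      obtain ⟨C, hC, hCf⟩ := kNorm_finset_indicator_le (ν := halfLine) w.c_ne_top w.t_ne_top S
      have hbd : ∀ n, kNorm halfLine ((S : Set ι).indicator w.c) w.t
          (fun u => ‖(z : ℝ →ₘ[halfLine] 𝕜) u‖ₑ) ≤ 1 + C * ENNReal.ofReal ‖z - i (v n)‖ := by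
        intro n
        have h1 := kNorm_enorm_add_le (c := (S : Set ι).indicator w.c) w.t_ne_zero
          (v n : ℝ →ₘ[halfLine] 𝕜) (z - v n : ℝ →ₘ[halfLine] 𝕜)
        rw [add_sub_cancel] at h1
        refine h1.trans (add_le_add ?_ ?_)
        · exact (kNorm_indicator_le _ _).trans (hw1 (hv n))
        · rw [hione, Submodule.coe_sub, hi]
          exact hCf _
      have hl : Tendsto (fun n => 1 + C * ENNReal.ofReal ‖z - i (v n)‖) atTop (𝓝 (1 + C * 0)) := by
        refine tendsto_const_nhds.add (ENNReal.Tendsto.const_mul ?_ (Or.inr hC))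
        rw [← ENNReal.ofReal_zero]
        refine (ENNReal.continuous_ofReal.tendsto _).comp ?_
        have := (tendsto_iff_norm_sub_tendsto_zero.1 hz)
        simpa only [norm_sub_rev] using this
      simpa using ge_of_tendsto' hl hbd
    exact ⟨⟨z, hmem⟩, Subtype.ext (hi _)⟩
  · intro φ ε hε
    obtain ⟨S, φ₁, φ₂, h, h1, h2⟩ := exists_dual_approx
      (fun S : Finset ι => w.partSeminorm 𝕜 (S : Set ι))
      (fun S : Finset ι => w.partSeminorm 𝕜 (S : Set ι)ᶜ)
      (fun S x => w.norm_sq_eq_partSeminorm _ x) (fun x η hη => by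
        obtain ⟨S, hS⟩ := exists_finset_kNorm_compl_le x.2
          (show ENNReal.ofReal η ≠ 0 by simpa using hη)
        refine ⟨S, ?_⟩
        rw [← ENNReal.ofReal_le_ofReal_iff hη.le, ofReal_partSeminorm]
        exact hS) φ hε
    refine ⟨φ₁, φ₂, h, ?_, h2⟩
    obtain ⟨C, hC, hCf⟩ := kNorm_finset_indicator_le (ν := halfLine) w.c_ne_top w.t_ne_top S
    refine ⟨‖φ‖ * C.toReal, fun u => (h1 u).trans ?_⟩
    rw [mul_assoc]
    refine mul_le_mul_of_nonneg_left ?_ (norm_nonneg _)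
    rw [← ENNReal.ofReal_le_ofReal_iff (by positivity), ofReal_partSeminorm,
      ENNReal.ofReal_mul ENNReal.toReal_nonneg, ENNReal.ofReal_toReal hC, hione, hi]
    exact hCf _

end KWeights

/-! ### Indicator functions of intervals and step functions -/

section Box

variable (𝕜 : Type*) [RCLike 𝕜]

/-- The indicator function of the interval `(a, b]`. -/
def box (a b : ℝ) : ℝ →ₘ[halfLine] 𝕜 :=
  AEEqFun.mk ((Ioc a b).indicator fun _ => 1)
    (aestronglyMeasurable_const.indicator measurableSet_Ioc)

lemma coeFn_box (a b : ℝ) : ∀ᵐ u ∂halfLine, box 𝕜 a b u = (Ioc a b).indicator (fun _ => 1) u :=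
  AEEqFun.coeFn_mk _ _

variable {𝕜}

lemma box_add_box {a b c : ℝ} (hab : a ≤ b) (hbc : b ≤ c) : box 𝕜 a b + box 𝕜 b c = box 𝕜 a c := by
  refine AEEqFun.ext ?_
  filter_upwards [coeFn_box 𝕜 a b, coeFn_box 𝕜 b c, coeFn_box 𝕜 a c,
    AEEqFun.coeFn_add (box 𝕜 a b) (box 𝕜 b c)] with u h1 h2 h3 h4
  rw [h4, Pi.add_apply, h1, h2, h3, ← Ioc_union_Ioc_eq_Ioc hab hbc,
    indicator_union_of_disjoint (Set.disjoint_left.2 fun x hx hx' => not_lt.2 hx.2 hx'.1)]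

lemma box_of_le {a b : ℝ} (h : b ≤ a) : box 𝕜 a b = 0 := by
  refine AEEqFun.ext ?_
  filter_upwards [coeFn_box 𝕜 a b, AEEqFun.coeFn_zero (β := 𝕜) (μ := halfLine)] with u h1 h2
  rw [h1, h2, Ioc_eq_empty (not_lt.2 h)]
  simp

lemma sum_box (n : ℕ) {δ : ℝ} (hδ : 0 ≤ δ) :
    ∑ j ∈ Finset.range n, box 𝕜 (j * δ) ((j + 1) * δ) = box 𝕜 0 (n * δ) := by
  induction n with
  | zero => simp [box_of_le]
  | succ n ih =>
    rw [Finset.sum_range_succ, ih, box_add_box (by positivity) (by nlinarith)]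
    push_cast
    rfl

lemma halfLine_Ioc {a b : ℝ} (ha : 0 ≤ a) : halfLine (Ioc a b) = ENNReal.ofReal (b - a) := by
  rw [Measure.restrict_apply measurableSet_Ioc, inter_eq_left.2, Real.volume_Ioc]
  exact fun x hx => ha.trans_lt hx.1

lemma distribution_smul_box_le {a b r s : ℝ} (ha : 0 ≤ a) (hr : 0 ≤ r) (hs : 0 ≤ s) :
    halfLine {u | ENNReal.ofReal s < ‖((r : 𝕜) • box 𝕜 a b) u‖ₑ} ≤
      if s < r then ENNReal.ofReal (b - a) else 0 := by
  have h : ∀ᵐ u ∂halfLine, ENNReal.ofReal s < ‖((r : 𝕜) • box 𝕜 a b) u‖ₑ →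
      u ∈ Ioc a b ∧ s < r := by
    filter_upwards [coeFn_box 𝕜 a b, AEEqFun.coeFn_smul (r : 𝕜) (box 𝕜 a b)] with u h1 h2 h3
    rw [h2, Pi.smul_apply, h1] at h3
    by_cases hu : u ∈ Ioc a b
    · rw [indicator_of_mem hu, ← ofReal_norm, ENNReal.ofReal_lt_ofReal_iff_of_nonneg hs] at h3
      simp only [smul_eq_mul, mul_one, RCLike.norm_ofReal, abs_of_nonneg hr] at h3
      exact ⟨hu, h3⟩
    · rw [indicator_of_notMem hu] at h3
      simp at h3
  split_ifs with hsr
  · rw [← halfLine_Ioc ha]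
    exact measure_mono_ae (h.mono fun u hu h' => (hu h').1)
  · rw [nonpos_iff_eq_zero, measure_eq_zero_iff_ae_notMem]
    exact h.mono fun u hu h' => hsr (hu h').2

lemma distribution_box (s : ℝ) {b : ℝ} (hs : s < 1) :
    ENNReal.ofReal b ≤ halfLine {u | ENNReal.ofReal s < ‖box 𝕜 0 b u‖ₑ} := by
  rw [← sub_zero b, ← halfLine_Ioc le_rfl, sub_zero]
  refine measure_mono_ae ?_
  filter_upwards [coeFn_box 𝕜 0 b] with u h1 h2
  have h2 : u ∈ Ioc 0 b := h2
  change _ < _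
  rw [h1, indicator_of_mem h2, enorm_one]
  simpa using hs

/-- A step function with steps of length `δ` and heights `b`. -/
def step (𝕜 : Type*) [RCLike 𝕜] {n : ℕ} (δ : ℝ) (b : Fin n → ℝ) : ℝ →ₘ[halfLine] 𝕜 :=
  ∑ j : Fin n, (b j : 𝕜) • box 𝕜 (j * δ) ((j + 1) * δ)

lemma distribution_step_le {n : ℕ} {δ : ℝ} (hδ : 0 < δ) {b : Fin n → ℝ} (hb : ∀ j, 0 ≤ b j) {s : ℝ}
    (hs : 0 < s) :
    halfLine {u | ENNReal.ofReal s < ‖step 𝕜 δ b u‖ₑ} ≤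
      (Finset.univ.filter fun j => s < b j).card * ENNReal.ofReal δ := by
  have hdisj : ∀ (u : ℝ) (i j : Fin n), u ∈ Ioc (i * δ) ((i + 1) * δ) →
      u ∈ Ioc (j * δ) ((j + 1) * δ) → i ≤ j := by
    intro u i j hi hj
    have h1 : (i : ℝ) * δ < (j + 1) * δ := hi.1.trans_le hj.2
    have h2 : (i : ℝ) < j + 1 := lt_of_mul_lt_mul_right h1 hδ.le
    have h3 : (i : ℕ) < j + 1 := by exact_mod_cast h2
    exact Fin.le_def.2 (Nat.lt_succ_iff.1 h3)
  have hcoe : ∀ᵐ u ∂halfLine, step 𝕜 δ b u =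
      ∑ j : Fin n, (b j : 𝕜) * (Ioc (j * δ) ((j + 1) * δ)).indicator (fun _ => 1) u := by
    filter_upwards [AEEqFun.coeFn_fun_finsetSum Finset.univ
        (fun j : Fin n => (b j : 𝕜) • box 𝕜 (j * δ) ((j + 1) * δ)),
      ae_all_iff.2 fun j : Fin n => coeFn_box 𝕜 (j * δ) ((j + 1) * δ),
      ae_all_iff.2 fun j : Fin n => AEEqFun.coeFn_smul (b j : 𝕜) (box 𝕜 (j * δ) ((j + 1) * δ))]
      with u h1 h2 h3
    rw [step, h1]
    refine Finset.sum_congr rfl fun j _ => ?_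
    rw [h3 j, Pi.smul_apply, h2 j, smul_eq_mul]
  calc halfLine {u | ENNReal.ofReal s < ‖step 𝕜 δ b u‖ₑ}
      ≤ halfLine (⋃ j ∈ Finset.univ.filter fun j => s < b j, Ioc (j * δ) ((j + 1) * δ)) := by
        refine measure_mono_ae ?_
        filter_upwards [hcoe] with u hu h
        have h : ENNReal.ofReal s < ‖step 𝕜 δ b u‖ₑ := h
        rw [hu] at h
        by_cases hex : ∃ j : Fin n, u ∈ Ioc (j * δ) ((j + 1) * δ)
        · obtain ⟨j, hj⟩ := hex
          rw [Finset.sum_eq_single_of_mem j (Finset.mem_univ _) (fun i _ hij => by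
            rw [indicator_of_notMem, mul_zero]
            exact fun hi => hij (le_antisymm (hdisj u i j hi hj) (hdisj u j i hj hi))),
            indicator_of_mem hj, mul_one, ← ofReal_norm, RCLike.norm_ofReal, abs_of_nonneg (hb j),
            ENNReal.ofReal_lt_ofReal_iff_of_nonneg hs.le] at h
          exact mem_iUnion₂.2 ⟨j, by simpa using h, hj⟩
        · rw [Finset.sum_eq_zero fun j _ => by
            rw [indicator_of_notMem fun hj => hex ⟨j, hj⟩, mul_zero]] at h
          simp at h
    _ ≤ ∑ j ∈ Finset.univ.filter fun j => s < b j, halfLine (Ioc (j * δ) ((j + 1) * δ)) :=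
        measure_biUnion_finset_le _ _
    _ = _ := by
      rw [Finset.sum_congr rfl fun j _ => ?_, Finset.sum_const, nsmul_eq_mul]
      rw [halfLine_Ioc (by positivity)]
      congr 1
      ring

/-- Over the `n` rotations every position receives each height exactly once, so the sum is constant
on `(0, n * δ]`. -/
lemma sum_step_cyclic {n : ℕ} [NeZero n] {δ : ℝ} (hδ : 0 ≤ δ) (b : Fin n → ℝ) :
    ∑ i : Fin n, step 𝕜 δ (fun j => b (i + j)) = ((∑ j, b j : ℝ) : 𝕜) • box 𝕜 0 (n * δ) := by
  simp only [step]
  rw [Finset.sum_comm, ← sum_box n hδ, ← Fin.sum_univ_eq_sum_range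
    (fun j => box 𝕜 (j * δ) ((j + 1) * δ)), Finset.smul_sum]
  refine Finset.sum_congr rfl fun j _ => ?_
  rw [← Finset.sum_smul, RCLike.ofReal_sum]
  congr 1
  exact Equiv.sum_comp (Equiv.addRight j) fun i => (b i : 𝕜)

end Box

/-! ### The fundamental function and the Marcinkiewicz bound -/

namespace NormedFunctionSpace.IsSymmetric

variable {𝕜 : Type*} [RCLike 𝕜] {E : NormedFunctionSpace 𝕜}

lemma mem_of_distribution_le (hE : E.IsSymmetric) {x : ℝ →ₘ[halfLine] 𝕜} (y : E.carrier)
    (h : ∀ s : ℝ, 0 < s → halfLine {u | ENNReal.ofReal s < ‖x u‖ₑ} ≤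
      halfLine {u | ENNReal.ofReal s < ‖(y : ℝ →ₘ[halfLine] 𝕜) u‖ₑ}) :
    ∃ hx : x ∈ E.carrier, ‖(⟨x, hx⟩ : E.carrier)‖ ≤ ‖y‖ := by
  refine hE.symmetric x ?_ y fun t _ => rearrangement_le_of_distribution_le h t
  obtain ⟨s, hs, hs'⟩ := mem_finiteDistribution_iff.1 (hE.subset_finiteDistribution y.2)
  exact mem_finiteDistribution_iff.2 ⟨s, hs, (h s hs).trans_lt hs'⟩

/-- A nonzero element exceeds some `s > 0` on a set of measure at least some `δ > 0`. By symmetry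
`E` contains every indicator of an interval of length `δ`, hence finite sums of these and whatever
they dominate. -/
lemma box_mem (hE : E.IsSymmetric) (hne : E.carrier ≠ ⊥) (t : ℝ) : box 𝕜 0 t ∈ E.carrier := by
  obtain ⟨x, hx, hx0⟩ := E.carrier.ne_bot_iff.1 hne
  obtain ⟨s, hs, hds⟩ : ∃ s : ℝ, 0 < s ∧ halfLine {u | ENNReal.ofReal s < ‖x u‖ₑ} ≠ 0 := by
    by_contra! hcon
    apply hx0
    have h := distribution_tendsto (ν := halfLine) (fun u => ‖x u‖ₑ) 0 (t := 0)
      fun s hs => (hcon s hs).le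
    rw [nonpos_iff_eq_zero, measure_eq_zero_iff_ae_notMem] at h
    refine AEEqFun.ext ?_
    filter_upwards [h, AEEqFun.coeFn_zero (β := 𝕜) (μ := halfLine)] with u h1 h2
    rw [h2]
    simpa using h1
  obtain ⟨δ, hδ, hδ'⟩ : ∃ δ : ℝ, 0 < δ ∧
      ENNReal.ofReal δ ≤ halfLine {u | ENNReal.ofReal s < ‖x u‖ₑ} := by
    obtain ⟨d, hd0, hd⟩ := ENNReal.lt_iff_exists_nnreal_btwn.1 (pos_iff_ne_zero.2 hds)
    exact ⟨d, by exact_mod_cast hd0, by simpa using hd.le⟩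
  have hsmall : ∀ a, 0 ≤ a → box 𝕜 a (a + δ) ∈ E.carrier := by
    intro a ha
    obtain ⟨h, -⟩ := hE.mem_of_distribution_le (x := (s : 𝕜) • box 𝕜 a (a + δ)) ⟨x, hx⟩
      fun r hr => by
        refine (distribution_smul_box_le ha hs.le hr.le).trans ?_
        split_ifs with hrs
        · rw [add_sub_cancel_left]
          exact hδ'.trans (antitone_distribution _ hrs.le)
        · exact bot_le
    have h2 := E.carrier.smul_mem ((s : 𝕜)⁻¹) h
    rwa [smul_smul, inv_mul_cancel₀ (by exact_mod_cast hs.ne'), one_smul] at h2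
  have hn : ∀ n : ℕ, box 𝕜 0 (n * δ) ∈ E.carrier := fun n => by
    rw [← sum_box n hδ.le]
    refine Submodule.sum_mem _ fun j _ => ?_
    rw [add_mul, one_mul]
    exact hsmall _ (by positivity)
  obtain ⟨n, hn'⟩ := exists_nat_ge (t / δ)
  obtain ⟨h, -⟩ := hE.mem_of_distribution_le (x := box 𝕜 0 t) ⟨_, hn n⟩ fun r hr => by
    have h1 := distribution_smul_box_le (𝕜 := 𝕜) (b := t) le_rfl zero_le_one hr.le
    rw [RCLike.ofReal_one, one_smul] at h1
    refine h1.trans ?_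
    split_ifs with hr1
    · refine le_trans (ENNReal.ofReal_le_ofReal ?_) (distribution_box r hr1)
      rw [sub_zero]
      exact (div_le_iff₀ hδ).1 hn'
    · exact bot_le
  exact h

/-- The averaging inequality for step functions dominated by an element of `E`. -/
lemma sum_mul_norm_box_le (hE : E.IsSymmetric) {n : ℕ} [NeZero n] {δ : ℝ} (hδ : 0 < δ) {b : Fin n → ℝ}
    (hb : ∀ j, 0 ≤ b j) (x : E.carrier) (hbox : box 𝕜 0 (n * δ) ∈ E.carrier)
    (h : ∀ s : ℝ, 0 < s → (Finset.univ.filter fun j => s < b j).card * ENNReal.ofReal δ ≤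
      halfLine {u | ENNReal.ofReal s < ‖(x : ℝ →ₘ[halfLine] 𝕜) u‖ₑ}) :
    (∑ j, b j) * ‖(⟨_, hbox⟩ : E.carrier)‖ ≤ n * ‖x‖ := by
  -- Permuting the heights leaves the distribution bound unchanged, so every rotation has norm at
  -- most `‖x‖`; the triangle inequality for their sum gives the result.
  have hstep : ∀ i : Fin n, ∃ hx : step 𝕜 δ (fun j => b (i + j)) ∈ E.carrier,
      ‖(⟨_, hx⟩ : E.carrier)‖ ≤ ‖x‖ := by
    intro i
    refine hE.mem_of_distribution_le x fun s hs =>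
      (distribution_step_le hδ (fun j => hb _) hs).trans (le_trans (le_of_eq ?_) (h s hs))
    congr 2
    refine Finset.card_equiv (Equiv.addLeft i) fun j => by simp
  choose hmem hle using hstep
  have hsum : ∑ i : Fin n, (⟨_, hmem i⟩ : E.carrier) =
      ((∑ j, b j : ℝ) : 𝕜) • (⟨_, hbox⟩ : E.carrier) := by
    refine Subtype.ext ?_
    rw [AddSubmonoidClass.coe_finsetSum, Submodule.coe_smul]
    exact sum_step_cyclic hδ.le b
  have hS : 0 ≤ ∑ j, b j := Finset.sum_nonneg fun j _ => hb j
  calc (∑ j, b j) * ‖(⟨_, hbox⟩ : E.carrier)‖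
      = ‖((∑ j, b j : ℝ) : 𝕜) • (⟨_, hbox⟩ : E.carrier)‖ := by
        rw [norm_smul, RCLike.norm_ofReal, abs_of_nonneg hS]
    _ = ‖∑ i : Fin n, (⟨_, hmem i⟩ : E.carrier)‖ := by rw [hsum]
    _ ≤ ∑ i : Fin n, ‖x‖ := norm_sum_le_of_le _ fun i _ => hle i
    _ = n * ‖x‖ := by simp

lemma rearrangement_ne_top (hE : E.IsSymmetric) (x : E.carrier) {t : ℝ} (ht : 0 < t) :
    rearrangement (x : ℝ →ₘ[halfLine] 𝕜) t ≠ ∞ := by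
  obtain ⟨s, hs, hs'⟩ := mem_finiteDistribution_iff.1 (hE.subset_finiteDistribution x.2)
  set f : ℝ → ℝ≥0∞ := fun u => ‖(x : ℝ →ₘ[halfLine] 𝕜) u‖ₑ
  have hfm : Measurable f := (x : ℝ →ₘ[halfLine] 𝕜).stronglyMeasurable.enorm
  have hlim : Tendsto (fun n : ℕ => halfLine {u | ENNReal.ofReal (s + n) < f u}) atTop
      (𝓝 (halfLine (⋂ n : ℕ, {u | ENNReal.ofReal (s + n) < f u}))) := by
    refine tendsto_measure_iInter_atTop
      (fun n => (measurableSet_lt measurable_const hfm).nullMeasurableSet) ?_ ⟨0, ?_⟩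
    · intro m n hmn u hu
      refine (ENNReal.ofReal_le_ofReal ?_).trans_lt (mem_ofPred.1 hu)
      gcongr
    · simpa using hs'.ne
  have hempty : (⋂ n : ℕ, {u | ENNReal.ofReal (s + n) < f u}) = ∅ := by
    refine eq_empty_of_forall_notMem fun u hu => ?_
    rw [mem_iInter] at hu
    obtain ⟨n, hn⟩ := exists_nat_ge (f u).toReal
    have h1 : ENNReal.ofReal (s + n) < f u := hu n
    rw [ENNReal.ofReal_lt_iff_lt_toReal (by positivity) enorm_ne_top] at h1
    linarith
  rw [hempty, measure_empty] at hlim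
  obtain ⟨n, hn⟩ := (hlim.eventually (gt_mem_nhds (ENNReal.ofReal_pos.2 ht))).exists
  exact ne_top_of_le_ne_top ENNReal.ofReal_ne_top
    ((rearrangement_le_iff _ t (by positivity : 0 ≤ s + n)).2 hn.le)

/-- `E` is contained in the Marcinkiewicz space given by its fundamental function. -/
lemma norm_box_mul_kFun_le (hE : E.IsSymmetric) (x : E.carrier) {t : ℝ} (ht : 0 < t) (hbox : box 𝕜 0 t ∈ E.carrier) :
    ENNReal.ofReal ‖(⟨_, hbox⟩ : E.carrier)‖ *
      kFun halfLine (ENNReal.ofReal t) (fun u => ‖(x : ℝ →ₘ[halfLine] 𝕜) u‖ₑ) ≤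
      ENNReal.ofReal (t * ‖x‖) := by
  set f : ℝ → ℝ≥0∞ := fun u => ‖(x : ℝ →ₘ[halfLine] 𝕜) u‖ₑ with hf
  set d : ℝ → ℝ≥0∞ := fun s => halfLine {u | ENNReal.ofReal s < f u} with hd
  set φ := ‖(⟨_, hbox⟩ : E.carrier)‖ with hφ
  have key : ∀ n : ℕ, ENNReal.ofReal φ *
      ∫⁻ s in Ioi (0 : ℝ), (min (ENNReal.ofReal t) (d s) - ENNReal.ofReal (t / (n + 1))) ≤
      ENNReal.ofReal (t * ‖x‖) := by
    intro m
    set n := m + 1 with hn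
    set δ := t / (m + 1) with hδ
    have hδ0 : 0 < δ := by positivity
    have hnδ : (n : ℝ) * δ = t := by
      rw [hn, hδ]; push_cast; field_simp
    -- The heights are taken at the right endpoints `(j + 1) * δ`, so that the step function stays
    -- below the rearrangement of `x`.
    set μ : Fin n → ℝ≥0∞ := fun j => rearrangement (x : ℝ →ₘ[halfLine] 𝕜) ((j + 1) * δ) with hμ
    have hμt : ∀ j, μ j ≠ ∞ := fun j => hE.rearrangement_ne_top x (by positivity)
    have hμd : ∀ (s : ℝ), 0 ≤ s → ∀ j, ENNReal.ofReal s < μ j ↔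
        ENNReal.ofReal ((j + 1) * δ) < d s := fun s hs j => by
      rw [← not_le, ← not_le, not_iff_not]
      exact rearrangement_le_iff _ _ hs
    have hsum : (∑ j, (μ j).toReal) * φ ≤ n * ‖x‖ := by
      have := hE.sum_mul_norm_box_le (n := n) hδ0 (b := fun j => (μ j).toReal)
        (fun j => ENNReal.toReal_nonneg) x (by rwa [hnδ]) (fun s hs => ?_)
      · simp only [hnδ] at this
        exact this
      · set A : Finset (Fin n) := Finset.univ.filter fun j => s < (μ j).toReal with hA
        rcases A.eq_empty_or_nonempty with hAe | hAne
        · simp [hAe]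
        · have hj : A.max' hAne ∈ A := A.max'_mem hAne
          set j := A.max' hAne
          have hcard : A.card ≤ (j : ℕ) + 1 := by
            rw [← Fin.card_Iic]
            exact Finset.card_le_card fun i hi => Finset.mem_Iic.2 (A.le_max' i hi)
          have h1 : ENNReal.ofReal s < μ j :=
            (ENNReal.ofReal_lt_iff_lt_toReal hs.le (hμt j)).2 (Finset.mem_filter.1 hj).2
          refine le_trans ?_ ((hμd s hs.le j).1 h1).le
          rw [ENNReal.ofReal_mul (by positivity)]
          gcongr
          rw [← ENNReal.ofReal_natCast]
          exact ENNReal.ofReal_le_ofReal (by exact_mod_cast hcard)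
    -- At each level the right-endpoint Riemann sum misses a length of at most `δ`. This is the term
    -- subtracted in `key`, and it disappears by monotone convergence as the mesh tends to `0`.
    have hpt : ∀ s : ℝ, 0 < s → min (ENNReal.ofReal t) (d s) - ENNReal.ofReal δ ≤
        ∑ j, ENNReal.ofReal δ * (Iio (μ j).toReal).indicator (fun _ => 1) s := by
      intro s hs
      set A : Finset (Fin n) := Finset.univ.filter fun j => s < (μ j).toReal with hA
      have hsumA : ∑ j, ENNReal.ofReal δ * (Iio (μ j).toReal).indicator (fun _ => (1 : ℝ≥0∞)) s =
          ENNReal.ofReal (A.card * δ) := by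
        rw [← Finset.mul_sum, ENNReal.ofReal_mul (by positivity), mul_comm]
        congr 1
        simp only [indicator_apply, mem_Iio]
        rw [Finset.sum_boole, ENNReal.ofReal_natCast]
      rw [hsumA, tsub_le_iff_right, ← ENNReal.ofReal_add (by positivity) hδ0.le, min_le_iff]
      by_contra! hcon
      obtain ⟨h1, h2⟩ := hcon
      rw [ENNReal.ofReal_lt_ofReal_iff ht, ← hnδ] at h1
      have h3 : A.card + 1 < n := by
        have : ((A.card : ℝ) + 1) * δ < n * δ := by linarith
        exact_mod_cast lt_of_mul_lt_mul_right this hδ0.le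
      have hsub : Finset.Iic (⟨A.card, by omega⟩ : Fin n) ⊆ A := by
        intro j hj
        have hj' : (j : ℕ) ≤ A.card := Fin.le_def.1 (Finset.mem_Iic.1 hj)
        refine Finset.mem_filter.2 ⟨Finset.mem_univ _, ?_⟩
        rw [← ENNReal.ofReal_lt_iff_lt_toReal hs.le (hμt j), hμd s hs.le]
        refine lt_of_le_of_lt (ENNReal.ofReal_le_ofReal ?_) h2
        have : (j : ℝ) ≤ A.card := by exact_mod_cast hj'
        nlinarith
      have := Finset.card_le_card hsub
      rw [Fin.card_Iic] at this
      simp at this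
    have hint : ∫⁻ s in Ioi (0 : ℝ), (min (ENNReal.ofReal t) (d s) - ENNReal.ofReal δ) ≤
        ENNReal.ofReal (δ * ∑ j, (μ j).toReal) := by
      refine (setLIntegral_mono' measurableSet_Ioi hpt).trans (le_of_eq ?_)
      rw [lintegral_finsetSum' _ fun j _ => ?_, Finset.mul_sum,
        ENNReal.ofReal_sum_of_nonneg fun j _ => by positivity]
      · refine Finset.sum_congr rfl fun j _ => ?_
        rw [lintegral_const_mul' _ _ ENNReal.ofReal_ne_top,
          lintegral_indicator_const measurableSet_Iio, Measure.restrict_apply measurableSet_Iio,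
          Iio_inter_Ioi, Real.volume_Ioo, sub_zero, one_mul, ENNReal.ofReal_mul hδ0.le]
      · exact ((measurable_const.indicator measurableSet_Iio).const_mul _).aemeasurable
    calc _ ≤ ENNReal.ofReal φ * ENNReal.ofReal (δ * ∑ j, (μ j).toReal) := by gcongr
      _ = ENNReal.ofReal (δ * ((∑ j, (μ j).toReal) * φ)) := by
        rw [← ENNReal.ofReal_mul (norm_nonneg _)]
        congr 1
        ring
      _ ≤ ENNReal.ofReal (δ * (n * ‖x‖)) := by gcongr
      _ = _ := by rw [← mul_assoc, mul_comm δ, hnδ]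
  have hlim : Tendsto (fun n : ℕ => ENNReal.ofReal φ * ∫⁻ s in Ioi (0 : ℝ),
      (min (ENNReal.ofReal t) (d s) - ENNReal.ofReal (t / (n + 1)))) atTop
      (𝓝 (ENNReal.ofReal φ * kFun halfLine (ENNReal.ofReal t) f)) := by
    refine ENNReal.Tendsto.const_mul ?_ (Or.inr ENNReal.ofReal_ne_top)
    refine lintegral_tendsto_of_tendsto_of_monotone ?_ ?_ ?_
    · exact fun n => ((measurable_const.min (measurable_distribution f)).sub
        measurable_const).aemeasurable
    · refine Eventually.of_forall fun s a b hab => tsub_le_tsub_left (ENNReal.ofReal_le_ofReal ?_) _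
      have : (a : ℝ) ≤ b := by exact_mod_cast hab
      gcongr
    · refine Eventually.of_forall fun s => ?_
      have h0 : Tendsto (fun n : ℕ => ENNReal.ofReal (t / (n + 1))) atTop (𝓝 0) := by
        rw [← ENNReal.ofReal_zero]
        refine (ENNReal.continuous_ofReal.tendsto _).comp ?_
        have := (tendsto_one_div_add_atTop_nhds_zero_nat (𝕜 := ℝ)).const_mul t
        simpa [div_eq_mul_inv] using this
      have h1 := ENNReal.Tendsto.sub (tendsto_const_nhds (x := min (ENNReal.ofReal t) (d s))) h0
        (Or.inr ENNReal.zero_ne_top)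
      rwa [tsub_zero] at h1
  exact le_of_tendsto' hlim key

end NormedFunctionSpace.IsSymmetric

/-! ### Growth of the fundamental function forced by functions outside E -/

namespace NormedFunctionSpace.IsSymmetric

variable {𝕜 : Type*} [RCLike 𝕜] {E : NormedFunctionSpace 𝕜}

lemma norm_box_pos {t : ℝ} (ht : 0 < t) (hbox : box 𝕜 0 t ∈ E.carrier) :
    0 < ‖(⟨_, hbox⟩ : E.carrier)‖ := by
  rw [norm_pos_iff]
  intro h0
  have h1 : box 𝕜 0 t = 0 := congrArg Subtype.val h0
  have h2 := distribution_box (𝕜 := 𝕜) 0 (b := t) zero_lt_one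
  have h3 : halfLine {u | ENNReal.ofReal 0 < ‖box 𝕜 0 t u‖ₑ} = 0 := by
    rw [measure_eq_zero_iff_ae_notMem, h1]
    filter_upwards [AEEqFun.coeFn_zero (β := 𝕜) (μ := halfLine)] with u hu
    simp [hu]
  rw [h3] at h2
  simp [not_le.2 ht] at h2

lemma norm_box_mono (hE : E.IsSymmetric) {s t : ℝ} (hst : s ≤ t) (hs : box 𝕜 0 s ∈ E.carrier)
    (ht : box 𝕜 0 t ∈ E.carrier) :
    ‖(⟨_, hs⟩ : E.carrier)‖ ≤ ‖(⟨_, ht⟩ : E.carrier)‖ := by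
  obtain ⟨_, h⟩ := hE.mem_of_distribution_le (x := box 𝕜 0 s) ⟨_, ht⟩ fun r hr => by
    have h1 := distribution_smul_box_le (𝕜 := 𝕜) (b := s) le_rfl zero_le_one hr.le
    rw [RCLike.ofReal_one, one_smul] at h1
    refine h1.trans ?_
    split_ifs with hr1
    · rw [sub_zero]
      exact (ENNReal.ofReal_le_ofReal hst).trans (distribution_box r hr1)
    · exact bot_le
  exact h

/-- An absolutely convergent series of multiples of indicator functions has a sum in `E` which
dominates each of its terms. -/
lemma exists_dominating (hE : E.IsSymmetric) (hbox : ∀ t, box 𝕜 0 t ∈ E.carrier) {b T : ℕ → ℝ} (hb : ∀ k, 0 ≤ b k)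
    (hsum : Summable fun k => b k * ‖(⟨_, hbox (T k)⟩ : E.carrier)‖) :
    ∃ H : E.carrier, ∀ k, ∀ s : ℝ, 0 < s → s < b k → ENNReal.ofReal (T k) ≤
      halfLine {u | ENNReal.ofReal s < ‖(H : ℝ →ₘ[halfLine] 𝕜) u‖ₑ} := by
  have := hE.complete
  let e : ℕ → E.carrier := fun k => (b k : 𝕜) • (⟨_, hbox (T k)⟩ : E.carrier)
  have he : Summable e := Summable.of_norm (hsum.congr fun k => by
    rw [norm_smul, RCLike.norm_ofReal, abs_of_nonneg (hb k)])
  have hlim := he.hasSum.tendsto_sum_nat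
  set H := ∑' k, e k with hH
  refine ⟨H, fun k s hs hsk => ?_⟩
  have hcoe : ∀ n, ∀ᵐ u ∂halfLine, ((∑ i ∈ Finset.range n, e i : E.carrier) : ℝ →ₘ[halfLine] 𝕜) u =
      ((∑ i ∈ Finset.range n, b i * (Ioc 0 (T i)).indicator (fun _ => 1) u : ℝ) : 𝕜) := by
    intro n
    rw [AddSubmonoidClass.coe_finsetSum]
    filter_upwards [AEEqFun.coeFn_fun_finsetSum (Finset.range n)
        (fun i => (e i : ℝ →ₘ[halfLine] 𝕜)),
      ae_all_iff.2 fun i => coeFn_box 𝕜 0 (T i),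
      ae_all_iff.2 fun i => AEEqFun.coeFn_smul (b i : 𝕜) (box 𝕜 0 (T i))] with u h1 h2 h3
    rw [h1, RCLike.ofReal_sum]
    refine Finset.sum_congr rfl fun i _ => ?_
    change ((b i : 𝕜) • box 𝕜 0 (T i)) u = _
    rw [h3 i, Pi.smul_apply, h2 i, smul_eq_mul, RCLike.ofReal_mul]
    congr 1
    by_cases hu : u ∈ Ioc 0 (T i) <;> simp [hu]
  -- On `A` the partial sums past index `k` are at least `b k` while `|H| ≤ s`, so they differ from
  -- `H` by more than `η`. Norm convergence, through the bound on `K(1, ·)`, then makes `A` null.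
  set A : Set ℝ := Ioc 0 (T k) ∩ {u | ‖(H : ℝ →ₘ[halfLine] 𝕜) u‖ₑ ≤ ENNReal.ofReal s} with hA
  set η := (b k - s) / 2 with hη
  have hη0 : 0 < η := by rw [hη]; linarith
  set φ := ‖(⟨_, hbox 1⟩ : E.carrier)‖ with hφ
  have hφ0 : 0 < φ := norm_box_pos zero_lt_one (hbox 1)
  have hAbd : ∀ n, k < n → ENNReal.ofReal φ * (ENNReal.ofReal η * min 1 (halfLine A)) ≤
      ENNReal.ofReal ‖(∑ i ∈ Finset.range n, e i) - H‖ := by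
    intro n hn
    have h1 := hE.norm_box_mul_kFun_le ((∑ i ∈ Finset.range n, e i) - H) zero_lt_one (hbox 1)
    rw [one_mul, ENNReal.ofReal_one] at h1
    refine le_trans ?_ h1
    gcongr
    refine le_trans ?_ (mul_min_le_kFun 1 _ η)
    refine mul_le_mul_right (min_le_min le_rfl (measure_mono_ae ?_)) _
    filter_upwards [hcoe n, AEEqFun.coeFn_sub
      ((∑ i ∈ Finset.range n, e i : E.carrier) : ℝ →ₘ[halfLine] 𝕜) (H : ℝ →ₘ[halfLine] 𝕜)]
      with u h1 h2 hu
    obtain ⟨hu1, hu2⟩ : u ∈ Ioc 0 (T k) ∧ ‖(H : ℝ →ₘ[halfLine] 𝕜) u‖ₑ ≤ ENNReal.ofReal s := hu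
    change _ < _
    rw [Submodule.coe_sub, h2, Pi.sub_apply, h1, ← ofReal_norm,
      ENNReal.ofReal_lt_ofReal_iff_of_nonneg hη0.le]
    rw [← ofReal_norm, ENNReal.ofReal_le_ofReal_iff hs.le] at hu2
    have hge : b k ≤ ∑ i ∈ Finset.range n, b i * (Ioc 0 (T i)).indicator (fun _ => (1 : ℝ)) u := by
      have := Finset.single_le_sum (s := Finset.range n)
        (f := fun i => b i * (Ioc 0 (T i)).indicator (fun _ => (1 : ℝ)) u)
        (fun i _ => mul_nonneg (hb i) (indicator_nonneg (fun _ _ => zero_le_one) _))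
        (Finset.mem_range.2 hn)
      simpa only [indicator_of_mem hu1, mul_one] using this
    have h3 := norm_sub_norm_le ((∑ i ∈ Finset.range n,
      b i * (Ioc 0 (T i)).indicator (fun _ => (1 : ℝ)) u : ℝ) : 𝕜) ((H : ℝ →ₘ[halfLine] 𝕜) u)
    rw [RCLike.norm_ofReal] at h3
    have h4 := le_abs_self (∑ i ∈ Finset.range n,
      b i * (Ioc 0 (T i)).indicator (fun _ => (1 : ℝ)) u)
    linarith
  have hzero : halfLine A = 0 := by
    have h1 : Tendsto (fun n => ENNReal.ofReal ‖(∑ i ∈ Finset.range n, e i) - H‖) atTop (𝓝 0) := by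
      rw [← ENNReal.ofReal_zero]
      exact (ENNReal.continuous_ofReal.tendsto _).comp (tendsto_iff_norm_sub_tendsto_zero.1 hlim)
    have h2 := ge_of_tendsto h1 (eventually_gt_atTop k |>.mono hAbd)
    rw [nonpos_iff_eq_zero, mul_eq_zero, mul_eq_zero] at h2
    rcases h2 with h | h | h
    · simp [not_le.2 hφ0] at h
    · simp [not_le.2 hη0] at h
    · rcases min_eq_iff.1 h with h | h
      · exact absurd h.1 one_ne_zero
      · exact h.1
  rw [← sub_zero (T k), ← halfLine_Ioc le_rfl]
  refine measure_mono_ae ?_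
  filter_upwards [measure_eq_zero_iff_ae_notMem.1 hzero] with u hu hu'
  exact not_le.1 fun h => hu ⟨hu', h⟩

/-- A membership test by layers: the level sets of `g` are compared with those of the sum of the
series, and symmetry of `E` does the rest. -/
lemma mem_of_dominated (hE : E.IsSymmetric) (hbox : ∀ t, box 𝕜 0 t ∈ E.carrier) {b T : ℕ → ℝ} (hb : ∀ k, 0 ≤ b k)
    (hsum : Summable fun k => b k * ‖(⟨_, hbox (T k)⟩ : E.carrier)‖) {g : ℝ →ₘ[halfLine] 𝕜}
    (hg : ∀ s : ℝ, 0 < s → halfLine {u | ENNReal.ofReal s < ‖g u‖ₑ} = 0 ∨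
      ∃ k, s < b k ∧ halfLine {u | ENNReal.ofReal s < ‖g u‖ₑ} ≤ ENNReal.ofReal (T k)) :
    g ∈ E.carrier := by
  obtain ⟨H, hH⟩ := hE.exists_dominating hbox hb hsum
  obtain ⟨h, -⟩ := hE.mem_of_distribution_le (x := g) H fun s hs => by
    rcases hg s hs with h | ⟨k, hk, h⟩
    · rw [h]; exact bot_le
    · exact h.trans (hH k s hs hk)
  exact h

/-- If the fundamental function of `E` is bounded near `∞`, then `E` contains `C₀`. -/
lemma mem_of_mem_C0HalfLine (hE : E.IsSymmetric) (hbox : ∀ t, box 𝕜 0 t ∈ E.carrier) {M : ℝ}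
    (hM : ∀ t, M ≤ t → ‖(⟨_, hbox t⟩ : E.carrier)‖ ≤ M) {g : ℝ →ₘ[halfLine] 𝕜}
    (hg : g ∈ C0HalfLine 𝕜) : g ∈ E.carrier := by
  obtain ⟨hg1, hg2⟩ := hg
  obtain ⟨B, hB0, hB⟩ : ∃ B : ℝ, 0 < B ∧ ∀ᵐ u ∂halfLine, ‖g u‖ₑ ≤ ENNReal.ofReal B := by
    have h1 : eLpNorm g ∞ halfLine < ∞ := Lp.mem_Lp_iff_eLpNorm_lt_top.1 hg1
    refine ⟨(eLpNorm g ∞ halfLine).toReal + 1, by positivity, ?_⟩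
    rw [eLpNorm_exponent_top] at h1 ⊢
    filter_upwards [enorm_ae_le_eLpNormEssSup g halfLine] with u hu
    refine hu.trans ?_
    rw [ENNReal.ofReal_add ENNReal.toReal_nonneg zero_le_one, ENNReal.ofReal_toReal h1.ne]
    exact le_self_add
  have hfin : ∀ s : ℝ, 0 < s → halfLine {u | ENNReal.ofReal s < ‖g u‖ₑ} ≠ ∞ := by
    intro s hs
    obtain ⟨t, ht⟩ := (hg2.eventually (gt_mem_nhds (ENNReal.ofReal_pos.2 hs))).exists
    exact ne_top_of_le_ne_top ENNReal.ofReal_ne_top ((rearrangement_le_iff g t hs.le).1 ht.le)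
  set d : ℝ → ℝ≥0∞ := fun s => halfLine {u | ENNReal.ofReal s < ‖g u‖ₑ} with hd
  have hBk : ∀ k : ℕ, 0 < B * (1 / 2) ^ (k + 1) := fun k => by positivity
  -- Layers at the heights `B / 2 ^ k`, doubled so that `s ≤ B / 2 ^ k` gives the strict `s < b k`.
  -- The maximum with `M` brings every length into the range where the fundamental function is
  -- bounded by `M`, so the series is geometric.
  refine hE.mem_of_dominated hbox (b := fun k => 2 * B * (1 / 2) ^ k)
    (T := fun k => max M (d (B * (1 / 2) ^ (k + 1))).toReal) (fun k => by positivity) ?_ ?_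
  · refine Summable.of_nonneg_of_le (fun k => by positivity)
      (fun k => mul_le_mul_of_nonneg_left (hM _ (le_max_left _ _)) (by positivity)) ?_
    exact ((summable_geometric_of_lt_one (by norm_num) (by norm_num : (1 / 2 : ℝ) < 1)).mul_left
      _).mul_right M
  · intro s hs
    rcases le_or_gt s B with hsB | hsB
    · right
      obtain ⟨k, hk1, hk2⟩ := exists_nat_pow_near_of_lt_one (div_pos hs hB0)
        ((div_le_one hB0).2 hsB) (by norm_num : (0 : ℝ) < 1 / 2) (by norm_num)
      rw [lt_div_iff₀ hB0] at hk1
      rw [div_le_iff₀ hB0] at hk2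
      refine ⟨k, ?_, ?_⟩
      · have : 0 < (1 / 2 : ℝ) ^ k * B := by positivity
        linarith
      · calc d s ≤ d (B * (1 / 2) ^ (k + 1)) := antitone_distribution _ (by linarith)
          _ = ENNReal.ofReal (d (B * (1 / 2) ^ (k + 1))).toReal :=
            (ENNReal.ofReal_toReal (hfin _ (hBk k))).symm
          _ ≤ _ := ENNReal.ofReal_le_ofReal (le_max_right _ _)
    · left
      rw [measure_eq_zero_iff_ae_notMem]
      filter_upwards [hB] with u hu
      exact not_lt.2 (hu.trans (ENNReal.ofReal_le_ofReal hsB.le))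

/-- If the fundamental function of `E` is at most linear near `0`, then `E` contains the integrable
functions which vanish outside a set of measure `1`. -/
lemma mem_of_lintegral_ne_top (hE : E.IsSymmetric) (hbox : ∀ t, box 𝕜 0 t ∈ E.carrier) {M : ℝ}
    (hM : ∀ s, 0 < s → s ≤ 1 → ‖(⟨_, hbox s⟩ : E.carrier)‖ ≤ M * s) {g : ℝ →ₘ[halfLine] 𝕜}
    (hg : ∀ s : ℝ, 0 < s → halfLine {u | ENNReal.ofReal s < ‖g u‖ₑ} ≤ 1)
    (hint : ∫⁻ u, ‖g u‖ₑ ∂halfLine ≠ ∞) : g ∈ E.carrier := by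
  set d : ℝ → ℝ≥0∞ := fun s => halfLine {u | ENNReal.ofReal s < ‖g u‖ₑ} with hd
  have hdt : ∀ s, 0 < s → d s ≠ ∞ := fun s hs => ne_top_of_le_ne_top ENNReal.one_ne_top (hg s hs)
  have hd1 : ∀ s, 0 < s → (d s).toReal ≤ 1 := fun s hs => by
    have := ENNReal.toReal_mono ENNReal.one_ne_top (hg s hs)
    rwa [ENNReal.toReal_one] at this
  have hφ : ∀ s, 0 ≤ s → s ≤ 1 → ‖(⟨_, hbox s⟩ : E.carrier)‖ ≤ M * s := by
    intro s hs hs1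
    rcases hs.eq_or_lt with rfl | hs
    · have : (⟨_, hbox 0⟩ : E.carrier) = 0 := Subtype.ext (box_of_le le_rfl)
      rw [this]; simp
    · exact hM s hs hs1
  -- The integral of the distribution function over `(2 ^ k / 2, 2 ^ k]` is at least `2 ^ k / 2 * d
  -- (2 ^ k)`, and these intervals are disjoint.
  have hsumd : Summable fun k : ℕ => (2 : ℝ) ^ k * (d (2 ^ k)).toReal := by
    have h1 : ∑' k : ℕ, ENNReal.ofReal (2 ^ k / 2) * d (2 ^ k) ≠ ∞ := by
      refine ne_top_of_le_ne_top hint ?_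
      have hmono : Monotone fun k : ℕ => (2 : ℝ) ^ k / 2 := fun a b hab => by
        dsimp only
        gcongr
        norm_num
      have hdisj := hmono.pairwise_disjoint_on_Ioc_succ
      calc ∑' k : ℕ, ENNReal.ofReal (2 ^ k / 2) * d (2 ^ k)
          ≤ ∑' k : ℕ, ∫⁻ s in Ioc ((2 : ℝ) ^ k / 2) (2 ^ (k + 1) / 2), d s := by
            refine ENNReal.tsum_le_tsum fun k => ?_
            calc _ = ∫⁻ s in Ioc ((2 : ℝ) ^ k / 2) (2 ^ (k + 1) / 2), d (2 ^ k) := by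
                  rw [setLIntegral_const, Real.volume_Ioc, mul_comm]
                  congr 2
                  ring
              _ ≤ _ := setLIntegral_mono' measurableSet_Ioc fun s hs =>
                  antitone_distribution _ (hs.2.trans (le_of_eq (by ring)))
        _ = ∫⁻ s in ⋃ k : ℕ, Ioc ((2 : ℝ) ^ k / 2) (2 ^ (k + 1) / 2), d s :=
            (lintegral_iUnion (fun _ => measurableSet_Ioc) hdisj _).symm
        _ ≤ ∫⁻ s in Ioi (0 : ℝ), d s := by
            refine lintegral_mono_set (iUnion_subset fun k s hs => ?_)
            have : (0 : ℝ) < 2 ^ k / 2 := by positivity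
            exact this.trans hs.1
        _ = _ := (lintegral_eq_lintegral_distribution (KWeights.aemeasurable_enorm g)).symm
    refine ((ENNReal.summable_toReal h1).mul_left 2).congr fun k => ?_
    rw [ENNReal.toReal_mul, ENNReal.toReal_ofReal (by positivity)]
    ring
  -- The layer of index `0` has length `1` and serves the levels `s ≤ 1`; the layer `k + 1` serves
  -- the levels in `[2 ^ k, 2 ^ (k + 1))`.
  refine hE.mem_of_dominated hbox (b := fun k => 2 ^ k * 2)
    (T := fun k => Nat.casesOn k 1 fun k => (d (2 ^ k)).toReal) (fun k => by positivity) ?_ ?_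
  · rw [← summable_nat_add_iff 1]
    refine Summable.of_nonneg_of_le (fun k => by positivity)
      (fun k => mul_le_mul_of_nonneg_left (hφ _ ENNReal.toReal_nonneg (hd1 _ (by positivity)))
        (by positivity)) ?_
    refine (hsumd.mul_left (4 * M)).congr fun k => ?_
    rw [pow_succ]
    ring
  · intro s hs
    right
    rcases le_or_gt s 1 with hs1 | hs1
    · exact ⟨0, by norm_num; linarith, by simpa using hg s hs⟩
    · obtain ⟨k, hk1, hk2⟩ := exists_nat_pow_near hs1.le (by norm_num : (1 : ℝ) < 2)
      refine ⟨k + 1, hk2.trans_le (by linarith [pow_pos (zero_lt_two (α := ℝ)) (k + 1)]), ?_⟩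
      change d s ≤ ENNReal.ofReal (d (2 ^ k)).toReal
      rw [ENNReal.ofReal_toReal (hdt _ (by positivity))]
      exact antitone_distribution _ hk1

lemma kFun_le_of_norm_box (hE : E.IsSymmetric) (x : E.carrier) {t C : ℝ} (ht : 0 < t) (hC : 0 < C)
    (hbox : box 𝕜 0 t ∈ E.carrier) (h : C * t ≤ ‖(⟨_, hbox⟩ : E.carrier)‖) :
    kFun halfLine (ENNReal.ofReal t) (fun u => ‖(x : ℝ →ₘ[halfLine] 𝕜) u‖ₑ) ≤
      ENNReal.ofReal (C⁻¹ * ‖x‖) := by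
  have h1 := hE.norm_box_mul_kFun_le x ht hbox
  have hCt : 0 < C * t := by positivity
  have h0 : ENNReal.ofReal (C * t) ≠ 0 := by simpa using hCt
  rw [← ENNReal.mul_le_mul_iff_right h0 ENNReal.ofReal_ne_top]
  calc _ ≤ _ := mul_le_mul_left (ENNReal.ofReal_le_ofReal h) _
    _ ≤ _ := h1
    _ = _ := by
      rw [← ENNReal.ofReal_mul hCt.le]
      congr 1
      field_simp

/-- If `E` does not contain `C₀`, then `K(t, ·) / t` is small on the unit ball of `E` for suitable
large `t`. -/
lemma exists_large (hE : E.IsSymmetric) {g : ℝ →ₘ[halfLine] 𝕜} (hg : g ∈ C0HalfLine 𝕜) (hgE : g ∉ E.carrier) (k : ℕ) :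
    ∃ t : ℝ, 2 ^ k ≤ t ∧ ∀ x : E.carrier,
      kFun halfLine (ENNReal.ofReal t) (fun u => ‖(x : ℝ →ₘ[halfLine] 𝕜) u‖ₑ) ≤
        ENNReal.ofReal (t * ((1 / 2) ^ k * ‖x‖)) := by
  by_cases hbot : E.carrier = ⊥
  · refine ⟨2 ^ k, le_rfl, fun x => ?_⟩
    have h0 : (fun u => ‖(x : ℝ →ₘ[halfLine] 𝕜) u‖ₑ) =ᵐ[halfLine] fun _ => 0 := by
      filter_upwards [AEEqFun.coeFn_zero (β := 𝕜) (μ := halfLine)] with u hu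
      rw [(Submodule.eq_bot_iff _).1 hbot x x.2, hu]
      simp
    rw [kFun_congr h0, kFun_zero]
    exact bot_le
  have hbox := hE.box_mem hbot
  -- Otherwise the fundamental function would be at most `2 ^ k` on `[2 ^ k, ∞)`, and `g` would lie
  -- in `E`.
  obtain ⟨t, ht1, ht2⟩ : ∃ t : ℝ, 2 ^ k ≤ t ∧ 2 ^ k < ‖(⟨_, hbox t⟩ : E.carrier)‖ := by
    by_contra! hcon
    exact hgE (hE.mem_of_mem_C0HalfLine hbox hcon hg)
  have ht : 0 < t := (by positivity : (0 : ℝ) < 2 ^ k).trans_le ht1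
  refine ⟨t, ht1, fun x => ?_⟩
  refine (hE.kFun_le_of_norm_box x ht (by positivity : 0 < 2 ^ k / t) (hbox t) ?_).trans
    (le_of_eq ?_)
  · rw [div_mul_cancel₀ _ ht.ne']
    exact ht2.le
  · congr 1
    rw [inv_div, one_div, inv_pow]
    ring

/-- If `E` does not contain `L₁(0, 1)`, then `K(s, ·)` is small on the unit ball of `E` for suitable
small `s`. -/
lemma exists_small (hE : E.IsSymmetric) {g : ℝ →ₘ[halfLine] 𝕜}
    (hg : ∀ s : ℝ, 0 < s → halfLine {u | ENNReal.ofReal s < ‖g u‖ₑ} ≤ 1)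
    (hint : ∫⁻ u, ‖g u‖ₑ ∂halfLine ≠ ∞) (hgE : g ∉ E.carrier) (k : ℕ) :
    ∃ s : ℝ, 0 < s ∧ s ≤ (1 / 2) ^ k ∧ ∀ x : E.carrier,
      kFun halfLine (ENNReal.ofReal s) (fun u => ‖(x : ℝ →ₘ[halfLine] 𝕜) u‖ₑ) ≤
        ENNReal.ofReal ((1 / 2) ^ k * ‖x‖) := by
  by_cases hbot : E.carrier = ⊥
  · refine ⟨(1 / 2) ^ k, by positivity, le_rfl, fun x => ?_⟩
    have h0 : (fun u => ‖(x : ℝ →ₘ[halfLine] 𝕜) u‖ₑ) =ᵐ[halfLine] fun _ => 0 := by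
      filter_upwards [AEEqFun.coeFn_zero (β := 𝕜) (μ := halfLine)] with u hu
      rw [(Submodule.eq_bot_iff _).1 hbot x x.2, hu]
      simp
    rw [kFun_congr h0, kFun_zero]
    exact bot_le
  have hbox := hE.box_mem hbot
  set φ := ‖(⟨_, hbox 1⟩ : E.carrier)‖ with hφ
  have hφ0 : 0 ≤ φ := norm_nonneg _
  -- The factor `φ + 1` forces `s ≤ 2 ^ (-k)`, because `M * s` stays below the fundamental function
  -- at `s ≤ 1`, hence below `φ`; and `M ≥ 2 ^ k` gives the bound on `K(s, ·)`.
  set M := 2 ^ k * (φ + 1) with hM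
  have hM0 : 0 < M := by positivity
  obtain ⟨s, hs0, hs1, hs⟩ : ∃ s : ℝ, 0 < s ∧ s ≤ 1 ∧ M * s < ‖(⟨_, hbox s⟩ : E.carrier)‖ := by
    by_contra! hcon
    exact hgE (hE.mem_of_lintegral_ne_top hbox hcon hg hint)
  refine ⟨s, hs0, ?_, fun x => ?_⟩
  · have h1 : M * s ≤ φ := hs.le.trans (hE.norm_box_mono hs1 _ _)
    have h2 : 2 ^ k * s ≤ 1 := by
      have h3 : (φ + 1) * (2 ^ k * s) ≤ (φ + 1) * 1 := by
        rw [hM] at h1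
        linarith
      exact le_of_mul_le_mul_left h3 (by positivity)
    rw [one_div, inv_pow, ← one_div, le_div_iff₀ (by positivity)]
    linarith
  · refine (hE.kFun_le_of_norm_box x hs0 hM0 (hbox s) hs.le).trans (ENNReal.ofReal_le_ofReal ?_)
    gcongr
    rw [one_div, inv_pow]
    gcongr
    rw [hM]
    nlinarith [pow_pos (zero_lt_two (α := ℝ)) k]

end NormedFunctionSpace.IsSymmetric

/-! ### Extension by zero and choice of the weights -/

lemma zeroExtend_distribution_le {𝕜 : Type*} [RCLike 𝕜] (f : ℝ →ₘ[unitInt] 𝕜) (s : ℝ) :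
    halfLine {u | ENNReal.ofReal s < ‖zeroExtend f u‖ₑ} ≤ 1 := by
  calc _ ≤ halfLine (Ioc 0 1) := by
        refine measure_mono_ae ?_
        filter_upwards [AEEqFun.coeFn_mk ((Ioo (0 : ℝ) 1).indicator f)
          (((aestronglyMeasurable_indicator_iff measurableSet_Ioo).2
            f.aestronglyMeasurable).restrict (s := Ioi 0))] with u hu h
        have h : ENNReal.ofReal s < ‖zeroExtend f u‖ₑ := h
        rw [show zeroExtend f u = _ from hu] at h
        by_contra hmem
        rw [indicator_of_notMem fun h' => hmem (Ioo_subset_Ioc_self h')] at h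
        simp at h
    _ = 1 := by rw [halfLine_Ioc le_rfl]; simp

lemma lintegral_zeroExtend {𝕜 : Type*} [RCLike 𝕜] (f : ℝ →ₘ[unitInt] 𝕜) :
    ∫⁻ u, ‖zeroExtend f u‖ₑ ∂halfLine = ∫⁻ u, ‖f u‖ₑ ∂unitInt := by
  have h : ∀ᵐ u ∂halfLine, ‖zeroExtend f u‖ₑ = (Ioo (0 : ℝ) 1).indicator (fun u => ‖f u‖ₑ) u := by
    filter_upwards [AEEqFun.coeFn_mk ((Ioo (0 : ℝ) 1).indicator f)
      (((aestronglyMeasurable_indicator_iff measurableSet_Ioo).2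
        f.aestronglyMeasurable).restrict (s := Ioi 0))] with u hu
    rw [show zeroExtend f u = _ from hu]
    by_cases hu : u ∈ Ioo (0 : ℝ) 1 <;> simp [hu]
  rw [lintegral_congr_ae h, lintegral_indicator measurableSet_Ioo,
    Measure.restrict_restrict measurableSet_Ioo, inter_eq_left.2 Ioo_subset_Ioi_self]

lemma ENNReal.tsum_ofReal_half_pow_ne_top (C : ℝ) :
    ∑' k : ℕ, ENNReal.ofReal ((1 / 2) ^ k * C) ^ 2 ≠ ∞ := by
  have h : Summable fun k : ℕ => ((1 / 2 : ℝ) ^ k * |C|) ^ 2 := by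
    refine ((summable_geometric_of_lt_one (by norm_num) (by norm_num : (1 / 4 : ℝ) < 1)).mul_right
      (|C| ^ 2)).congr fun k => ?_
    rw [mul_pow, ← pow_mul, mul_comm k, pow_mul]
    norm_num
  refine ne_top_of_le_ne_top h.tsum_ofReal_ne_top (ENNReal.tsum_le_tsum fun k => ?_)
  rw [ENNReal.ofReal_pow (by positivity)]
  gcongr
  exact le_abs_self C

end

theorem mainTheorem7 {𝕜 : Type*} [RCLike 𝕜] (E : NormedFunctionSpace 𝕜) (hE : E.IsSymmetric)
    (hC : (E.carrier : Set (ℝ →ₘ[halfLine] 𝕜)) ∩ (Lp 𝕜 ∞ halfLine : Set (ℝ →ₘ[halfLine] 𝕜)) ⊂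
      C0HalfLine 𝕜) :
    (∃ F : NormedFunctionSpace 𝕜, F.IsSymmetricKB ∧ E.carrier ≤ F.carrier) ∧
    (E.onUnitInterval ≠ (Lp 𝕜 1 unitInt : Set (ℝ →ₘ[unitInt] 𝕜)) →
      ∃ F : NormedFunctionSpace 𝕜, F.IsSymmetricKB ∧ F.IsReflexive ∧ E.carrier ≤ F.carrier) := by
  obtain ⟨g, hg, hgE⟩ := exists_of_ssubset hC
  have hgE : g ∉ E.carrier := fun h => hgE ⟨h, hg.1⟩
  choose t ht htx using hE.exists_large hg hgE
  have ht0 : ∀ k, 0 < t k := fun k => (by positivity : (0 : ℝ) < 2 ^ k).trans_le (ht k)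
  have htc : ∀ k, (ENNReal.ofReal (t k))⁻¹ * ENNReal.ofReal (t k) = 1 := fun k =>
    ENNReal.inv_mul_cancel (by simpa using ht0 k) ENNReal.ofReal_ne_top
  have hlarge : ∀ x : E.carrier, ∑' k, ((ENNReal.ofReal (t k))⁻¹ * kFun halfLine
      (ENNReal.ofReal (t k)) (fun u => ‖(x : ℝ →ₘ[halfLine] 𝕜) u‖ₑ)) ^ 2 ≠ ∞ := by
    intro x
    refine ne_top_of_le_ne_top (ENNReal.tsum_ofReal_half_pow_ne_top ‖x‖)
      (ENNReal.tsum_le_tsum fun k => ?_)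
    gcongr
    refine (mul_le_mul_right (htx k x) _).trans ?_
    rw [ENNReal.ofReal_mul (ht0 k).le, ← mul_assoc, htc, one_mul]
  refine ⟨?_, fun hne => ?_⟩
  · let w : KWeights ℕ :=
      { c := fun k => (ENNReal.ofReal (t k))⁻¹
        t := fun k => ENNReal.ofReal (t k)
        c_ne_top := fun k => by simpa using ht0 k
        t_ne_zero := fun k => by simpa using ht0 k
        t_ne_top := fun k => ENNReal.ofReal_ne_top
        exists_c_ne_zero := ⟨0, by simp⟩ }
    refine ⟨w.space 𝕜, w.isSymmetricKB_space ?_, fun x hx => ?_⟩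
    · simp [w, htc]
    · rw [KWeights.mem_space]
      refine fun h => hlarge ⟨x, hx⟩ ?_
      have h2 := kNorm_sq (ν := halfLine) w.c w.t fun u => ‖x u‖ₑ
      rw [← h2, show kNorm halfLine w.c w.t _ = ∞ from h]
      rfl
  · obtain ⟨f, hf, hfE⟩ : ∃ f : ℝ →ₘ[unitInt] 𝕜, f ∈ Lp 𝕜 1 unitInt ∧ zeroExtend f ∉ E.carrier := by
      by_contra! hcon
      exact hne (Set.Subset.antisymm (fun f hf => hf.1) fun f hf => ⟨hf, hcon f hf⟩)
    have hfint : ∫⁻ u, ‖zeroExtend f u‖ₑ ∂halfLine ≠ ∞ := by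
      rw [lintegral_zeroExtend, ← eLpNorm_one_eq_lintegral_enorm]
      exact (Lp.mem_Lp_iff_eLpNorm_lt_top.1 hf).ne
    choose s hs0 hs hsx using
      hE.exists_small (fun r _ => zeroExtend_distribution_le f r) hfint hfE
    -- The small arguments with weight `1` make `∑ c²` diverge, and the large ones with weight `1 /
    -- t` make `∑ (c t)²` diverge. The sum `∑ c² t = ∑ s_k + ∑ 1 / t_k` is finite, both parts being
    -- dominated by `∑ 2^(-k)`.
    let w : KWeights (ℕ ⊕ ℕ) :=
      { c := Sum.elim (fun _ => 1) fun k => (ENNReal.ofReal (t k))⁻¹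
        t := Sum.elim (fun k => ENNReal.ofReal (s k)) fun k => ENNReal.ofReal (t k)
        c_ne_top := by rintro (k | k) <;> simp [ht0 k]
        t_ne_zero := by rintro (k | k) <;> simp [ht0 k, hs0 k]
        t_ne_top := by rintro (k | k) <;> simp
        exists_c_ne_zero := ⟨Sum.inl 0, by simp⟩ }
    have hsplit : ∀ a : ℕ ⊕ ℕ → ℝ≥0∞, ∑' k, a k = ∑' k, a (Sum.inl k) + ∑' k, a (Sum.inr k) :=
      fun a => Summable.tsum_sum ENNReal.summable ENNReal.summable
    have hgeom : ∑' k : ℕ, ENNReal.ofReal ((1 / 2) ^ k) ≠ ∞ :=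
      (summable_geometric_of_lt_one (by norm_num) (by norm_num : (1 / 2 : ℝ) < 1)).tsum_ofReal_ne_top
    have hw1 : ∑' k, w.c k ^ 2 = ∞ := by rw [hsplit]; simp [w]
    have hw2 : ∑' k, (w.c k * w.t k) ^ 2 = ∞ := by rw [hsplit]; simp [w, htc]
    have hw3 : ∑' k, w.c k ^ 2 * w.t k ≠ ∞ := by
      rw [hsplit]
      refine ENNReal.add_ne_top.2 ⟨ne_top_of_le_ne_top hgeom (ENNReal.tsum_le_tsum fun k => ?_),
        ne_top_of_le_ne_top hgeom (ENNReal.tsum_le_tsum fun k => ?_)⟩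
      · simpa [w] using ENNReal.ofReal_le_ofReal (hs k)
      · change (ENNReal.ofReal (t k))⁻¹ ^ 2 * ENNReal.ofReal (t k) ≤ _
        rw [sq, mul_assoc, htc, mul_one, ← ENNReal.ofReal_inv_of_pos (ht0 k), one_div, inv_pow]
        exact ENNReal.ofReal_le_ofReal (inv_anti₀ (by positivity) (ht k))
    refine ⟨w.space 𝕜, w.isSymmetricKB_space hw2, w.isReflexive_space hw1 hw2 hw3, fun x hx => ?_⟩
    rw [KWeights.mem_space]
    intro h
    have h2 := kNorm_sq (ν := halfLine) w.c w.t fun u => ‖x u‖ₑ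
    rw [show kNorm halfLine w.c w.t _ = ∞ from h, hsplit] at h2
    have hsmall : ∑' k, (1 * kFun halfLine (ENNReal.ofReal (s k)) fun u => ‖x u‖ₑ) ^ 2 ≠ ∞ := by
      refine ne_top_of_le_ne_top (ENNReal.tsum_ofReal_half_pow_ne_top ‖(⟨x, hx⟩ : E.carrier)‖)
        (ENNReal.tsum_le_tsum fun k => ?_)
      rw [one_mul]
      gcongr
      exact hsx k ⟨x, hx⟩
    exact ENNReal.add_ne_top.2 ⟨hsmall, hlarge ⟨x, hx⟩⟩ (h2.symm.trans rfl)
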